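/- Let $X$ be a smooth projective curve over an algebraically closed field $\mathbb{K}$ of characteristic $\neq 2$, let $x\in X$ be a closed point with local ring $\mathcal{O}_{X,x}$ and maximal ideal $\mathfrak{m}$, and let $\epsilon$ denote a generator of $\mathfrak m/\mathfrak m^2$. For a vector bundle $M$ on $X$ write $M_x=M\otimes\mathcal{O}/\mathfrak{m}$ and $M_{2x}=M\otimes\mathcal{O}/\mathfrak{m}^2$, so that there is an exact sequence $0\to\epsilon M_x\to M_{2x}\to M_x\to 0$. For a submodule $P\subset M_{2x}$, the Hecke transform of $M$ along $P$ is $\ker(M\to M_{2x}/P)$. Let $E$ be an orthogonal bundle of rank $6$. A submodule $L\subset E_{2x}$ is called Lagrangian if it is isotropic for the induced $\mathcal{O}/\mathfrak{m}^2$-valued quadratic form and $\dim_{\mathbb K}L=6$; write $L\in \mathrm{O}\Sigma_i$ if moreover the image of $L$ in $E_x$ has dimension $i$. The orthogonal Hecke transform is $\mathcal{H}(E,L)=E'(x)$, where $E'=\ker(E\to E_{2x}/L)$, with the form extending that of $E$. Let $F$ be a vector bundle of rank $4$ and suppose that either (A) $E=\Lambda^2F$ with $\det F\cong\mathcal{O}_X$,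 or (B) $E=(\Lambda^2F)(x)$ with $\det F\cong\mathcal{O}_X(-2x)$, where $E$ carries the form $(\omega,\omega')\mapsto\omega\wedge\omega'$ defined by the isomorphism. For $P,Q\subset F_{2x}$ write $P\wedge Q$ for the span of all $p\wedge q$ ($p\in P$, $q\in Q$) in $(\Lambda^2F)_{2x}$, and in case (B) also for the corresponding submodule of $(\Lambda^2F)(x)_{2x}=(\Lambda^2F)_{2x}\otimes\mathcal{O}(x)$; use the same convention for subspaces of $E_x$. The set $\mathrm{O}\Sigma_3$ is the disjoint union of $\mathrm{O}\Sigma_3^{(0)}$, consisting of the $L$ whose image in $E_x$ is $\Lambda^2W$ for a hyperplane $W\subset F_x$, and $\mathrm{O}\Sigma_3^{(1)}$, consisting of the $L$ whose image in $E_x$ is $D\wedge F_x$ for a line $D\subset F_x$. Say that a submodule $P\subset F_{2x}$ is attached to $L$ if: 1. for $L\in\mathrm{O}\Sigma_1$: there is an exact sequence $0\to\epsilon F_x\to P\to K\to0$ with $K\subset F_x$, $\dim K=2$, and $L=P\wedge P$; 2. for $L\in\mathrm{O}\Sigma_2$: there is an exact sequence $0\to\epsilon W\to P\to D\to0$ with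 a line $D$ contained in a hyperplane $W\subset F_x$, and $L=P\wedge W_2$, where $W_2\subset F_{2x}$ is the preimage of $W$; 3. for $L\in\mathrm{O}\Sigma_3^{(0)}$: there is an exact sequence $0\to\epsilon W\to P\to W\to0$ with a hyperplane $W\subset F_x$, and $L=P\wedge P$; 4. for $L\in\mathrm{O}\Sigma_3^{(1)}$: there is an exact sequence $0\to\epsilon D\to P\to D\to0$ with a line $D\subset F_x$, and $L=P\wedge F_{2x}$. (In each case the exact sequence is the restriction of $0\to\epsilon F_x\to F_{2x}\to F_x\to0$.) Then for each $L$ in one of these four sets there exists a submodule $P\subset F_{2x}$ attached to $L$, and for every such $P$, with $F'$ the Hecke transform of $F$ along $P$, there is an isomorphism of orthogonal bundles, in case (A) (respectively (B)): 1. $L\in\mathrm{O}\Sigma_1$: $\mathcal{H}(E,L)\cong(\Lambda^2F')(x)$ (resp. $\Lambda^2(F'(x))$); 2. $L\in\mathrm{O}\Sigma_2$: $\mathcal{H}(E,L)\cong\Lambda^2(F'(x))$ (resp. $(\Lambda^2(F'(x)))(x)$); 3. $L\in\mathrm{O}\Sigma_3^{(0)}$: $\mathcal{H}(E,L)\cong(\Lambda^2F')(x)$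 (resp. $\Lambda^2(F'(x))$); 4. $L\in\mathrm{O}\Sigma_3^{(1)}$: $\mathcal{H}(E,L)\cong(\Lambda^2(F'(x)))(x)$ (resp. $\Lambda^2(F'(2x))$). Here a right-hand side $\Lambda^2G$ (resp. $(\Lambda^2G)(x)$) carries the form given by the exterior product and some isomorphism $\det G\cong\mathcal{O}_X$ (resp. $\det G\cong\mathcal{O}_X(-2x)$), whose existence is part of the statement. -/

import Mathlib

universe u

open CategoryTheory AlgebraicGeometry Opposite TopologicalSpace IsLocalRing

namespace OrthHecke

noncomputable section

/-! ### Sections, germs and stalks of sheaves of modules -/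

/-- The stalk of an `𝒪_X`-module at `x` is a module over the local ring `𝒪_{X,x}`. -/
instance stalkModule {X : Scheme.{u}} (M : X.Modules) (x : X) :
    Module (X.presheaf.stalk x) (M.presheaf.stalk x) :=
  PresheafOfModules.instModuleCarrierStalkCommRingCatCarrierAbPresheafOpensCarrier
    (X := X.carrier) (R := X.presheaf) M.val x

theorem germ_smul {X : Scheme.{u}} (M : X.Modules) (x : X) (U : X.Opens) (hx : x ∈ U)
    (r : Γ(X, U)) (m : Γ(M, U)) : M.presheaf.germ U x hx (r • m) =
      X.presheaf.germ U x hx r • M.presheaf.germ U x hx m :=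
  PresheafOfModules.germ_smul (X := X.carrier) (R := X.presheaf) M.val x U hx r m

variable {X : Scheme.{u}} (M : X.Modules)

/-- Restriction of sections of a sheaf of modules. -/
def res {U V : X.Opens} (h : V ≤ U) (s : Γ(M, U)) : Γ(M, V) :=
  M.presheaf.map (homOfLE h).op s

/-- Restriction of regular functions. -/
def resO {U V : X.Opens} (h : V ≤ U) (s : Γ(X, U)) : Γ(X, V) :=
  X.presheaf.map (homOfLE h).op s

theorem res_smul {U V : X.Opens} (h : V ≤ U) (r : Γ(X, U)) (s : Γ(M, U)) :
    res M h (r • s) = resO h r • res M h s := M.map_smul _ _ _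

theorem res_add {U V : X.Opens} (h : V ≤ U) (s t : Γ(M, U)) :
    res M h (s + t) = res M h s + res M h t := map_add _ _ _

theorem res_res {U V W : X.Opens} (h : V ≤ U) (h' : W ≤ V) (s : Γ(M, U)) :
    res M h' (res M h s) = res M (h'.trans h) s := by
  simp only [res, ← ConcreteCategory.comp_apply, ← Functor.map_comp]; rfl

theorem germ_res {U V : X.Opens} (h : V ≤ U) (x : X) (hx : x ∈ V) (s : Γ(M, U)) :
    M.presheaf.germ V x hx (res M h s) = M.presheaf.germ U x (h hx) s :=
  TopCat.Presheaf.germ_res_apply _ _ _ _ _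

theorem germ_resO {U V : X.Opens} (h : V ≤ U) (x : X) (hx : x ∈ V) (s : Γ(X, U)) :
    X.presheaf.germ V x hx (resO h s) = X.presheaf.germ U x (h hx) s :=
  TopCat.Presheaf.germ_res_apply _ _ _ _ _

theorem app_res {M N : X.Modules} (φ : M ⟶ N) {U V : X.Opens} (h : V ≤ U) (s : Γ(M, U)) :
    φ.app V (res M h s) = res N h (φ.app U s) :=
  ConcreteCategory.congr_hom (φ.mapPresheaf.naturality (homOfLE h).op) s

theorem germ_stalkFunctor_map {M N : X.Modules} (φ : M ⟶ N) (x : X) (U : X.Opens) (hx : x ∈ U)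
    (s : Γ(M, U)) :
    (TopCat.Presheaf.stalkFunctor Ab x).map φ.mapPresheaf (M.presheaf.germ U x hx s) =
      N.presheaf.germ U x hx (φ.app U s) :=
  TopCat.Presheaf.stalkFunctor_map_germ_apply U x hx φ.mapPresheaf s

/-- The `𝒪_{X,x}`-linear map induced on stalks by a morphism of `𝒪_X`-modules. -/
def stalkMap {M N : X.Modules} (φ : M ⟶ N) (x : X) :
    M.presheaf.stalk x →ₗ[X.presheaf.stalk x] N.presheaf.stalk x where
  toFun := (TopCat.Presheaf.stalkFunctor Ab x).map φ.mapPresheaf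
  map_add' := map_add _
  map_smul' r m := by
    obtain ⟨U, hU, r, rfl⟩ := X.presheaf.exists_germ_eq r
    obtain ⟨V, hV, m, rfl⟩ := TopCat.Presheaf.exists_germ_eq M.presheaf m
    have hx : x ∈ (U : X.Opens) ⊓ V := ⟨hU, hV⟩
    rw [← germ_resO (inf_le_left : (U : X.Opens) ⊓ V ≤ U) x hx r,
      ← germ_res M (inf_le_right : (U : X.Opens) ⊓ V ≤ V) x hx m, ← germ_smul]
    simp only [RingHom.id_apply]
    rw [germ_stalkFunctor_map, germ_stalkFunctor_map, Scheme.Modules.Hom.app_smul, germ_smul]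

/-- The structure sheaf as a module over itself. -/
def structureModule (X : Scheme.{u}) : X.Modules := SheafOfModules.unit X.ringCatSheaf

/-- Sections of `𝒪_X`, viewed as a sheaf of modules, are regular functions. -/
def toFunction {U : X.Opens} (s : Γ(structureModule X, U)) : Γ(X, U) := s

/-- `M` is a vector bundle of rank `r`: every point has an open neighbourhood `U` with sections
`e₁, …, e_r` of `M` over `U` inducing an isomorphism `𝒪_U^r ≅ M|_U`. -/
def IsVectorBundle (r : ℕ) : Prop :=
  ∀ y : X, ∃ (U : X.Opens) (_ : y ∈ U) (e : Fin r → Γ(M, U)), ∀ (V : X.Opens) (h : V ≤ U),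
    LinearIndependent Γ(X, V) (fun i => res M h (e i)) ∧
      Submodule.span Γ(X, V) (Set.range fun i => res M h (e i)) = ⊤

/-! ### Subsheaves cut out by a condition at a point -/

/-- The sections of `M` over `U` whose germ at `x` lies in `N` (no condition if `x ∉ U`). -/
def subAtSections (x : X) (N : Submodule (X.presheaf.stalk x) (M.presheaf.stalk x))
    (U : X.Opens) : Submodule Γ(X, U) Γ(M, U) where
  carrier := {s | ∀ hx : x ∈ U, M.presheaf.germ U x hx s ∈ N}
  add_mem' := fun ha hb hx => by rw [map_add]; exact N.add_mem (ha hx) (hb hx)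
  zero_mem' := fun hx => by rw [map_zero]; exact N.zero_mem
  smul_mem' := fun c s hs hx => by rw [germ_smul]; exact N.smul_mem _ (hs hx)

/-- The same, as a presheaf of submodules. -/
def subAtPresheaf (x : X) (N : Submodule (X.presheaf.stalk x) (M.presheaf.stalk x)) :
    PresheafOfModules.Submodule M.val where
  obj U := subAtSections M x N U.unop
  map f s hs := fun hx => by
    have h := germ_res M (leOfHom f.unop) x hx s
    have h' := hs (leOfHom f.unop hx)
    rw [← h] at h'
    exact h'

theorem subAtPresheaf_isSheaf (x : X)
    (N : Submodule (X.presheaf.stalk x) (M.presheaf.stalk x)) :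
    TopCat.Presheaf.IsSheaf (subAtPresheaf M x N).toPresheafOfModules.presheaf := by
  rw [TopCat.Presheaf.isSheaf_iff_isSheafUniqueGluing]
  intro ι U sf hsf
  obtain ⟨s, hs, huniq⟩ := M.isSheaf.isSheafUniqueGluing U (fun i => (sf i).1)
    fun i j => congrArg Subtype.val (hsf i j)
  refine ⟨⟨s, fun hx => ?_⟩, fun i => Subtype.ext (hs i), fun t ht =>
    Subtype.ext (huniq t.1 fun i => congrArg Subtype.val (ht i))⟩
  obtain ⟨i, hi⟩ := Opens.mem_iSup.mp hx
  have h1 : res M (le_iSup U i) s = (sf i).1 := hs i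
  have h2 := germ_res M (le_iSup U i) x hi s
  rw [h1] at h2
  have h3 : M.presheaf.germ (U i) x hi (sf i).1 ∈ N := (sf i).2 hi
  rw [h2] at h3
  exact h3

/-- The subsheaf of `M` of all sections whose germ at `x` lies in the submodule `N` of the
stalk `M_x`. -/
def subAt (x : X) (N : Submodule (X.presheaf.stalk x) (M.presheaf.stalk x)) : X.Modules where
  val := (subAtPresheaf M x N).toPresheafOfModules
  isSheaf := subAtPresheaf_isSheaf M x N

/-- The inclusion of `subAt M x N` into `M`. -/
def subAtι (x : X) (N : Submodule (X.presheaf.stalk x) (M.presheaf.stalk x)) :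
    subAt M x N ⟶ M := ⟨(subAtPresheaf M x N).ι⟩

/-- A morphism into `M` whose sections satisfy the condition at `x` factors through
`subAt M x N`. -/
def subAtLift (x : X) (N : Submodule (X.presheaf.stalk x) (M.presheaf.stalk x))
    {M' : X.Modules} (φ : M' ⟶ M)
    (h : ∀ U (s : Γ(M', U)), φ.app U s ∈ subAtSections M x N U) : M' ⟶ subAt M x N :=
  ⟨PresheafOfModules.homMk
    { app U := AddCommGrpCat.ofHom
        ((φ.app U.unop).hom.codRestrict (subAtSections M x N U.unop).toAddSubgroup (h U.unop))
      naturality _ _ f := by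
        ext s
        exact Subtype.ext (app_res φ (leOfHom f.unop) s) }
    (by
      intro U r s
      exact Subtype.ext (φ.app_smul r s))⟩

theorem subAtLift_ι (x : X) (N : Submodule (X.presheaf.stalk x) (M.presheaf.stalk x))
    {M' : X.Modules} (φ : M' ⟶ M) (h) : subAtLift M x N φ h ≫ subAtι M x N = φ := rfl

/-! ### Twists by multiples of a point -/

/-- `M(-kx)`, the sections of `M` whose germ at `x` lies in `𝔪_x^k M_x`. -/
def twistNeg (x : X) (k : ℕ) : X.Modules :=
  subAt M x (maximalIdeal (X.presheaf.stalk x) ^ k • ⊤)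

/-- The complement of the (closed) point `x`. -/
def punctured (x : X) : X.Opens := ⟨(closure {x})ᶜ, isClosed_closure.isOpen_compl⟩

/-- The sheaf `j_* j^* M`, where `j` is the inclusion of the complement of `x`; its sections over
`U` are the sections of `M` over `U ∖ {x}`. -/
def away (x : X) : X.Modules :=
  (Scheme.Modules.pushforward (punctured x).ι).obj (M.restrict (punctured x).ι)

/-- The restriction map `M ⟶ j_* j^* M`. -/
def toAway (x : X) : M ⟶ away M x :=
  (Scheme.Modules.restrictAdjunction (punctured x).ι).unit.app M

/-- The germs at `x` of sections of `M` with a pole of order at most `n` at `x`: those `σ` for which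
`𝔪_x^n σ` consists of germs of sections of `M`. -/
def poleGerms (x : X) (n : ℕ) :
    Submodule (X.presheaf.stalk x) ((away M x).presheaf.stalk x) where
  carrier := {σ | ∀ f ∈ maximalIdeal (X.presheaf.stalk x) ^ n,
    f • σ ∈ LinearMap.range (stalkMap (toAway M x) x)}
  add_mem' ha hb f hf := by rw [smul_add]; exact Submodule.add_mem _ (ha f hf) (hb f hf)
  zero_mem' f hf := by rw [smul_zero]; exact Submodule.zero_mem _
  smul_mem' c σ hσ f hf := by rw [smul_comm]; exact Submodule.smul_mem _ _ (hσ f hf)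

/-- The twist `M(nx)` of a vector bundle `M` on a smooth curve, for `n ≥ 0`: the sections over `U`
are the sections of `M` over `U ∖ {x}` with a pole of order at most `n` at `x`. -/
def twist (x : X) (n : ℕ) : X.Modules := subAt (away M x) x (poleGerms M x n)

/-- The natural map `M ⟶ M(nx)`. -/
def toTwist (x : X) (n : ℕ) : M ⟶ twist M x n :=
  subAtLift (away M x) x (poleGerms M x n) (toAway M x) fun U s hx f _ => by
    rw [← germ_stalkFunctor_map (toAway M x)]
    exact Submodule.smul_mem _ _ ⟨_, rfl⟩

/-! ### Exterior powers -/

/-- The semilinear map induced on exterior powers by a semilinear map. -/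
def exteriorMap {A B : Type u} [CommRing A] [CommRing B] (φ : A →+* B) {N N' : Type u}
    [AddCommGroup N] [Module A N] [AddCommGroup N'] [Module B N'] (n : ℕ) (g : N →ₛₗ[φ] N') :
    ⋀[A]^n N →ₛₗ[φ] ⋀[B]^n N' :=
  letI : Module A (⋀[B]^n N') := Module.compHom _ φ
  let f : N [⋀^Fin n]→ₗ[A] (⋀[B]^n N') :=
    { toFun m := exteriorPower.ιMulti B n (g ∘ m)
      map_update_add' m i a b := by
        have h (c : N) : g ∘ Function.update m i c = Function.update (g ∘ m) i (g c) :=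
          Function.comp_update g m i c
        rw [h, h, h, map_add, AlternatingMap.map_update_add]
      map_update_smul' m i a b := by
        have h (c : N) : g ∘ Function.update m i c = Function.update (g ∘ m) i (g c) :=
          Function.comp_update g m i c
        rw [h, h, map_smulₛₗ, AlternatingMap.map_update_smul]; rfl
      map_eq_zero_of_eq' m i j hij hne :=
        (exteriorPower.ιMulti B n).map_eq_zero_of_eq _ (congrArg g hij) hne }
  let F := exteriorPower.alternatingMapLinearEquiv f
  { toFun := F
    map_add' := F.map_add
    map_smul' := F.map_smul }

theorem exteriorMap_ιMulti {A B : Type u} [CommRing A] [CommRing B] (φ : A →+* B) {N N' : Type u}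
    [AddCommGroup N] [Module A N] [AddCommGroup N'] [Module B N'] (n : ℕ) (g : N →ₛₗ[φ] N')
    (m : Fin n → N) :
    exteriorMap φ n g (exteriorPower.ιMulti A n m) = exteriorPower.ιMulti B n (g ∘ m) := by
  let _ : Module A (⋀[B]^n N') := Module.compHom _ φ
  exact exteriorPower.alternatingMapLinearEquiv_apply_ιMulti _ _

/-- Restriction of sections as a semilinear map. -/
def resLinear {U V : X.Opens} (h : V ≤ U) :
    Γ(M, U) →ₛₗ[(X.presheaf.map (homOfLE h).op).hom] Γ(M, V) where
  toFun s := res M h s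
  map_add' := res_add M _
  map_smul' := res_smul M _

/-- The restriction map `⋀^n M(U) → ⋀^n M(V)`. -/
def exteriorRes (n : ℕ) {U V : X.Opens} (h : V ≤ U) :
    ⋀[Γ(X, U)]^n Γ(M, U) →ₛₗ[(X.presheaf.map (homOfLE h).op).hom] ⋀[Γ(X, V)]^n Γ(M, V) :=
  exteriorMap _ n (resLinear M h)

theorem exteriorRes_id (n : ℕ) {U : X.Opens} (ω : ⋀[Γ(X, U)]^n Γ(M, U)) :
    exteriorRes M n le_rfl ω = ω := by
  have hω : ω ∈ Submodule.span Γ(X, U) (Set.range (exteriorPower.ιMulti Γ(X, U) n)) := by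
    rw [exteriorPower.ιMulti_span]; trivial
  induction hω using Submodule.span_induction with
  | mem ω hω =>
    obtain ⟨m, rfl⟩ := hω
    rw [exteriorRes, exteriorMap_ιMulti]
    congr 1
    ext i
    exact ConcreteCategory.congr_hom (M.presheaf.map_id (op U)) (m i)
  | zero => exact map_zero _
  | add a b _ _ ha hb => rw [map_add, ha, hb]
  | smul r a _ ha =>
    rw [map_smulₛₗ, ha]
    congr 1
    exact ConcreteCategory.congr_hom (X.presheaf.map_id (op U)) r

theorem exteriorRes_exteriorRes (n : ℕ) {U V W : X.Opens} (h : V ≤ U) (h' : W ≤ V)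
    (ω : ⋀[Γ(X, U)]^n Γ(M, U)) :
    exteriorRes M n h' (exteriorRes M n h ω) = exteriorRes M n (h'.trans h) ω := by
  have hω : ω ∈ Submodule.span Γ(X, U) (Set.range (exteriorPower.ιMulti Γ(X, U) n)) := by
    rw [exteriorPower.ιMulti_span]; trivial
  induction hω using Submodule.span_induction with
  | mem ω hω =>
    obtain ⟨m, rfl⟩ := hω
    rw [exteriorRes, exteriorRes, exteriorRes, exteriorMap_ιMulti, exteriorMap_ιMulti,
      exteriorMap_ιMulti]
    congr 1
    ext i
    exact res_res M h h' (m i)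
  | zero => simp only [map_zero]
  | add a b _ _ ha hb => rw [map_add, map_add, map_add, ha, hb]
  | smul r a _ ha =>
    rw [map_smulₛₗ, map_smulₛₗ, map_smulₛₗ, ha]
    congr 1
    exact (ConcreteCategory.congr_hom (X.presheaf.map_comp (homOfLE h).op (homOfLE h').op) r).symm

/-- The presheaf of modules `U ↦ ⋀^n M(U)`. -/
def exteriorPresheaf (n : ℕ) : X.PresheafOfModules where
  obj U := ModuleCat.of Γ(X, U.unop) (⋀[Γ(X, U.unop)]^n Γ(M, U.unop))
  map f := ModuleCat.semilinearMapAddEquiv _ _ _ (exteriorRes M n (leOfHom f.unop))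
  map_id U := by
    refine ModuleCat.hom_ext (LinearMap.ext fun ω => ?_)
    exact exteriorRes_id M n ω
  map_comp f g := by
    refine ModuleCat.hom_ext (LinearMap.ext fun ω => ?_)
    exact (exteriorRes_exteriorRes M n (leOfHom f.unop) (leOfHom g.unop) ω).symm

/-- The exterior power `Λ^n M`: the sheafification of `U ↦ ⋀^n M(U)`. -/
def extPower (n : ℕ) : X.Modules :=
  (PresheafOfModules.sheafification (𝟙 X.ringCatSheaf.obj)).obj (exteriorPresheaf M n)

/-- The section `s₁ ∧ ⋯ ∧ s_n` of `Λ^n M`. -/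
def wedge {M : X.Modules} {n : ℕ} {U : X.Opens} (s : Fin n → Γ(M, U)) : Γ(extPower M n, U) :=
  ((PresheafOfModules.sheafificationAdjunction (𝟙 X.ringCatSheaf.obj)).unit.app
    (exteriorPresheaf M n)).app (op U) (exteriorPower.ιMulti Γ(X, U) n s)

/-! ### The fibres over `x` and over the divisor `2x`, and Hecke transforms -/

/-- The fibre `M_x = M̂_x ⊗ 𝒪/𝔪`. -/
abbrev fiber (x : X) : Type u :=
  M.presheaf.stalk x ⧸
    (maximalIdeal (X.presheaf.stalk x) • ⊤ :
      Submodule (X.presheaf.stalk x) (M.presheaf.stalk x))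

/-- The module `M_{2x} = M̂_x ⊗ 𝒪/𝔪²`. Its `𝒪/𝔪²`-submodules are its `𝒪_{X,x}`-submodules. -/
abbrev fiber2 (x : X) : Type u :=
  M.presheaf.stalk x ⧸
    (maximalIdeal (X.presheaf.stalk x) ^ 2 • ⊤ :
      Submodule (X.presheaf.stalk x) (M.presheaf.stalk x))

/-- The quotient map from the stalk to `M_{2x}`. -/
def mk2 (x : X) : M.presheaf.stalk x →ₗ[X.presheaf.stalk x] fiber2 M x := Submodule.mkQ _

/-- The reduction map `M_{2x} → M_x`; its kernel `εM_x` is `𝔪 M_{2x}`. -/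
def red (x : X) : fiber2 M x →ₗ[X.presheaf.stalk x] fiber M x :=
  Submodule.factor (Submodule.smul_mono_left (Ideal.pow_le_self two_ne_zero))

/-- The class in `M_{2x}` of a section of `M` defined near `x`. -/
def jet {M : X.Modules} {x : X} {U : X.Opens} (hx : x ∈ U) (s : Γ(M, U)) : fiber2 M x :=
  mk2 M x (M.presheaf.germ U x hx s)

/-- The Hecke transform of `M` along `P ⊂ M_{2x}`: the kernel of `M → M_{2x}/P`. -/
def hecke (x : X) (P : Submodule (X.presheaf.stalk x) (fiber2 M x)) : X.Modules :=
  subAt M x (P.comap (mk2 M x))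

/-- The inclusion of the Hecke transform. -/
def heckeι (x : X) (P : Submodule (X.presheaf.stalk x) (fiber2 M x)) : hecke M x P ⟶ M :=
  subAtι M x _

/-! ### Orthogonal bundles, Lagrangian submodules and orthogonal Hecke transforms -/

/-- A non-degenerate symmetric bilinear form `E × E → 𝒪_X`; non-degenerate means that it is
non-degenerate on every fibre `E ⊗ κ(y)`. -/
structure OrthogonalForm (E : X.Modules) where
  /-- the bilinear form on sections over `U` -/
  form (U : X.Opens) : LinearMap.BilinForm Γ(X, U) Γ(E, U)
  form_res {U V : X.Opens} (h : V ≤ U) (s t : Γ(E, U)) :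
    form V (res E h s) (res E h t) = resO h (form U s t)
  symm (U : X.Opens) (s t : Γ(E, U)) : form U s t = form U t s
  nondegenerate (y : X) (U : X.Opens) (hy : y ∈ U) (s : Γ(E, U))
    (hs : ∀ (V : X.Opens) (hV : V ≤ U) (hyV : y ∈ V) (t : Γ(E, V)),
      X.presheaf.germ V y hyV (form V (res E hV s) t) ∈ maximalIdeal (X.presheaf.stalk y)) :
    E.presheaf.germ U y hy s ∈ (maximalIdeal (X.presheaf.stalk y) • ⊤ :
      Submodule (X.presheaf.stalk y) (E.presheaf.stalk y))

/-- `L ⊂ E_{2x}` is Lagrangian, where `E` is an orthogonal bundle of rank `r`: it is isotropic for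
the quadratic form induced on `E_{2x}` with values in `𝒪/𝔪²`, and it has dimension `r`. As the
residue field at a closed point is the ground field, dimension is length over `𝒪_{X,x}`. -/
def IsLagrangian {E : X.Modules} (b : OrthogonalForm E) (x : X) (r : ℕ)
    (L : Submodule (X.presheaf.stalk x) (fiber2 E x)) : Prop :=
  (∀ (U : X.Opens) (hx : x ∈ U) (s : Γ(E, U)), jet hx s ∈ L →
    X.presheaf.germ U x hx (b.form U s s) ∈ maximalIdeal (X.presheaf.stalk x) ^ 2) ∧
  Module.length (X.presheaf.stalk x) L = r

/-- The stratum `OΣ_i` for an orthogonal bundle of rank `6`: the Lagrangian submodules whose image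
in `E_x` has dimension `i`. -/
def OSigma {E : X.Modules} (b : OrthogonalForm E) (x : X) (i : ℕ) :
    Set (Submodule (X.presheaf.stalk x) (fiber2 E x)) :=
  {L | IsLagrangian b x 6 L ∧ Module.length (X.presheaf.stalk x) (L.map (red E x)) = i}

/-- The orthogonal Hecke transform `ℋ(E, L) = E'(x)`, where `E'` is the kernel of
`E → E_{2x}/L`. -/
def orthogonalHecke (E : X.Modules) (x : X)
    (L : Submodule (X.presheaf.stalk x) (fiber2 E x)) : X.Modules :=
  twist (hecke E x L) x 1

/-- The form on `ℋ(E, L) = E'(x)` is the one that extends the restriction to `E'` of the form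
of `E`. -/
def ExtendsForm {E : X.Modules} {x : X} {L : Submodule (X.presheaf.stalk x) (fiber2 E x)}
    (b : OrthogonalForm E) (b' : OrthogonalForm (orthogonalHecke E x L)) : Prop :=
  ∀ (U : X.Opens) (s t : Γ(hecke E x L, U)),
    b'.form U ((toTwist (hecke E x L) x 1).app U s) ((toTwist (hecke E x L) x 1).app U t) =
      b.form U ((heckeι E x L).app U s) ((heckeι E x L).app U t)

/-! ### Orthogonal bundles of rank six -/

/-- The bundle `(Λ²F)(mx)`. -/
def sixBundle (F : X.Modules) (x : X) (m : ℕ) : X.Modules := twist (extPower F 2) x m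

/-- For `F` of rank `4` and `δ : det F ≅ 𝒪_X(-2mx)`, the form `b` on `(Λ²F)(mx)` is the one induced
by the exterior product, `b(s₁ ∧ s₂, s₃ ∧ s₄) = δ(s₁ ∧ s₂ ∧ s₃ ∧ s₄)`. -/
def IsWedgeForm {F : X.Modules} {x : X} {m : ℕ}
    (δ : extPower F 4 ≅ twistNeg (structureModule X) x (2 * m))
    (b : OrthogonalForm (sixBundle F x m)) : Prop :=
  ∀ (U : X.Opens) (s : Fin 4 → Γ(F, U)),
    b.form U ((toTwist (extPower F 2) x m).app U (wedge ![s 0, s 1]))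
        ((toTwist (extPower F 2) x m).app U (wedge ![s 2, s 3])) =
      toFunction ((subAtι (structureModule X) x _).app U (δ.hom.app U (wedge s)))

/-- For submodules `P, Q ⊂ F_{2x}`, the submodule `P ∧ Q` of `(Λ²F)_{2x}` spanned by all `p ∧ q` with
`p ∈ P` and `q ∈ Q`, that is, the image of `P ⊗ Q`. -/
def wedgeSub {F : X.Modules} {x : X} (P Q : Submodule (X.presheaf.stalk x) (fiber2 F x)) :
    Submodule (X.presheaf.stalk x) (fiber2 (extPower F 2) x) :=
  Submodule.span _ {ω | ∃ (U : X.Opens) (hx : x ∈ U) (p q : Γ(F, U)),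
    jet hx p ∈ P ∧ jet hx q ∈ Q ∧ ω = jet hx (wedge ![p, q])}

/-- The germs `u` of `M(mx)` at `x` such that `𝔪^m u` is contained in the preimage of `N` in the
stalk `M_x`. -/
def twistGerms {M : X.Modules} {x : X} (m : ℕ)
    (N : Submodule (X.presheaf.stalk x) (fiber2 M x)) :
    Submodule (X.presheaf.stalk x) ((twist M x m).presheaf.stalk x) where
  carrier := {u | ∀ f ∈ maximalIdeal (X.presheaf.stalk x) ^ m,
    f • u ∈ (N.comap (mk2 M x)).map (stalkMap (toTwist M x m) x)}
  add_mem' ha hb f hf := by rw [smul_add]; exact Submodule.add_mem _ (ha f hf) (hb f hf)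
  zero_mem' f hf := by rw [smul_zero]; exact Submodule.zero_mem _
  smul_mem' c u hu f hf := by rw [smul_comm]; exact Submodule.smul_mem _ _ (hu f hf)

/-- For a submodule `N ⊂ M_{2x}`, the corresponding submodule `N(mx)` of `M(mx)_{2x}`. -/
def twistSubmodule {M : X.Modules} {x : X} (m : ℕ)
    (N : Submodule (X.presheaf.stalk x) (fiber2 M x)) :
    Submodule (X.presheaf.stalk x) (fiber2 (twist M x m) x) :=
  (twistGerms m N).map (mk2 (twist M x m) x)

/-- For `P, Q ⊂ F_{2x}`, the submodule of `E_{2x}` given by `P ∧ Q`, where `E = (Λ²F)(mx)`. -/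
def wedgeIn {F : X.Modules} {x : X} (m : ℕ)
    (P Q : Submodule (X.presheaf.stalk x) (fiber2 F x)) :
    Submodule (X.presheaf.stalk x) (fiber2 (sixBundle F x m) x) :=
  twistSubmodule m (wedgeSub P Q)

/-- `P ⊂ F_{2x}` sits in an exact sequence `0 → εG → P → W → 0` with `G, W ⊂ F_x`: the image of `P`
in `F_x` is `W`, and `P ∩ εF_x = εG`. -/
def IsExtension {F : X.Modules} {x : X} (P : Submodule (X.presheaf.stalk x) (fiber2 F x))
    (G W : Submodule (X.presheaf.stalk x) (fiber F x)) : Prop :=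
  P.map (red F x) = W ∧
    P ⊓ maximalIdeal (X.presheaf.stalk x) • ⊤ =
      maximalIdeal (X.presheaf.stalk x) • G.comap (red F x)

/-- `P` is attached to `L ∈ OΣ_1`: `0 → εF_x → P → K → 0` with `dim K = 2`, and `L = P ∧ P`. -/
def Attached1 {F : X.Modules} {x : X} {m : ℕ}
    (L : Submodule (X.presheaf.stalk x) (fiber2 (sixBundle F x m) x))
    (P : Submodule (X.presheaf.stalk x) (fiber2 F x)) : Prop :=
  ∃ K : Submodule (X.presheaf.stalk x) (fiber F x),
    Module.length (X.presheaf.stalk x) K = 2 ∧ IsExtension P ⊤ K ∧ L = wedgeIn m P P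

/-- `P` is attached to `L ∈ OΣ_2`: `0 → εW → P → D → 0` for a line `D` contained in a hyperplane `W`
of `F_x`, and `L = P ∧ W₂`, where `W₂` is the preimage of `W` in `F_{2x}`. -/
def Attached2 {F : X.Modules} {x : X} {m : ℕ}
    (L : Submodule (X.presheaf.stalk x) (fiber2 (sixBundle F x m) x))
    (P : Submodule (X.presheaf.stalk x) (fiber2 F x)) : Prop :=
  ∃ D W : Submodule (X.presheaf.stalk x) (fiber F x),
    Module.length (X.presheaf.stalk x) D = 1 ∧ Module.length (X.presheaf.stalk x) W = 3 ∧
      D ≤ W ∧ IsExtension P W D ∧ L = wedgeIn m P (W.comap (red F x))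

/-- `P` is attached to `L ∈ OΣ_3^{(0)}`: `0 → εW → P → W → 0` for a hyperplane `W` of `F_x`, and
`L = P ∧ P`. -/
def Attached30 {F : X.Modules} {x : X} {m : ℕ}
    (L : Submodule (X.presheaf.stalk x) (fiber2 (sixBundle F x m) x))
    (P : Submodule (X.presheaf.stalk x) (fiber2 F x)) : Prop :=
  ∃ W : Submodule (X.presheaf.stalk x) (fiber F x),
    Module.length (X.presheaf.stalk x) W = 3 ∧ IsExtension P W W ∧ L = wedgeIn m P P

/-- `P` is attached to `L ∈ OΣ_3^{(1)}`: `0 → εD → P → D → 0` for a line `D` of `F_x`, and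
`L = P ∧ F_{2x}`. -/
def Attached31 {F : X.Modules} {x : X} {m : ℕ}
    (L : Submodule (X.presheaf.stalk x) (fiber2 (sixBundle F x m) x))
    (P : Submodule (X.presheaf.stalk x) (fiber2 F x)) : Prop :=
  ∃ D : Submodule (X.presheaf.stalk x) (fiber F x),
    Module.length (X.presheaf.stalk x) D = 1 ∧ IsExtension P D D ∧ L = wedgeIn m P ⊤

/-- The part `OΣ_3^{(0)}` of `OΣ_3`: the image of `L` in `E_x` is `Λ²W` (twisted) for a hyperplane
`W` of `F_x`. -/
def OSigma30 {F : X.Modules} {x : X} {m : ℕ} (b : OrthogonalForm (sixBundle F x m)) :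
    Set (Submodule (X.presheaf.stalk x) (fiber2 (sixBundle F x m) x)) :=
  {L | L ∈ OSigma b x 3 ∧ ∃ W : Submodule (X.presheaf.stalk x) (fiber F x),
    Module.length (X.presheaf.stalk x) W = 3 ∧
      L.map (red _ x) =
        (wedgeIn m (W.comap (red F x)) (W.comap (red F x))).map (red (sixBundle F x m) x)}

/-- The part `OΣ_3^{(1)}` of `OΣ_3`: the image of `L` in `E_x` is `D ∧ F_x` (twisted) for a line `D`
of `F_x`. -/
def OSigma31 {F : X.Modules} {x : X} {m : ℕ} (b : OrthogonalForm (sixBundle F x m)) :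
    Set (Submodule (X.presheaf.stalk x) (fiber2 (sixBundle F x m) x)) :=
  {L | L ∈ OSigma b x 3 ∧ ∃ D : Submodule (X.presheaf.stalk x) (fiber F x),
    Module.length (X.presheaf.stalk x) D = 1 ∧
      L.map (red _ x) = (wedgeIn m (D.comap (red F x)) ⊤).map (red (sixBundle F x m) x)}

/-- `ℋ(E, L) = (Λ²(F'(ax)))(cx)` as orthogonal bundles, where `E = (Λ²F)(mx)` has the form `b` and
`F'` is the Hecke transform of `F` along `P`. The right-hand side carries the form given by the
exterior product and an isomorphism `det F'(ax) ≅ 𝒪_X(-2cx)`. -/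
def HeckeIs {F : X.Modules} {x : X} {m : ℕ} (b : OrthogonalForm (sixBundle F x m))
    (L : Submodule (X.presheaf.stalk x) (fiber2 (sixBundle F x m) x))
    (P : Submodule (X.presheaf.stalk x) (fiber2 F x)) (a c : ℕ) : Prop :=
  ∃ (bH : OrthogonalForm (orthogonalHecke (sixBundle F x m) x L))
    (δ' : extPower (twist (hecke F x P) x a) 4 ≅ twistNeg (structureModule X) x (2 * c))
    (b' : OrthogonalForm (sixBundle (twist (hecke F x P) x a) x c))
    (ψ : orthogonalHecke (sixBundle F x m) x L ≅ sixBundle (twist (hecke F x P) x a) x c),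
    ExtendsForm b bH ∧ IsWedgeForm δ' b' ∧
      ∀ (U : X.Opens) (s t : Γ(orthogonalHecke (sixBundle F x m) x L, U)),
        b'.form U (ψ.hom.app U s) (ψ.hom.app U t) = bH.form U s t

end

end OrthHecke

open OrthHecke

/-! Every sheaf that occurs is torsion-free on an integral scheme, so it is determined by its
generic stalk together with the lattice which each stalk spans there (`Model`). Let V be the generic
stalk of F. Exterior powers, twists and Hecke transforms become families of lattices in V, Λ²V and
Λ⁴V, and a twist or a Hecke transform at x alters only the lattice at x. Two sheaves with the same
lattices in the same space are isomorphic by the identity of that space (`Model.exists_iso`).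

Both ℋ(E, L) and (Λ²(F'(ax)))(cx) have models in Λ²V, and their forms are restrictions of one
bilinear form there, namely `wedgeForm D`, where D identifies Λ⁴V with the function field by means
of δ. The isomorphisms therefore come down to an equality of two lattices at x, together with the
fact that the same D carries det F'(ax) onto 𝒪(-2cx).

The local ring at x is a discrete valuation ring with uniformizer ϖ, and lattices are compared by
exponents. Let N be the stalk of F at x, and identify the stalk of E with Λ²N by the factor ϖ^m.
Suppose that N has a basis e₁, …, e₄ for which P lifts to the span of the ϖ^(z_i) e_i, and L to the
span of the ϖ^(w_ij) e_i ∧ e_j. The criterion `heckeIs_of_eq_expSub` then asks for w_ij + 2a + c =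
z_i + z_j + m + 1 and Σ z_i + 2m = 2c + 4a. In the four cases z is (0,0,1,1), (0,1,1,2), (0,0,0,2),
(0,2,2,2), and w_ij is z_i + z_j minus the constant 0, 1, 0, 2. The values of a and c in the theorem
solve the two equations. A basis adapted to an attached P comes from `exists_basis_of_extension`:
vectors of the fibre adapted to a flag are lifted, the first ones inside P itself, and Nakayama's
lemma makes them a basis. The exponents of L = P ∧ Q follow from `span_wedge_sup`.

For the existence of P, the Lagrangian L is lifted to a lattice in Λ²N that contains ϖ²Λ²N and is
isotropic modulo ϖ² (`IsotropicLattice`). In the coordinates q₀, …, q₅ along the pairs 12, 13, 14,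
23, 24, 34 the quadratic form is a unit times q₀q₅ - q₁q₄ + q₂q₃, because 2 is invertible. Isotropy
is thus the Plücker relation modulo ϖ², and an element of L not divisible by ϖ is decomposable
modulo ϖ². Changes of basis put e₁ ∧ e₂ into L, then e₁ ∧ e₃, then one of e₁ ∧ e₄ and e₂ ∧ e₃, as
far as the dimension of the image in the fibre requires. All of L is orthogonal modulo ϖ² to these
vectors, which kills the complementary coordinates modulo ϖ². Since L has length 6 modulo ϖ², it
must be the submodule with the exponents above. The last alternative separates the two families of
maximal isotropic subspaces, D ∧ F_x and Λ²W, which never coincide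
(`expSub_hyperplane_ne_expSub_line`). -/

namespace OrthHecke
noncomputable section

/-! ### The local ring at a closed point, and a uniformizer near it -/

/-- A Noetherian local domain over a ring mapping isomorphically onto its residue field, formally
smooth with free differentials of rank one, is a discrete valuation ring. -/
theorem isDiscreteValuationRing_of_kaehler {k R : Type u} [CommRing k] [CommRing R] [Algebra k R]
    [IsLocalRing R] [IsDomain R] [IsNoetherianRing R] [Algebra.FormallySmooth k R]
    (hk : Function.Bijective (algebraMap k (ResidueField R)))
    (ω : Ω[R⁄k] ≃ₗ[R] R) : IsDiscreteValuationRing R := by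
  let D := KaehlerDifferential.D k R
  have : Algebra.FormallySmooth k (ResidueField R) :=
    Algebra.FormallySmooth.of_equiv (AlgEquiv.ofBijective (Algebra.ofId k (ResidueField R)) hk)
  have hsurj : Function.Surjective (algebraMap R (ResidueField R)) := residue_surjective
  -- A retraction of the cotangent map 𝔪/𝔪² → κ ⊗ Ω. Hence an element of 𝔪 whose differential dies
  -- in κ ⊗ Ω lies in 𝔪², which is `key`.
  obtain ⟨l, hl⟩ := (Algebra.FormallySmooth.iff_split_injection (R := k) hsurj).mp this
  have key (g : R) (hg : g ∈ maximalIdeal R) (hDg : ω (D g) ∈ maximalIdeal R) :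
      g ∈ maximalIdeal R ^ 2 := by
    have hker : RingHom.ker (algebraMap R (ResidueField R)) = maximalIdeal R := ker_residue
    have hg' : g ∈ RingHom.ker (algebraMap R (ResidueField R)) := hker ▸ hg
    have h1 := congrArg (fun φ => φ (Ideal.toCotangent _ ⟨g, hg'⟩)) hl
    simp only [LinearMap.comp_apply, LinearMap.id_apply,
      KaehlerDifferential.kerCotangentToTensor_toCotangent] at h1
    have h2 : (1 : ResidueField R) ⊗ₜ[R] D g = 0 := by
      have : D g = ω (D g) • ω.symm 1 := by
        apply ω.injective; simp
      rw [this, ← TensorProduct.smul_tmul]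
      have : ω (D g) • (1 : ResidueField R) = 0 := by
        rw [Algebra.smul_def, mul_one]
        exact (residue_eq_zero_iff _).mpr hDg
      rw [this, TensorProduct.zero_tmul]
    rw [h2, map_zero, eq_comm, Ideal.toCotangent_eq_zero] at h1
    exact hker ▸ (show g ∈ RingHom.ker (algebraMap R (ResidueField R)) ^ 2 from h1)
  -- Otherwise all differentials lie in 𝔪Ω, since R is the sum of the constants and 𝔪, and constants
  -- have differential zero; but differentials generate Ω ≅ R.
  have hex : ∃ t ∈ maximalIdeal R, IsUnit (ω (D t)) := by
    by_contra! h
    have h' (r : R) : ω (D r) ∈ maximalIdeal R := by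
      obtain ⟨c, hc⟩ := hk.2 (residue R r)
      have hm : r - algebraMap k R c ∈ maximalIdeal R := by
        rw [← residue_eq_zero_iff, map_sub, ← hc, sub_eq_zero]
        rfl
      have := (mem_maximalIdeal _).mpr (h _ hm)
      rwa [map_sub, D.map_algebraMap, sub_zero] at this
    have htop : ∀ w : Ω[R⁄k], ω w ∈ maximalIdeal R := by
      intro w
      have hw : w ∈ Submodule.span R (Set.range D) := by
        rw [KaehlerDifferential.span_range_derivation]; trivial
      induction hw using Submodule.span_induction with
      | mem w hw => obtain ⟨r, rfl⟩ := hw; exact h' r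
      | zero => rw [map_zero]; exact Ideal.zero_mem _
      | add a b _ _ ha hb => rw [map_add]; exact Ideal.add_mem _ ha hb
      | smul r a _ ha => rw [map_smul]; exact Ideal.mul_mem_left _ _ ha
    have := htop (ω.symm 1)
    rw [ω.apply_symm_apply] at this
    exact (Ideal.ne_top_iff_one _).mp (maximalIdeal.isMaximal R).ne_top this
  obtain ⟨t, ht, u, hu⟩ := hex
  -- The coefficient `a` is the quotient of the differentials of `f` and `t`, so that the
  -- differential of f - at is -t·Da, which lies in 𝔪Ω, and `key` applies. Nakayama's lemma then
  -- shows that `t` generates 𝔪.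
  have hle : maximalIdeal R ≤ Ideal.span {t} ⊔ maximalIdeal R • maximalIdeal R := by
    intro f hf
    set a := ω (D f) * ↑u⁻¹ with ha
    have hg : f - a * t ∈ maximalIdeal R ^ 2 := by
      apply key _ (Ideal.sub_mem _ hf (Ideal.mul_mem_left _ _ ht))
      have : ω (D (f - a * t)) = - (t * ω (D a)) := by
        rw [map_sub, D.leibniz, map_sub, map_add, map_smul, map_smul, ← hu]
        simp only [smul_eq_mul, ha, mul_assoc, Units.inv_mul, mul_one]
        ring
      rw [this]
      exact neg_mem (Ideal.mul_mem_right _ _ ht)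
    rw [smul_eq_mul, ← pow_two, ← sub_add_cancel f (a * t)]
    exact add_mem (Submodule.mem_sup_right hg)
      (Submodule.mem_sup_left (Ideal.mul_mem_left _ _ (Ideal.mem_span_singleton_self t)))
  have hle' : maximalIdeal R ≤ Ideal.span {t} :=
    Submodule.le_of_le_smul_of_le_jacobson_bot (IsNoetherian.noetherian _)
      (maximalIdeal_le_jacobson _) hle
  have hprinc : (maximalIdeal R).IsPrincipal :=
    ⟨t, le_antisymm hle' ((Ideal.span_singleton_le_iff_mem _).mpr ht)⟩
  -- In a field `t` would be zero, while its differential is a unit.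
  have hnf : ¬ IsField R := by
    intro hf
    have : t = 0 := by
      have := (isField_iff_maximalIdeal_eq.mp hf) ▸ ht
      simpa using this
    subst this
    rw [map_zero, map_zero] at hu
    exact u.ne_zero hu
  exact ((IsDiscreteValuationRing.TFAE R hnf).out 0 4).mpr hprinc

theorem appLE_top_top {Y Z : Scheme.{u}} (g : Y ⟶ Z) (e : ⊤ ≤ g ⁻¹ᵁ ⊤) :
    g.appLE ⊤ ⊤ e = g.appTop := (Scheme.Hom.app_eq_appLE g).symm

/-- The Nullstellensatz makes the residue field at a closed point equal to the ground field. The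
work lies in matching the composite through the charts `U` and `V` with `residueFieldIsoBase`, by
pulling functions back along Spec κ(x) ⟶ X. -/
theorem residueField_bijective {K : Type u} [Field K] [IsAlgClosed K] {X : Scheme.{u}}
    (f : X ⟶ Spec (CommRingCat.of K)) [LocallyOfFiniteType f] (x : X)
    (hx : IsClosed ({x} : Set X)) (U : (Spec (CommRingCat.of K)).Opens) (V : X.Opens)
    (e : V ≤ f ⁻¹ᵁ U) (hxV : x ∈ V) :
    Function.Bijective
      (f.appLE U V e ≫ X.presheaf.germ V x hxV ≫ X.residue x : _ ⟶ X.residueField x).hom := by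
  -- The spectrum of a field is a single point, so a nonempty open subset is everything.
  obtain rfl : U = ⊤ := by
    refine top_unique fun y _ => ?_
    rw [Subsingleton.elim y (f x)]
    exact e hxV
  have h1 : f.appLE ⊤ V e ≫ X.presheaf.germ V x hxV ≫ X.residue x =
      (Scheme.ΓSpecIso _).hom ≫ (residueFieldIsoBase f x hx).inv := by
    have hg (g : Spec (X.residueField x) ⟶ X)
        (hg : g = Spec.map (X.residue x) ≫ X.fromSpecStalk x) (e' : ⊤ ≤ g ⁻¹ᵁ V) :
        X.presheaf.germ V x hxV ≫ X.residue x =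
          g.appLE V ⊤ e' ≫ (Scheme.ΓSpecIso (X.residueField x)).hom := by
      subst hg
      have e'' : ⊤ ≤ Spec.map (X.residue x) ⁻¹ᵁ (X.fromSpecStalk x ⁻¹ᵁ V) := e'
      have h4 : (Spec.map (X.residue x) ≫ X.fromSpecStalk x).appLE V ⊤ e' =
          (X.fromSpecStalk x).app V ≫ (Spec.map (X.residue x)).appLE _ ⊤ e'' :=
        Scheme.Hom.comp_appLE _ _ _ _ _
      rw [h4, Scheme.fromSpecStalk_app hxV, Category.assoc, Category.assoc,
        Category.assoc, Scheme.Hom.map_appLE_assoc]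
      rw [appLE_top_top, Scheme.ΓSpecIso_naturality, Iso.inv_hom_id_assoc]
    have hV : ⊤ ≤ X.fromSpecResidueField x ⁻¹ᵁ V := fun y _ => by simpa using hxV
    rw [hg (X.fromSpecResidueField x) rfl hV, Scheme.Hom.appLE_comp_appLE_assoc]
    have h3 (g : Spec (X.residueField x) ⟶ Spec (CommRingCat.of K))
        (hg : g = Spec.map (residueFieldIsoBase f x hx).inv) (e' : ⊤ ≤ g ⁻¹ᵁ ⊤) :
        g.appLE ⊤ ⊤ e' ≫ (Scheme.ΓSpecIso (X.residueField x)).hom =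
          (Scheme.ΓSpecIso _).hom ≫ (residueFieldIsoBase f x hx).inv := by
      subst hg
      rw [← Scheme.ΓSpecIso_naturality, appLE_top_top]
    exact h3 _ (SpecMap_residueFieldIsoBase_inv f x hx).symm _
  rw [h1]
  exact ConcreteCategory.bijective_of_isIso (C := CommRingCat) _

/-- On a standard smooth chart of relative dimension one the differentials are free of rank one.
Formal smoothness and differentials are compatible with localization, so the criterion through
differentials applies to the stalk. -/
theorem isDiscreteValuationRing_stalk {K : Type u} [Field K] [IsAlgClosed K] {X : Scheme.{u}}
    (f : X ⟶ Spec (CommRingCat.of K)) [SmoothOfRelativeDimension 1 f] [IsIntegral X] (x : X)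
    (hx : IsClosed ({x} : Set X)) : IsDiscreteValuationRing (X.presheaf.stalk x) := by
  have : Smooth f := SmoothOfRelativeDimension.smooth 1 f
  have : IsLocallyNoetherian X := LocallyOfFiniteType.isLocallyNoetherian f
  obtain ⟨U, hU, V, hV, hxV, e, hf⟩ :=
    SmoothOfRelativeDimension.exists_isStandardSmoothOfRelativeDimension (n := 1) (f := f) x
  let _ := (f.appLE U V e).hom.toAlgebra
  let _ := X.presheaf.algebra_section_stalk ⟨x, hxV⟩
  let _ := (f.appLE U V e ≫ X.presheaf.germ V x hxV).hom.toAlgebra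
  have hloc := hV.isLocalization_stalk ⟨x, hxV⟩
  have : IsScalarTower Γ(Spec (CommRingCat.of K), U) Γ(X, V) (X.presheaf.stalk x) :=
    IsScalarTower.of_algebraMap_eq' rfl
  have hf' : Algebra.IsStandardSmoothOfRelativeDimension 1
    Γ(Spec (CommRingCat.of K), U) Γ(X, V) := hf
  have : Algebra.IsStandardSmooth Γ(Spec (CommRingCat.of K), U) Γ(X, V) :=
    hf'.isStandardSmooth
  have : Nonempty V := ⟨⟨x, hxV⟩⟩
  have : Algebra.FormallySmooth Γ(Spec (CommRingCat.of K), U) (X.presheaf.stalk x) := by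
    have := Algebra.FormallySmooth.of_isLocalization (Rₘ := X.presheaf.stalk x)
      (hV.primeIdealOf ⟨x, hxV⟩).asIdeal.primeCompl
    exact Algebra.FormallySmooth.comp _ Γ(X, V) _
  have hfree : Module.finrank Γ(X, V) Ω[Γ(X, V)⁄Γ(Spec (CommRingCat.of K), U)] = 1 := by
    rw [Module.finrank, Algebra.IsStandardSmoothOfRelativeDimension.rank_kaehlerDifferential 1]
    simp
  have : Module.Finite Γ(X, V) Ω[Γ(X, V)⁄Γ(Spec (CommRingCat.of K), U)] := inferInstance
  let B := (Module.finBasisOfFinrankEq Γ(X, V) Ω[Γ(X, V)⁄Γ(Spec (CommRingCat.of K), U)] hfree)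
  have := KaehlerDifferential.isLocalizedModule_map Γ(Spec (CommRingCat.of K), U) Γ(X, V)
    (X.presheaf.stalk x) (hV.primeIdealOf ⟨x, hxV⟩).asIdeal.primeCompl
  let B' := B.ofIsLocalizedModule (X.presheaf.stalk x)
    (hV.primeIdealOf ⟨x, hxV⟩).asIdeal.primeCompl
    (KaehlerDifferential.map Γ(Spec (CommRingCat.of K), U) Γ(Spec (CommRingCat.of K), U) Γ(X, V)
    (X.presheaf.stalk x))
  let ω := B'.equivFun.trans (LinearEquiv.funUnique (Fin 1) _ _)
  refine isDiscreteValuationRing_of_kaehler (k := Γ(Spec (CommRingCat.of K), U)) ?_ ω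
  exact residueField_bijective f x hx U V e hxV

/-- Near a closed point of a locally Noetherian integral scheme whose local ring is a discrete
valuation ring there is a function which is a uniformizer at the point and invertible elsewhere. -/
theorem exists_uniformizer {X : Scheme.{u}} [IsIntegral X] [IsLocallyNoetherian X] (x : X)
    (hx : IsClosed ({x} : Set X)) [IsDiscreteValuationRing (X.presheaf.stalk x)] :
    ∃ (U : X.Opens) (hxU : x ∈ U) (t : Γ(X, U)), Irreducible (X.presheaf.germ U x hxU t) ∧
      ∀ (y : X) (hy : y ∈ U), y ≠ x → IsUnit (X.presheaf.germ U y hy t) := by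
  obtain ⟨ϖ, hϖ⟩ := IsDiscreteValuationRing.exists_irreducible (X.presheaf.stalk x)
  obtain ⟨U₀, hxU₀, t, rfl⟩ := X.presheaf.exists_germ_eq ϖ
  obtain ⟨_, ⟨V, hV, rfl⟩, hxV, hVU⟩ :=
    X.isBasis_affineOpens.exists_subset_of_mem_open hxU₀ U₀.isOpen
  have : IsNoetherianRing Γ(X, V) := IsLocallyNoetherian.component_noetherian ⟨V, hV⟩
  -- The ideal of functions vanishing at x. It is finitely generated, and each generator is a
  -- multiple of `t` near x; on a common neighbourhood every zero of `t` is then a zero of the whole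
  -- ideal.
  let p : Ideal Γ(X, V) := (maximalIdeal (X.presheaf.stalk x)).comap (X.presheaf.germ V x hxV).hom
  obtain ⟨S, hS⟩ := (isNoetherian_def.mp this p : p.FG)
  have hgen : ∀ g ∈ p, ∃ c, X.presheaf.germ V x hxV g = c * X.presheaf.germ U₀ x hxU₀ t := by
    intro g hg
    have : X.presheaf.germ V x hxV g ∈ maximalIdeal (X.presheaf.stalk x) := hg
    rw [hϖ.maximalIdeal_eq, Ideal.mem_span_singleton'] at this
    exact ⟨_, this.choose_spec.symm⟩
  have hnear : ∀ g ∈ p, ∃ (W : X.Opens) (_ : x ∈ W) (_ : W ≤ V) (_ : W ≤ U₀),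
      ∀ y (hyV : y ∈ V) (hyU : y ∈ U₀), y ∈ W → ∃ c,
        X.presheaf.germ V y hyV g = c * X.presheaf.germ U₀ y hyU t := by
    intro g hg
    obtain ⟨c, hc⟩ := hgen g hg
    obtain ⟨W₁, hxW₁, c, rfl⟩ := X.presheaf.exists_germ_eq c
    have hxW₂ : x ∈ V ⊓ (U₀ ⊓ W₁ : X.Opens) := ⟨hxV, hxU₀, hxW₁⟩
    rw [← germ_resO (inf_le_left : V ⊓ (U₀ ⊓ W₁ : X.Opens) ≤ V) x hxW₂,
      ← germ_resO (inf_le_right.trans inf_le_left : V ⊓ (U₀ ⊓ W₁ : X.Opens) ≤ U₀) x hxW₂,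
      ← germ_resO (inf_le_right.trans inf_le_right : V ⊓ (U₀ ⊓ W₁ : X.Opens) ≤ W₁) x hxW₂,
      ← map_mul] at hc
    obtain ⟨W, hxW, i, j, h⟩ := X.presheaf.germ_eq _ hxW₂ hxW₂ _ _ hc
    refine ⟨W, hxW, i.le.trans inf_le_left, i.le.trans (inf_le_right.trans inf_le_left),
      fun y hyV hyU hyW => ⟨X.presheaf.germ W₁ y (i.le hyW).2.2 c, ?_⟩⟩
    have h' := congrArg (X.presheaf.germ W y hyW) h
    simp only [TopCat.Presheaf.germ_res_apply, map_mul] at h'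
    rwa [germ_resO, germ_resO, germ_resO] at h'
  choose! W hxW hWV hWU hW using hnear
  let W' : X.Opens := V ⊓ Finset.inf S W
  have hSp : ∀ g ∈ S, g ∈ p := fun g hg => hS ▸ Ideal.subset_span hg
  have hxW' : x ∈ W' := by
    refine ⟨hxV, ?_⟩
    have : ∀ S' : Finset Γ(X, V), S' ⊆ S → x ∈ Finset.inf S' W := by
      classical
      intro S'
      induction S' using Finset.induction_on with
      | empty => intro _; trivial
      | insert a s ha ih =>
        intro h
        rw [Finset.inf_insert]
        exact ⟨hxW a (hSp a (h (Finset.mem_insert_self _ _))),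
          ih ((Finset.subset_insert _ _).trans h)⟩
    exact this S subset_rfl
  refine ⟨W', hxW', resO (inf_le_left.trans hVU) t, ?_, ?_⟩
  · rwa [germ_resO]
  · intro y hy hyx
    by_contra hu
    rw [germ_resO, ← mem_nonunits_iff, ← mem_maximalIdeal] at hu
    have hyp : ∀ g ∈ p, X.presheaf.germ V y hy.1 g ∈ maximalIdeal (X.presheaf.stalk y) := by
      have : p ≤ (maximalIdeal (X.presheaf.stalk y)).comap (X.presheaf.germ V y hy.1).hom := by
        rw [← hS]
        refine Ideal.span_le.mpr fun g hg => ?_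
        obtain ⟨c, hc⟩ := hW g (hSp g hg) y hy.1 (hVU hy.1) ((Finset.inf_le hg : S.inf W ≤ W g) hy.2)
        change X.presheaf.germ V y hy.1 g ∈ maximalIdeal (X.presheaf.stalk y)
        rw [hc]
        exact Ideal.mul_mem_left _ _ hu
      exact fun g hg => this hg
    refine hyx ?_
    -- If `t` is not a unit at y, all functions of the affine chart that vanish at x vanish at y, so
    -- y is a specialization of x; as x is closed, this forces y = x.
    have hsp : x ⤳ y := by
      rw [specializes_iff_forall_open]
      intro O hO hyO
      obtain ⟨g, hgO, hyg⟩ := hV.exists_basicOpen_le (V := ⟨O, hO⟩) ⟨y, hyO⟩ hy.1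
      by_contra hxO
      have hgp : g ∈ p := by
        by_contra hgp
        refine hxO (hgO ((Scheme.mem_basicOpen X g x hxV).mpr ?_))
        by_contra hnu
        exact hgp ((mem_maximalIdeal _).mpr hnu)
      have := hyp g hgp
      rw [mem_maximalIdeal] at this
      exact this ((Scheme.mem_basicOpen X g y hy.1).mp hyg)
    have := hsp.mem_closed hx rfl
    exact this


/-! ### Sheaves of modules seen from the generic stalk -/

variable {X : Scheme.{u}}

theorem genericPoint_mem [IrreducibleSpace X] {U : X.Opens} {y : X} (hy : y ∈ U) : genericPoint X ∈ U :=
  ((genericPoint_spec X).specializes trivial).mem_open U.isOpen hy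

theorem germ_app {M M' : X.Modules} (φ : M ⟶ M') {U : X.Opens} {y : X} (hy : y ∈ U) (s : Γ(M, U)) :
    M'.presheaf.germ U y hy (φ.app U s) = stalkMap φ y (M.presheaf.germ U y hy s) :=
  (germ_stalkFunctor_map φ y U hy s).symm

theorem stalkMap_id {M : X.Modules} (y : X) (v : M.presheaf.stalk y) : stalkMap (𝟙 M) y v = v := by
  obtain ⟨U, hU, v, rfl⟩ := TopCat.Presheaf.exists_germ_eq M.presheaf v
  rw [← germ_app]; rfl

theorem stalkMap_comp {M M' M'' : X.Modules} (φ : M ⟶ M') (ψ : M' ⟶ M'') (y : X)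
    (v : M.presheaf.stalk y) : stalkMap (φ ≫ ψ) y v = stalkMap ψ y (stalkMap φ y v) := by
  obtain ⟨U, hU, v, rfl⟩ := TopCat.Presheaf.exists_germ_eq M.presheaf v
  rw [← germ_app, ← germ_app, ← germ_app]; rfl

/-- A morphism of sheaves of modules given on sections. -/
def homMk {M M' : X.Modules} (F : ∀ U : X.Opens, Γ(M, U) →+ Γ(M', U))
    (hres : ∀ (U V : X.Opens) (h : V ≤ U) (s : Γ(M, U)), F V (res M h s) = res M' h (F U s))
    (hsmul : ∀ (U : X.Opens) (r : Γ(X, U)) (s : Γ(M, U)), F U (r • s) = r • F U s) : M ⟶ M' :=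
  ⟨PresheafOfModules.homMk
    { app U := AddCommGrpCat.ofHom (F U.unop)
      naturality U V f := by
        ext s
        exact hres U.unop V.unop (leOfHom f.unop) s }
    (fun U r s => hsmul U.unop r s)⟩

section
variable [IsIntegral X]

variable (X) in
theorem algebraMap_functionField_injective (y : X) :
    Function.Injective (algebraMap (X.presheaf.stalk y) X.functionField) :=
  IsFractionRing.injective _ _

/-- The stalk of `M` at the generic point. -/
abbrev genericStalk (M : X.Modules) : Type u := M.presheaf.stalk (genericPoint X)

/-- The semilinear specialization map from the stalk at `y` to the generic stalk. -/
def toGeneric (M : X.Modules) (y : X) :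
    M.presheaf.stalk y →ₛₗ[algebraMap (X.presheaf.stalk y) X.functionField] genericStalk M where
  toFun := M.presheaf.stalkSpecializes ((genericPoint_spec X).specializes trivial)
  map_add' := map_add _
  map_smul' r m := by
    obtain ⟨U, hU, r, rfl⟩ := X.presheaf.exists_germ_eq r
    obtain ⟨V, hV, m, rfl⟩ := TopCat.Presheaf.exists_germ_eq M.presheaf m
    have hx : y ∈ (U : X.Opens) ⊓ V := ⟨hU, hV⟩
    rw [← germ_resO (inf_le_left : (U : X.Opens) ⊓ V ≤ U) y hx r,
      ← germ_res M (inf_le_right : (U : X.Opens) ⊓ V ≤ V) y hx m, ← germ_smul,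
      TopCat.Presheaf.germ_stalkSpecializes_apply, TopCat.Presheaf.germ_stalkSpecializes_apply,
      germ_smul]
    congr 1
    exact (TopCat.Presheaf.germ_stalkSpecializes_apply _ _ _ _).symm

theorem toGeneric_germ (M : X.Modules) {U : X.Opens} {y : X} (hy : y ∈ U) (s : Γ(M, U)) :
    toGeneric M y (M.presheaf.germ U y hy s) =
      M.presheaf.germ U (genericPoint X) (genericPoint_mem hy) s :=
  TopCat.Presheaf.germ_stalkSpecializes_apply M.presheaf hy _ s

theorem algebraMap_germ {U : X.Opens} {y : X} (hy : y ∈ U) (r : Γ(X, U)) :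
    algebraMap (X.presheaf.stalk y) X.functionField (X.presheaf.germ U y hy r) =
      X.presheaf.germ U (genericPoint X) (genericPoint_mem hy) r :=
  TopCat.Presheaf.germ_stalkSpecializes_apply X.presheaf hy _ r

theorem algebraMap_genericPoint (r : X.functionField) :
    (stalkFunctionFieldAlgebra X (genericPoint X)).algebraMap r = r := by
  obtain ⟨U, hU, r, rfl⟩ := X.presheaf.exists_germ_eq r
  exact algebraMap_germ hU r

theorem toGeneric_genericPoint (M : X.Modules) (m : genericStalk M) :
    toGeneric M (genericPoint X) m = m := by
  obtain ⟨U, hU, m, rfl⟩ := TopCat.Presheaf.exists_germ_eq M.presheaf m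
  exact toGeneric_germ M hU m

theorem toGeneric_stalkMap {M N : X.Modules} (φ : M ⟶ N) (y : X) (m : M.presheaf.stalk y) :
    toGeneric N y (stalkMap φ y m) = stalkMap φ (genericPoint X) (toGeneric M y m) := by
  obtain ⟨U, hU, m, rfl⟩ := TopCat.Presheaf.exists_germ_eq M.presheaf m
  rw [toGeneric_germ]
  rw [← germ_app, ← germ_app, toGeneric_germ]

/-- The image of the stalk at `y` in the generic stalk. -/
def lattice (M : X.Modules) (y : X) : AddSubgroup (genericStalk M) :=
  (toGeneric M y).toAddMonoidHom.range

theorem mem_lattice {M : X.Modules} {y : X} {v : genericStalk M} :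
    v ∈ lattice M y ↔ ∃ m, toGeneric M y m = v := Iff.rfl

theorem germ_mem_lattice (M : X.Modules) {U : X.Opens} {y : X} (hy : y ∈ U) (s : Γ(M, U))
    (hη : genericPoint X ∈ U) : M.presheaf.germ U (genericPoint X) hη s ∈ lattice M y :=
  ⟨_, toGeneric_germ M hy s⟩

/-- All stalks embed into the generic stalk. -/
def TorsionFree (M : X.Modules) : Prop := ∀ y, Function.Injective (toGeneric M y)

variable {M M' : X.Modules}

/-- Equality may be tested on stalks, and these embed in the generic stalk. The hypothesis is
conditional on `genericPoint X ∈ U` so that the empty open set is covered as well. -/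
theorem TorsionFree.section_ext (hM : TorsionFree M) {U : X.Opens} (s s' : Γ(M, U))
    (h : ∀ hη : genericPoint X ∈ U, M.presheaf.germ U (genericPoint X) hη s =
      M.presheaf.germ U (genericPoint X) hη s') : s = s' := by
  refine TopCat.Presheaf.section_ext ⟨M.presheaf, M.isSheaf⟩ U s s' fun y hy => hM y ?_
  change toGeneric M y (M.presheaf.germ U y hy s) = toGeneric M y (M.presheaf.germ U y hy s')
  rw [toGeneric_germ, toGeneric_germ, h]

/-- Near each point the vector is the generic germ of some section. Such local sections agree on
overlaps because they have the same generic germ, so they glue. -/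
theorem TorsionFree.exists_section (hM : TorsionFree M) (U : X.Opens) (v : genericStalk M)
    (hv : ∀ y ∈ U, v ∈ lattice M y) : ∃ s : Γ(M, U), ∀ hη : genericPoint X ∈ U,
      M.presheaf.germ U (genericPoint X) hη s = v := by
  have h (y : U) : ∃ (V : X.Opens) (_ : y.1 ∈ V) (s : Γ(M, V)) (hη : genericPoint X ∈ V),
      M.presheaf.germ V (genericPoint X) hη s = v := by
    obtain ⟨m, hm⟩ := hv y y.2
    obtain ⟨V, hV, m, rfl⟩ := TopCat.Presheaf.exists_germ_eq M.presheaf m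
    exact ⟨V, hV, m, genericPoint_mem hV, (toGeneric_germ M hV m).symm.trans hm⟩
  choose V hV s hη hs using h
  obtain ⟨g, hg, -⟩ := (TopCat.Sheaf.existsUnique_gluing' ⟨M.presheaf, M.isSheaf⟩
    (fun y : U => U ⊓ V y) U (fun y => homOfLE inf_le_left)
    (fun y hy => Opens.mem_iSup.mpr ⟨⟨y, hy⟩, hy, hV ⟨y, hy⟩⟩)
    (fun y => res M inf_le_right (s y)) (by
      intro y z
      refine hM.section_ext _ _ fun h => ?_
      have h1 := germ_res M (inf_le_left.trans inf_le_right : (U ⊓ V y) ⊓ (U ⊓ V z) ≤ V y)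
        (genericPoint X) h (s y)
      have h2 := germ_res M (inf_le_right.trans inf_le_right : (U ⊓ V y) ⊓ (U ⊓ V z) ≤ V z)
        (genericPoint X) h (s z)
      rw [← res_res M inf_le_right inf_le_left, hs] at h1
      rw [← res_res M inf_le_right inf_le_right, hs] at h2
      exact h1.trans h2.symm))
  refine ⟨g, fun hU => ?_⟩
  have h1 := hg ⟨_, hU⟩
  have h2 := germ_res M (inf_le_left : U ⊓ V ⟨_, hU⟩ ≤ U) (genericPoint X) ⟨hU, hη _⟩ g
  rw [← h2]
  exact (congrArg _ h1).trans ((germ_res M inf_le_right _ ⟨hU, hη ⟨_, hU⟩⟩ _).trans (hs _))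

/-- A linear map of generic stalks that respects all lattices comes from a morphism. -/
theorem TorsionFree.exists_hom (hM' : TorsionFree M')
    (θ : genericStalk M →ₗ[X.functionField] genericStalk M')
    (hθ : ∀ y, ∀ v ∈ lattice M y, θ v ∈ lattice M' y) :
    ∃ φ : M ⟶ M', ∀ v, stalkMap φ (genericPoint X) v = θ v := by
  have h (U : X.Opens) (s : Γ(M, U)) : ∃ s' : Γ(M', U), ∀ hη : genericPoint X ∈ U,
      M'.presheaf.germ U (genericPoint X) hη s' = θ (M.presheaf.germ U (genericPoint X) hη s) := by
    by_cases hU : genericPoint X ∈ U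
    · obtain ⟨s', hs'⟩ := hM'.exists_section U (θ (M.presheaf.germ U (genericPoint X) hU s))
        fun y hy => hθ y _ (germ_mem_lattice M hy s hU)
      exact ⟨s', hs'⟩
    -- Here `U` is empty and the value is irrelevant.
    · exact ⟨0, fun h => (hU h).elim⟩
  choose F hF using h
  let φ : M ⟶ M' := homMk
    (fun U =>
      { toFun := F U
        map_zero' := hM'.section_ext _ _ fun hη => by
          rw [hF, map_zero, map_zero, map_zero]
        map_add' := fun a b => hM'.section_ext _ _ fun hη => by
          rw [hF, map_add, map_add, map_add, hF, hF] })
    (fun U V h s => hM'.section_ext _ _ fun hη => by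
      refine (hF _ _ _).trans ?_
      rw [germ_res, germ_res]
      exact (hF _ _ _).symm)
    (fun U r s => hM'.section_ext _ _ fun hη => by
      refine (hF _ _ _).trans ?_
      rw [germ_smul, germ_smul]
      exact (θ.map_smul _ _).trans (congrArg _ (hF _ _ _).symm))
  refine ⟨φ, fun v => ?_⟩
  obtain ⟨U, hU, v, rfl⟩ := TopCat.Presheaf.exists_germ_eq M.presheaf v
  rw [← germ_app]
  exact hF U v hU

theorem TorsionFree.hom_ext (hM' : TorsionFree M') {φ ψ : M ⟶ M'}
    (h : ∀ v, stalkMap φ (genericPoint X) v = stalkMap ψ (genericPoint X) v) : φ = ψ := by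
  refine Scheme.Modules.hom_ext _ _ fun U => ?_
  ext s
  refine hM'.section_ext _ _ fun hη => ?_
  rw [germ_app, germ_app, h]

/-- An isomorphism of generic stalks that identifies all lattices comes from an isomorphism. -/
theorem TorsionFree.exists_iso (hM : TorsionFree M) (hM' : TorsionFree M')
    (θ : genericStalk M ≃ₗ[X.functionField] genericStalk M')
    (hθ : ∀ y v, θ v ∈ lattice M' y ↔ v ∈ lattice M y) :
    ∃ φ : M ≅ M', ∀ v, stalkMap φ.hom (genericPoint X) v = θ v := by
  obtain ⟨φ, hφ⟩ := hM'.exists_hom θ.toLinearMap fun y v => (hθ y v).mpr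
  obtain ⟨ψ, hψ⟩ := hM.exists_hom θ.symm.toLinearMap fun y v hv =>
    (hθ y _).mp (by simpa using hv)
  refine ⟨⟨φ, ψ, hM.hom_ext fun v => ?_, hM'.hom_ext fun v => ?_⟩, hφ⟩
  · rw [stalkMap_comp, hφ, hψ, stalkMap_id]; simp
  · rw [stalkMap_comp, hψ, hφ, stalkMap_id]; simp

end

/-! ### Semilinear maps that carry a basis to a basis -/

section algebra

variable {A K M N ι : Type*} [CommRing A] [CommRing K] [AddCommGroup M] [Module A M]
  [AddCommGroup N] [Module K N] {σ : A →+* K} [Finite ι] (b : Module.Basis ι A M)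
  (b' : Module.Basis ι K N) (f : M →ₛₗ[σ] N)

include b in
theorem repr_semilinear (h : ∀ i, f (b i) = b' i) (m : M) (i : ι) :
    b'.repr (f m) i = σ (b.repr m i) := by
  have := Fintype.ofFinite ι
  classical
  conv_lhs => rw [← b.sum_repr m, map_sum]
  simp only [map_smulₛₗ, h]
  exact congrFun (b'.repr_sum_self fun i => σ (b.repr m i)) i

include b in
theorem injective_of_basis (hσ : Function.Injective σ) (h : ∀ i, f (b i) = b' i) :
    Function.Injective f := by
  rw [injective_iff_map_eq_zero]
  intro m hm
  refine b.ext_elem fun i => hσ ?_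
  rw [← repr_semilinear b b' f h, hm]
  simp

include b in
theorem mem_range_iff_of_basis (h : ∀ i, f (b i) = b' i) (v : N) :
    (∃ m, f m = v) ↔ ∀ i, b'.repr v i ∈ σ.range := by
  have := Fintype.ofFinite ι
  constructor
  · rintro ⟨m, rfl⟩ i
    exact ⟨_, (repr_semilinear b b' f h m i).symm⟩
  · intro hv
    choose c hc using hv
    refine ⟨∑ i, c i • b i, b'.ext_elem fun i => ?_⟩
    rw [repr_semilinear b b' f h, ← hc]
    exact congrArg σ (congrFun (b.repr_sum_self c) i)

end algebra

/-! ### Germs and frames of vector bundles -/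

section
variable {X : Scheme.{u}}

theorem exists_smaller_open {U V : X.Opens} {y : X} (hU : y ∈ U) (hV : y ∈ V) :
    ∃ W : X.Opens, y ∈ W ∧ W ≤ U ∧ W ≤ V := ⟨U ⊓ V, ⟨hU, hV⟩, inf_le_left, inf_le_right⟩

theorem exists_germ_of_le (M : X.Modules) {y : X} {U : X.Opens} (hU : y ∈ U)
    (m : M.presheaf.stalk y) : ∃ (V : X.Opens) (hV : y ∈ V) (_ : V ≤ U) (s : Γ(M, V)),
      M.presheaf.germ V y hV s = m := by
  obtain ⟨V, hV, s, rfl⟩ := TopCat.Presheaf.exists_germ_eq M.presheaf m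
  exact ⟨U ⊓ V, ⟨hU, hV⟩, inf_le_left, res M inf_le_right s, germ_res M inf_le_right y _ s⟩

/-- Finitely many germs are germs of sections over a common neighbourhood. -/
theorem exists_germs {ι : Type*} [Finite ι] (M : X.Modules) {y : X} {U : X.Opens} (hU : y ∈ U)
    (m : ι → M.presheaf.stalk y) : ∃ (V : X.Opens) (hV : y ∈ V) (_ : V ≤ U) (s : ι → Γ(M, V)),
      ∀ i, M.presheaf.germ V y hV (s i) = m i := by
  have := Fintype.ofFinite ι
  choose V hV hVU s hs using fun i => exists_germ_of_le M hU (m i)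
  have hfin : IsOpen (⋂ i, (V i : Set X)) := isOpen_iInter_of_finite fun i => (V i).isOpen
  let W : X.Opens := U ⊓ ⟨_, hfin⟩
  have hW (i) : W ≤ V i := fun z hz => Set.mem_iInter.mp hz.2 i
  exact ⟨W, ⟨hU, Set.mem_iInter.mpr hV⟩, inf_le_left, fun i => res M (hW i) (s i), fun i =>
    (germ_res M (hW i) y _ (s i)).trans (hs i)⟩

theorem exists_germsO {ι : Type*} [Finite ι] {y : X} {U : X.Opens} (hU : y ∈ U)
    (m : ι → X.presheaf.stalk y) : ∃ (V : X.Opens) (hV : y ∈ V) (_ : V ≤ U) (s : ι → Γ(X, V)),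
      ∀ i, X.presheaf.germ V y hV (s i) = m i := by
  have := Fintype.ofFinite ι
  choose V hV s hs using fun i => X.presheaf.exists_germ_eq (m i)
  have hfin : IsOpen (⋂ i, (V i : Set X)) := isOpen_iInter_of_finite fun i => (V i).isOpen
  let W : X.Opens := U ⊓ ⟨_, hfin⟩
  have hW (i) : W ≤ V i := fun z hz => Set.mem_iInter.mp hz.2 i
  exact ⟨W, ⟨hU, Set.mem_iInter.mpr hV⟩, inf_le_left, fun i => resO (hW i) (s i), fun i =>
    (germ_resO (hW i) y _ (s i)).trans (hs i)⟩

theorem exists_res_eq_zero (M : X.Modules) {y : X} {U : X.Opens} (hU : y ∈ U) (s : Γ(M, U))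
    (hs : M.presheaf.germ U y hU s = 0) :
    ∃ (V : X.Opens) (_ : y ∈ V) (h : V ≤ U), res M h s = 0 := by
  have hs' : M.presheaf.germ U y hU s = M.presheaf.germ U y hU 0 := by rw [hs, map_zero]
  obtain ⟨W, hW, i, j, h⟩ := M.presheaf.germ_eq y hU hU s 0 hs'
  exact ⟨W, hW, i.le, h.trans (map_zero _)⟩

variable (M : X.Modules)

/-- The germ map as a semilinear map. -/
def germLinear {U : X.Opens} {y : X} (hy : y ∈ U) :
    Γ(M, U) →ₛₗ[(X.presheaf.germ U y hy).hom] M.presheaf.stalk y where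
  toFun := M.presheaf.germ U y hy
  map_add' := map_add _
  map_smul' := germ_smul M y U hy

/-- A frame of `M` over `U`: sections that form a basis over all smaller open sets. -/
def IsFrame {ι : Type*} {U : X.Opens} (e : ι → Γ(M, U)) : Prop :=
  ∀ (V : X.Opens) (h : V ≤ U), LinearIndependent Γ(X, V) (fun i => res M h (e i)) ∧
      Submodule.span Γ(X, V) (Set.range fun i => res M h (e i)) = ⊤

variable {M} {ι : Type*} {U : X.Opens} {e : ι → Γ(M, U)}

/-- The basis of sections over a smaller open set given by a frame. -/
def IsFrame.basis (he : IsFrame M e) {V : X.Opens} (h : V ≤ U) :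
    Module.Basis ι Γ(X, V) Γ(M, V) := .mk (he V h).1 (he V h).2.ge

theorem IsFrame.basis_apply (he : IsFrame M e) {V : X.Opens} (h : V ≤ U) (i : ι) :
    he.basis h i = res M h (e i) := Module.Basis.mk_apply _ _ _

/-- A relation between germs already holds between sections over a small neighbourhood, where the
frame is still a basis. This is why a frame is required to be a basis over every smaller open set.
-/
theorem IsFrame.linearIndependent_germ [Finite ι] (he : IsFrame M e) {y : X} (hy : y ∈ U) :
    LinearIndependent (X.presheaf.stalk y) fun i => M.presheaf.germ U y hy (e i) := by
  have := Fintype.ofFinite ι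
  rw [Fintype.linearIndependent_iff]
  intro c hc i
  obtain ⟨V, hV, hVU, c, rfl⟩ : ∃ (V : X.Opens) (hV : y ∈ V) (_ : V ≤ U) (s : ι → Γ(X, V)),
    (fun i => X.presheaf.germ V y hV (s i)) = c := by
    obtain ⟨V, hV, hVU, s, hs⟩ := exists_germsO hy c
    exact ⟨V, hV, hVU, s, funext hs⟩
  have h1 : M.presheaf.germ V y hV (∑ i, c i • res M hVU (e i)) = 0 := by
    rw [← hc, map_sum]
    exact Finset.sum_congr rfl fun i _ => by rw [germ_smul, germ_res]
  obtain ⟨W, hW, hWV, h2⟩ := exists_res_eq_zero M hV _ h1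
  have h3 : ∑ i, resO hWV (c i) • res M (hWV.trans hVU) (e i) = 0 := by
    rw [← h2]
    refine (Finset.sum_congr rfl fun i _ => ?_).trans (map_sum (resLinear M hWV) _ _).symm
    rw [← res_res M hVU hWV]
    exact (res_smul M hWV _ _).symm
  have h4 := Fintype.linearIndependent_iff.mp (he W (hWV.trans hVU)).1 _ h3 i
  have h5 := germ_resO hWV y hW (c i)
  rw [h4, map_zero] at h5
  exact h5.symm

theorem IsFrame.span_germ (he : IsFrame M e) {y : X} (hy : y ∈ U) :
    Submodule.span (X.presheaf.stalk y) (Set.range fun i => M.presheaf.germ U y hy (e i)) = ⊤ := by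
  refine eq_top_iff.mpr fun m _ => ?_
  obtain ⟨V, hV, hVU, s, rfl⟩ := exists_germ_of_le M hy m
  have hs : s ∈ Submodule.span Γ(X, V) (Set.range fun i => res M hVU (e i)) := by
    rw [(he V hVU).2]; trivial
  induction hs using Submodule.span_induction with
  | mem s hs =>
    obtain ⟨i, rfl⟩ := hs
    exact Submodule.subset_span ⟨i, (germ_res M hVU y hV (e i)).symm⟩
  | zero => rw [map_zero]; exact Submodule.zero_mem _
  | add a b ha hb iha ihb =>
    rw [map_add]
    exact Submodule.add_mem _ (iha trivial) (ihb trivial)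
  | smul r a ha iha =>
    rw [germ_smul]
    exact Submodule.smul_mem _ _ (iha trivial)

/-- The basis of a stalk given by a frame. -/
def IsFrame.stalkBasis [Finite ι] (he : IsFrame M e) {y : X} (hy : y ∈ U) :
    Module.Basis ι (X.presheaf.stalk y) (M.presheaf.stalk y) :=
  .mk (he.linearIndependent_germ hy) (he.span_germ hy).ge

theorem IsFrame.stalkBasis_apply [Finite ι] (he : IsFrame M e) {y : X} (hy : y ∈ U) (i : ι) :
    he.stalkBasis hy i = M.presheaf.germ U y hy (e i) := Module.Basis.mk_apply _ _ _

section
variable [IsIntegral X]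

theorem IsFrame.toGeneric_stalkBasis [Finite ι] (he : IsFrame M e) {y : X} (hy : y ∈ U) (i : ι) :
    toGeneric M y (he.stalkBasis hy i) = he.stalkBasis (genericPoint_mem hy) i := by
  rw [he.stalkBasis_apply, he.stalkBasis_apply, toGeneric_germ]

/-- A frame gives bases of the stalk at y and of the generic stalk that correspond, and the local
ring at y embeds in the function field. -/
theorem IsVectorBundle.torsionFree {r : ℕ} (hM : IsVectorBundle M r) : TorsionFree M := by
  intro y
  obtain ⟨U, hy, e, he⟩ := hM y
  exact injective_of_basis (IsFrame.stalkBasis he hy) (IsFrame.stalkBasis he (genericPoint_mem hy))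
    _ (algebraMap_functionField_injective X y) (IsFrame.toGeneric_stalkBasis he hy)

end

/-! ### Stalks of exterior powers -/

variable (M) (n : ℕ)

/-- The canonical map from exterior powers of sections to sections of the exterior power. -/
def toExtPower (U : X.Opens) : ⋀[Γ(X, U)]^n Γ(M, U) →ₗ[Γ(X, U)] Γ(extPower M n, U) where
  toFun := ((PresheafOfModules.sheafificationAdjunction (𝟙 X.ringCatSheaf.obj)).unit.app
    (exteriorPresheaf M n)).app (op U)
  map_add' := map_add _
  map_smul' := map_smul _

theorem res_toExtPower {U V : X.Opens} (h : V ≤ U) (ω : ⋀[Γ(X, U)]^n Γ(M, U)) :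
    res (extPower M n) h (toExtPower M n U ω) = toExtPower M n V (exteriorRes M n h ω) :=
  (PresheafOfModules.naturality_apply
    ((PresheafOfModules.sheafificationAdjunction (𝟙 X.ringCatSheaf.obj)).unit.app
    (exteriorPresheaf M n)) (homOfLE h).op ω).symm

/-- Sheafification kills only what is locally zero. Together with `exists_toExtPower_eq`, by which
sections of the sheafification lift locally, this gives access to the stalks of the exterior power.
-/
theorem exists_exteriorRes_eq_zero {U : X.Opens} (ω : ⋀[Γ(X, U)]^n Γ(M, U))
    (hω : toExtPower M n U ω = 0) {y : X} (hy : y ∈ U) :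
    ∃ (V : X.Opens) (_ : y ∈ V) (h : V ≤ U), exteriorRes M n h ω = 0 := by
  have := CategoryTheory.Presheaf.equalizerSieve_mem (Opens.grothendieckTopology X)
    (CategoryTheory.toSheafify (Opens.grothendieckTopology X) (exteriorPresheaf M n).presheaf)
    (X := op U) ω 0 (by
      refine Eq.trans ?_ (map_zero _).symm
      exact hω)
  obtain ⟨V, i, h, hV⟩ := this y hy
  exact ⟨V, hV, i.le, h.trans (map_zero _)⟩

theorem exists_toExtPower_eq {U : X.Opens} (s : Γ(extPower M n, U)) {y : X} (hy : y ∈ U) :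
    ∃ (V : X.Opens) (_ : y ∈ V) (h : V ≤ U) (ω : ⋀[Γ(X, V)]^n Γ(M, V)),
      toExtPower M n V ω = res (extPower M n) h s := by
  have := CategoryTheory.Presheaf.imageSieve_mem (Opens.grothendieckTopology X)
    (CategoryTheory.toSheafify (Opens.grothendieckTopology X) (exteriorPresheaf M n).presheaf)
    (U := op U) s
  obtain ⟨V, i, ⟨ω, h⟩, hV⟩ := this y hy
  exact ⟨V, hV, i.le, ω, h⟩

end

section
variable {X : Scheme.{u}} {M : X.Modules} {r : ℕ} {U : X.Opens} {e : Fin r → Γ(M, U)} (n : ℕ)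

/-- The exterior products of the sections of a frame. -/
def frameWedge (e : Fin r → Γ(M, U)) (I : Set.powersetCard (Fin r) n) : Γ(extPower M n, U) :=
  wedge (e ∘ Set.powersetCard.ofFinEmbEquiv.symm I)

theorem IsFrame.exteriorPower_basis_apply (he : IsFrame M e) {V : X.Opens} (h : V ≤ U)
    (I : Set.powersetCard (Fin r) n) : (he.basis h).exteriorPower n I =
      exteriorRes M n h (exteriorPower.ιMulti _ n (e ∘ Set.powersetCard.ofFinEmbEquiv.symm I)) := by
  rw [exteriorPower.basis_apply, exteriorPower.ιMulti_family, exteriorRes, exteriorMap_ιMulti]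
  congr 1
  ext i
  exact he.basis_apply h _

/-- A relation between germs is spread out to a neighbourhood and then, after shrinking once more,
lifted from the sheafification to the presheaf, where the exterior products of a basis are a basis.
-/
theorem IsFrame.linearIndependent_frameWedge (he : IsFrame M e) {y : X} (hy : y ∈ U) :
    LinearIndependent (X.presheaf.stalk y)
      fun I => (extPower M n).presheaf.germ U y hy (frameWedge n e I) := by
  rw [Fintype.linearIndependent_iff]
  intro c hc I
  obtain ⟨V, hV, hVU, c, rfl⟩ : ∃ (V : X.Opens) (hV : y ∈ V) (_ : V ≤ U)
      (s : Set.powersetCard (Fin r) n → Γ(X, V)), (fun i => X.presheaf.germ V y hV (s i)) = c := by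
    obtain ⟨V, hV, hVU, s, hs⟩ := exists_germsO hy c
    exact ⟨V, hV, hVU, s, funext hs⟩
  have h1 : (extPower M n).presheaf.germ V y hV
      (toExtPower M n V (∑ I, c I • (he.basis hVU).exteriorPower n I)) = 0 := by
    rw [← hc, map_sum, map_sum]
    refine Finset.sum_congr rfl fun I _ => ?_
    rw [map_smul, germ_smul, he.exteriorPower_basis_apply, ← res_toExtPower, germ_res]
    rfl
  obtain ⟨W, hW, hWV, h2⟩ := exists_res_eq_zero _ hV _ h1
  rw [res_toExtPower] at h2
  obtain ⟨W', hW', hWW', h3⟩ := exists_exteriorRes_eq_zero M n _ h2 hW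
  rw [exteriorRes_exteriorRes, map_sum] at h3
  have h4 : ∑ I, resO (hWW'.trans hWV) (c I) •
      (he.basis ((hWW'.trans hWV).trans hVU)).exteriorPower n I = 0 := by
    rw [← h3]
    refine Finset.sum_congr rfl fun I _ => ?_
    rw [map_smulₛₗ, he.exteriorPower_basis_apply, he.exteriorPower_basis_apply,
      exteriorRes_exteriorRes]
    rfl
  have h5 := Fintype.linearIndependent_iff.mp
    ((he.basis ((hWW'.trans hWV).trans hVU)).exteriorPower n).linearIndependent _ h4 I
  have h6 := germ_resO (hWW'.trans hWV) y hW' (c I)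
  rw [h5, map_zero] at h6
  exact h6.symm

theorem exists_germ_toExtPower {y : X} (hy : y ∈ U) (m : (extPower M n).presheaf.stalk y) :
    ∃ (V : X.Opens) (hV : y ∈ V) (_ : V ≤ U) (ω : ⋀[Γ(X, V)]^n Γ(M, V)),
      (extPower M n).presheaf.germ V y hV (toExtPower M n V ω) = m := by
  obtain ⟨V, hV, hVU, s, rfl⟩ := exists_germ_of_le _ hy m
  obtain ⟨W, hW, hWV, ω, hω⟩ := exists_toExtPower_eq M n s hV
  exact ⟨W, hW, hWV.trans hVU, ω, by rw [hω, germ_res]⟩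

theorem IsFrame.span_frameWedge (he : IsFrame M e) {y : X} (hy : y ∈ U) :
    Submodule.span (X.presheaf.stalk y)
      (Set.range fun I => (extPower M n).presheaf.germ U y hy (frameWedge n e I)) = ⊤ := by
  refine eq_top_iff.mpr fun m _ => ?_
  obtain ⟨V, hV, hVU, ω, rfl⟩ := exists_germ_toExtPower n hy m
  rw [← ((he.basis hVU).exteriorPower n).sum_repr ω, map_sum, map_sum]
  refine Submodule.sum_mem _ fun I _ => ?_
  rw [map_smul, germ_smul]
  refine Submodule.smul_mem _ _ (Submodule.subset_span ⟨I, ?_⟩)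
  rw [he.exteriorPower_basis_apply, ← res_toExtPower, germ_res]
  rfl

/-- The basis of a stalk of the exterior power given by a frame. -/
def IsFrame.extStalkBasis (he : IsFrame M e) {y : X} (hy : y ∈ U) :
    Module.Basis (Set.powersetCard (Fin r) n) (X.presheaf.stalk y)
      ((extPower M n).presheaf.stalk y) :=
  .mk (he.linearIndependent_frameWedge n hy) (he.span_frameWedge n hy).ge

theorem IsFrame.extStalkBasis_apply (he : IsFrame M e) {y : X} (hy : y ∈ U)
    (I : Set.powersetCard (Fin r) n) :
    he.extStalkBasis n hy I = (extPower M n).presheaf.germ U y hy (frameWedge n e I) :=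
  Module.Basis.mk_apply _ _ _

/-- The map is defined through the frame, but its values on germs of all decomposable sections, over
arbitrary neighbourhoods, show that it does not depend on the frame. -/
theorem IsFrame.exists_extStalkEquiv (he : IsFrame M e) {y : X} (hy : y ∈ U) :
    ∃ θ : (extPower M n).presheaf.stalk y ≃ₗ[X.presheaf.stalk y]
      ⋀[X.presheaf.stalk y]^n (M.presheaf.stalk y),
      ∀ (W : X.Opens) (hW : y ∈ W) (s : Fin n → Γ(M, W)),
        θ ((extPower M n).presheaf.germ W y hW (wedge s)) =
          exteriorPower.ιMulti _ n fun i => M.presheaf.germ W y hW (s i) := by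
  let θ := (he.extStalkBasis n hy).equiv ((he.stalkBasis hy).exteriorPower n) (Equiv.refl _)
  have key (W : X.Opens) (hW : y ∈ W) (hWU : W ≤ U) (ω : ⋀[Γ(X, W)]^n Γ(M, W)) :
      θ ((extPower M n).presheaf.germ W y hW (toExtPower M n W ω)) =
        exteriorMap (X.presheaf.germ W y hW).hom n (germLinear M hW) ω := by
    rw [← ((he.basis hWU).exteriorPower n).sum_repr ω]
    simp only [map_sum]
    refine Finset.sum_congr rfl fun I _ => ?_
    rw [map_smul, germ_smul, map_smul, map_smulₛₗ]
    congr 1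
    rw [he.exteriorPower_basis_apply, ← res_toExtPower, germ_res]
    refine (congrArg θ (he.extStalkBasis_apply n hy I).symm).trans ?_
    rw [Module.Basis.equiv_apply, Equiv.refl_apply, exteriorPower.basis_apply,
      exteriorPower.ιMulti_family, exteriorRes, exteriorMap_ιMulti, exteriorMap_ιMulti]
    congr 1
    ext i
    exact (he.stalkBasis_apply hy _).trans (germ_res M hWU y hW _).symm
  refine ⟨θ, fun W hW s => ?_⟩
  obtain ⟨W', hW', hWW', hWU'⟩ := exists_smaller_open hW hy
  have h := key W' hW' hWU' (exteriorRes M n hWW' (exteriorPower.ιMulti _ n s))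
  rw [← res_toExtPower, germ_res] at h
  refine h.trans ?_
  rw [exteriorRes, exteriorMap_ιMulti, exteriorMap_ιMulti]
  congr 1
  ext i
  exact germ_res M hWW' y hW' _

variable {n}

/-- The stalks of the exterior powers of a vector bundle are the exterior powers of its stalks. -/
def extStalkEquiv (hM : IsVectorBundle M r) (n : ℕ) (y : X) :
    (extPower M n).presheaf.stalk y ≃ₗ[X.presheaf.stalk y]
      ⋀[X.presheaf.stalk y]^n (M.presheaf.stalk y) :=
  (IsFrame.exists_extStalkEquiv n (hM y).choose_spec.choose_spec.choose_spec
    (hM y).choose_spec.choose).choose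

theorem extStalkEquiv_germ_wedge (hM : IsVectorBundle M r) {y : X} {W : X.Opens} (hW : y ∈ W)
    (s : Fin n → Γ(M, W)) :
    extStalkEquiv hM n y ((extPower M n).presheaf.germ W y hW (wedge s)) =
      exteriorPower.ιMulti _ n fun i => M.presheaf.germ W y hW (s i) :=
  (IsFrame.exists_extStalkEquiv n (hM y).choose_spec.choose_spec.choose_spec
    (hM y).choose_spec.choose).choose_spec W hW s

/-- Germs of decomposable sections span the stalk, since finitely many germs of M extend to a common
neighbourhood. -/
theorem extStalk_induction (hM : IsVectorBundle M r) {y : X}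
    {p : (extPower M n).presheaf.stalk y → Prop}
    (hw : ∀ (W : X.Opens) (hW : y ∈ W) (s : Fin n → Γ(M, W)),
      p ((extPower M n).presheaf.germ W y hW (wedge s)))
    (hz : p 0) (ha : ∀ a b, p a → p b → p (a + b)) (hs : ∀ (c : X.presheaf.stalk y) a, p a → p (c • a))
    (m : (extPower M n).presheaf.stalk y) : p m := by
  obtain ⟨ω, rfl⟩ := (extStalkEquiv hM n y).symm.surjective m
  have hω : ω ∈ Submodule.span (X.presheaf.stalk y)
      (Set.range (exteriorPower.ιMulti (X.presheaf.stalk y) n)) := by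
    rw [exteriorPower.ιMulti_span]; trivial
  induction hω using Submodule.span_induction with
  | mem ω hω =>
    obtain ⟨m, rfl⟩ := hω
    obtain ⟨V, hV, -, s, hs⟩ := exists_germs M (U := ⊤) (y := y) trivial m
    obtain rfl : (fun i => M.presheaf.germ V y hV (s i)) = m := funext hs
    rw [← extStalkEquiv_germ_wedge hM, LinearEquiv.symm_apply_apply]
    exact hw V hV s
  | zero => rw [map_zero]; exact hz
  | add a b _ _ iha ihb => rw [map_add]; exact ha _ _ iha ihb
  | smul c a _ iha => rw [map_smul]; exact hs _ _ iha

variable [IsIntegral X]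

theorem extStalkEquiv_toGeneric (hM : IsVectorBundle M r) (y : X)
    (m : (extPower M n).presheaf.stalk y) :
    extStalkEquiv hM n (genericPoint X) (toGeneric (extPower M n) y m) =
      exteriorMap (algebraMap (X.presheaf.stalk y) X.functionField) n (toGeneric M y)
        (extStalkEquiv hM n y m) := by
  induction m using extStalk_induction hM with
  | hw W hW s =>
    rw [toGeneric_germ, extStalkEquiv_germ_wedge, extStalkEquiv_germ_wedge, exteriorMap_ιMulti]
    congr 1
    ext i
    exact (toGeneric_germ M hW (s i)).symm
  | hz => simp only [map_zero]
  | ha a b iha ihb => simp only [map_add, iha, ihb]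
  | hs c a iha =>
    rw [map_smulₛₗ, map_smul, map_smulₛₗ, map_smulₛₗ, iha]
    rfl

end

/-! ### Sections away from a point -/

section
variable {X : Scheme.{u}} (M : X.Modules) (x : X)

/-- The open set `U ∖ {x}`. -/
def awayOpen (U : X.Opens) : X.Opens := (punctured x).ι ''ᵁ ((punctured x).ι ⁻¹ᵁ U)

/-- Sections of `away M x` over `U` are sections of `M` over `U ∖ {x}`. -/
def ofAway {U : X.Opens} (s : Γ(away M x, U)) : Γ(M, awayOpen x U) := s

/-- Sections of `M` over `U ∖ {x}` are sections of `away M x` over `U`. -/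
def mkAway {U : X.Opens} (s : Γ(M, awayOpen x U)) : Γ(away M x, U) := s

theorem mem_awayOpen {U : X.Opens} {y : X} : y ∈ awayOpen x U ↔ y ∈ punctured x ∧ y ∈ U := by
  constructor
  · rintro ⟨z, hz, rfl⟩
    exact ⟨z.2, hz⟩
  · rintro ⟨h1, h2⟩
    exact ⟨⟨y, h1⟩, h2, rfl⟩

theorem mem_punctured {x : X} (hx : IsClosed ({x} : Set X)) {y : X} : y ∈ punctured x ↔ y ≠ x := by
  change y ∈ (closure {x})ᶜ ↔ _
  rw [hx.closure_eq]
  rfl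

theorem awayOpen_le (U : X.Opens) : awayOpen x U ≤ U := fun _ hy => ((mem_awayOpen x).mp hy).2

theorem awayOpen_mono {U V : X.Opens} (h : V ≤ U) : awayOpen x V ≤ awayOpen x U := fun _ hy =>
  (mem_awayOpen x).mpr ⟨((mem_awayOpen x).mp hy).1, h ((mem_awayOpen x).mp hy).2⟩

variable {M x}

theorem ofAway_res {U V : X.Opens} (h : V ≤ U) (s : Γ(away M x, U)) :
    ofAway M x (res (away M x) h s) = res M (awayOpen_mono x h) (ofAway M x s) := rfl

theorem ofAway_toAway {U : X.Opens} (s : Γ(M, U)) :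
    ofAway M x ((toAway M x).app U s) = res M (awayOpen_le x U) s := rfl

theorem stalkMap_germ {M M' : X.Modules} (φ : M ⟶ M') {U : X.Opens} {y : X} (hy : y ∈ U)
    (s : Γ(M, U)) : stalkMap φ y (M.presheaf.germ U y hy s) = M'.presheaf.germ U y hy (φ.app U s) :=
  (germ_app φ hy s).symm

/-- A section of `away M x` near a point other than `x` comes from `M`. -/
theorem exists_stalkMap_toAway {y : X} (hy : y ∈ punctured x) {U : X.Opens} (hU : y ∈ U)
    (s : Γ(away M x, U)) : (away M x).presheaf.germ U y hU s =
      stalkMap (toAway M x) y (M.presheaf.germ _ y ((mem_awayOpen x).mpr ⟨hy, hU⟩)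
        (ofAway M x s)) := by
  rw [stalkMap_germ, ← germ_res _ (awayOpen_le x U) y ((mem_awayOpen x).mpr ⟨hy, hU⟩) s]
  congr 1

theorem stalkMap_toAway_injective {y : X} (hy : y ∈ punctured x) :
    Function.Injective (stalkMap (toAway M x) y) := by
  rw [injective_iff_map_eq_zero]
  intro m hm
  obtain ⟨U, hU, m, rfl⟩ := TopCat.Presheaf.exists_germ_eq M.presheaf m
  rw [stalkMap_germ] at hm
  obtain ⟨V, hV, hVU, h⟩ := exists_res_eq_zero _ hU _ hm
  have h1 : res M ((awayOpen_mono x hVU).trans (awayOpen_le x U)) m = 0 := by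
    have h2 : ofAway M x (res (away M x) hVU ((toAway M x).app U m)) = 0 := congrArg (ofAway M x) h
    rwa [ofAway_res, ofAway_toAway, res_res] at h2
  rw [← germ_res M ((awayOpen_mono x hVU).trans (awayOpen_le x U)) y
    ((mem_awayOpen x).mpr ⟨hy, hV⟩), h1, map_zero]

theorem stalkMap_toAway_surjective {y : X} (hy : y ∈ punctured x) :
    Function.Surjective (stalkMap (toAway M x) y) := by
  intro m
  obtain ⟨U, hU, m, rfl⟩ := TopCat.Presheaf.exists_germ_eq (away M x).presheaf m
  exact ⟨_, (exists_stalkMap_toAway hy hU m).symm⟩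

/-! ### Stalks of subsheaves -/

variable {N : Submodule (X.presheaf.stalk x) (M.presheaf.stalk x)}

theorem stalkMap_subAtι_injective (y : X) : Function.Injective (stalkMap (subAtι M x N) y) := by
  rw [injective_iff_map_eq_zero]
  intro m hm
  obtain ⟨U, hU, m, rfl⟩ := TopCat.Presheaf.exists_germ_eq (subAt M x N).presheaf m
  rw [stalkMap_germ] at hm
  obtain ⟨V, hV, hVU, h⟩ := exists_res_eq_zero _ hU _ hm
  have h1 : res (subAt M x N) hVU m = 0 := Subtype.ext h
  rw [← germ_res _ hVU y hV, h1, map_zero]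

theorem mem_range_stalkMap_subAtι (m : M.presheaf.stalk x) :
    (∃ m', stalkMap (subAtι M x N) x m' = m) ↔ m ∈ N := by
  constructor
  · rintro ⟨m, rfl⟩
    obtain ⟨U, hU, m, rfl⟩ := TopCat.Presheaf.exists_germ_eq (subAt M x N).presheaf m
    rw [stalkMap_germ]
    exact m.2 hU
  · intro hm
    obtain ⟨U, hU, m, rfl⟩ := TopCat.Presheaf.exists_germ_eq M.presheaf m
    let s : Γ(subAt M x N, U) := ⟨m, fun _ => hm⟩
    exact ⟨(subAt M x N).presheaf.germ U x hU s, by rw [stalkMap_germ]; rfl⟩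

theorem stalkMap_subAtι_surjective {y : X} (hy : y ∈ punctured x) :
    Function.Surjective (stalkMap (subAtι M x N) y) := by
  intro m
  obtain ⟨U, hU, hUp, m, rfl⟩ := exists_germ_of_le M hy m
  let s : Γ(subAt M x N, U) := ⟨m, fun hx => (hUp hx (subset_closure rfl)).elim⟩
  exact ⟨(subAt M x N).presheaf.germ U y hU s, by rw [stalkMap_germ]; rfl⟩

end

/-! ### Local parameters -/

section
variable {X : Scheme.{u}} [IsIntegral X]

/-- A local parameter at a closed point `x`, invertible at all other points of its domain. -/
structure LocalParameter (x : X) where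
  isClosed : IsClosed ({x} : Set X)
  U : X.Opens
  mem : x ∈ U
  t : Γ(X, U)
  irreducible : Irreducible (X.presheaf.germ U x mem t)
  isUnit (y : X) (hy : y ∈ U) : y ≠ x → IsUnit (X.presheaf.germ U y hy t)

namespace LocalParameter
variable {x : X} (p : LocalParameter x)

/-- The germ of the parameter in the local ring. -/
def ϖ : X.presheaf.stalk x := X.presheaf.germ p.U x p.mem p.t

/-- The parameter as a rational function. -/
def τ : X.functionField := algebraMap (X.presheaf.stalk x) X.functionField p.ϖ

-- The stalk at the generic point is a field, and a field has no irreducible elements.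
include p in
theorem genericPoint_ne : genericPoint X ≠ x := by
  rintro rfl
  have h := p.irreducible
  exact h.not_isUnit (isUnit_iff_ne_zero.mpr h.ne_zero)

include p in
omit [IsIntegral X] in
theorem mem_punctured {y : X} : y ∈ punctured x ↔ y ≠ x := OrthHecke.mem_punctured p.isClosed

include p in
theorem genericPoint_mem_punctured : genericPoint X ∈ punctured x :=
  p.mem_punctured.mpr p.genericPoint_ne

theorem τ_ne_zero : p.τ ≠ 0 := by
  rw [τ, Ne, map_eq_zero_iff _ (algebraMap_functionField_injective X x)]
  exact p.irreducible.ne_zero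

theorem τ_eq {y : X} (hy : y ∈ p.U) :
    p.τ = algebraMap (X.presheaf.stalk y) X.functionField (X.presheaf.germ p.U y hy p.t) :=
  (algebraMap_germ p.mem p.t).trans (algebraMap_germ hy p.t).symm

theorem exists_τ_inv {y : X} (hy : y ∈ p.U) (hyx : y ≠ x) (n : ℕ) :
    ∃ c, p.τ ^ n * algebraMap (X.presheaf.stalk y) X.functionField c = 1 := by
  obtain ⟨u, hu⟩ := p.isUnit y hy hyx
  refine ⟨(↑u⁻¹) ^ n, ?_⟩
  rw [p.τ_eq hy, ← hu, ← map_pow, ← map_mul, ← mul_pow, Units.mul_inv, one_pow, map_one]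

end LocalParameter

/-! ### Models: torsion-free sheaves as families of lattices in a vector space -/

/-- A torsion-free sheaf of modules together with an identification of its generic stalk. -/
structure Model (M : X.Modules) (V : Type u) [AddCommGroup V] [Module X.functionField V] where
  torsionFree : TorsionFree M
  equiv : genericStalk M ≃ₗ[X.functionField] V

namespace Model

variable {M M' : X.Modules} {V : Type u} [AddCommGroup V] [Module X.functionField V]
  (μ : Model M V)

/-- The embedding of the stalk at `y`. -/
def emb (y : X) : M.presheaf.stalk y →ₛₗ[algebraMap (X.presheaf.stalk y) X.functionField] V where
  toFun m := μ.equiv (toGeneric M y m)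
  map_add' a b := by rw [map_add, map_add]
  map_smul' c a := by rw [map_smulₛₗ]; exact μ.equiv.map_smul _ _

theorem emb_apply (y : X) (m : M.presheaf.stalk y) : μ.emb y m = μ.equiv (toGeneric M y m) := rfl

theorem emb_injective (y : X) : Function.Injective (μ.emb y) :=
  μ.equiv.injective.comp (μ.torsionFree y)

theorem emb_genericPoint (m : genericStalk M) : μ.emb (genericPoint X) m = μ.equiv m := by
  rw [emb_apply, toGeneric_genericPoint]

theorem emb_germ {U : X.Opens} {y : X} (hy : y ∈ U) (s : Γ(M, U)) :
    μ.emb y (M.presheaf.germ U y hy s) =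
      μ.equiv (M.presheaf.germ U (genericPoint X) (genericPoint_mem hy) s) := by
  rw [emb_apply, toGeneric_germ]

/-- The lattice at `y`. -/
def lat (y : X) : AddSubgroup V := (μ.emb y).toAddMonoidHom.range

theorem mem_lat {y : X} {v : V} : v ∈ μ.lat y ↔ ∃ m, μ.emb y m = v := Iff.rfl

theorem mem_lattice_iff {y : X} {v : genericStalk M} : v ∈ lattice M y ↔ μ.equiv v ∈ μ.lat y := by
  rw [mem_lattice, mem_lat]
  exact exists_congr fun m => μ.equiv.injective.eq_iff.symm

theorem smul_mem_lat {y : X} {v : V} (hv : v ∈ μ.lat y) (c : X.presheaf.stalk y) :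
    algebraMap (X.presheaf.stalk y) X.functionField c • v ∈ μ.lat y := by
  obtain ⟨m, rfl⟩ := hv
  exact ⟨c • m, map_smulₛₗ (μ.emb y) c m⟩

/-- Membership in the lattices is an open condition. -/
theorem exists_open_mem_lat {y : X} {v : V} (hv : v ∈ μ.lat y) :
    ∃ U : X.Opens, y ∈ U ∧ ∀ z ∈ U, v ∈ μ.lat z := by
  obtain ⟨m, rfl⟩ := hv
  obtain ⟨U, hU, m, rfl⟩ := TopCat.Presheaf.exists_germ_eq M.presheaf m
  exact ⟨U, hU, fun z hz =>
    ⟨M.presheaf.germ U z hz m, (μ.emb_germ hz m).trans (μ.emb_germ hU m).symm⟩⟩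

theorem section_ext {U : X.Opens} (s s' : Γ(M, U))
    (h : ∀ y (hy : y ∈ U), μ.emb y (M.presheaf.germ U y hy s) = μ.emb y (M.presheaf.germ U y hy s')) :
    s = s' :=
  μ.torsionFree.section_ext s s' fun hη => by
    have := h _ hη
    rwa [emb_germ, emb_germ, μ.equiv.injective.eq_iff] at this

theorem exists_section (U : X.Opens) (v : V) (hv : ∀ y ∈ U, v ∈ μ.lat y) :
    ∃ s : Γ(M, U), ∀ y (hy : y ∈ U), μ.emb y (M.presheaf.germ U y hy s) = v := by
  obtain ⟨s, hs⟩ := μ.torsionFree.exists_section U (μ.equiv.symm v) fun y hy => by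
    rw [μ.mem_lattice_iff, LinearEquiv.apply_symm_apply]
    exact hv y hy
  exact ⟨s, fun y hy => by rw [emb_germ, hs, LinearEquiv.apply_symm_apply]⟩

/-- Change of the ambient space. -/
def trans {V' : Type u} [AddCommGroup V'] [Module X.functionField V']
    (θ : V ≃ₗ[X.functionField] V') : Model M V' := ⟨μ.torsionFree, μ.equiv.trans θ⟩

theorem trans_emb {V' : Type u} [AddCommGroup V'] [Module X.functionField V']
    (θ : V ≃ₗ[X.functionField] V') (y : X) (m : M.presheaf.stalk y) :
    (μ.trans θ).emb y m = θ (μ.emb y m) := rfl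

theorem mem_trans_lat {V' : Type u} [AddCommGroup V'] [Module X.functionField V']
    (θ : V ≃ₗ[X.functionField] V') {y : X} {v : V'} :
    v ∈ (μ.trans θ).lat y ↔ θ.symm v ∈ μ.lat y := by
  rw [mem_lat, mem_lat]
  exact exists_congr fun m => by rw [trans_emb, LinearEquiv.eq_symm_apply]

/-- The identity of V respects all lattices and hence comes from an isomorphism of sheaves. The
isomorphism of orthogonal bundles and the trivialization of the new determinant are both obtained in
this way. -/
theorem exists_iso (μ' : Model M' V) (h : ∀ y v, v ∈ μ'.lat y ↔ v ∈ μ.lat y) :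
    ∃ φ : M ≅ M', ∀ y m, μ'.emb y (stalkMap φ.hom y m) = μ.emb y m := by
  obtain ⟨φ, hφ⟩ := μ.torsionFree.exists_iso μ'.torsionFree (μ.equiv.trans μ'.equiv.symm)
    fun y v => by
      rw [μ'.mem_lattice_iff, μ.mem_lattice_iff, h]
      simp
  refine ⟨φ, fun y m => ?_⟩
  rw [emb_apply, toGeneric_stalkMap, hφ]
  simp [emb_apply]

variable {x : X} (p : LocalParameter x) (N : Submodule (X.presheaf.stalk x) (M.presheaf.stalk x))

/-- The model of a subsheaf. -/
def subAt : Model (OrthHecke.subAt M x N) V where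
  torsionFree y := by
    have h : Function.Injective
        (stalkMap (subAtι M x N) (genericPoint X) ∘ toGeneric (OrthHecke.subAt M x N) y) := by
      have : stalkMap (subAtι M x N) (genericPoint X) ∘ toGeneric (OrthHecke.subAt M x N) y =
          toGeneric M y ∘ stalkMap (subAtι M x N) y :=
        funext fun m => (toGeneric_stalkMap _ _ _).symm
      rw [this]
      exact (μ.torsionFree y).comp (stalkMap_subAtι_injective y)
    exact h.of_comp
  equiv := (LinearEquiv.ofBijective (stalkMap (subAtι M x N) (genericPoint X))
    ⟨stalkMap_subAtι_injective _, stalkMap_subAtι_surjective p.genericPoint_mem_punctured⟩).trans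
      μ.equiv

theorem subAt_emb (y : X) (m : (OrthHecke.subAt M x N).presheaf.stalk y) :
    (μ.subAt p N).emb y m = μ.emb y (stalkMap (subAtι M x N) y m) := by
  rw [emb_apply, emb_apply, toGeneric_stalkMap]
  rfl

theorem mem_subAt_lat_self {v : V} :
    v ∈ (μ.subAt p N).lat x ↔ ∃ m ∈ N, μ.emb x m = v := by
  rw [mem_lat]
  constructor
  · rintro ⟨m, rfl⟩
    exact ⟨_, (mem_range_stalkMap_subAtι _).mp ⟨m, rfl⟩, (μ.subAt_emb p N x m).symm⟩
  · rintro ⟨m, hm, rfl⟩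
    obtain ⟨m, rfl⟩ := (mem_range_stalkMap_subAtι _).mpr hm
    exact ⟨m, μ.subAt_emb p N x m⟩

theorem subAt_lat_of_ne {y : X} (hy : y ≠ x) : (μ.subAt p N).lat y = μ.lat y := by
  ext v
  rw [mem_lat, mem_lat, (stalkMap_subAtι_surjective (N := N) (p.mem_punctured.mpr hy)).exists]
  exact exists_congr fun m => by rw [subAt_emb]

/-- The model of `away M x`. -/
def away : Model (OrthHecke.away M x) V where
  torsionFree y := by
    rw [injective_iff_map_eq_zero]
    intro m hm
    obtain ⟨U, hU, s, rfl⟩ := TopCat.Presheaf.exists_germ_eq (OrthHecke.away M x).presheaf m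
    rw [toGeneric_germ, exists_stalkMap_toAway p.genericPoint_mem_punctured,
      map_eq_zero_iff _ (stalkMap_toAway_injective p.genericPoint_mem_punctured)] at hm
    -- A section of `away M x` over U is nothing but a section of M over U ∖ {x}, and the latter
    -- vanishes if its generic germ does.
    have : ofAway M x s = 0 := μ.torsionFree.section_ext _ _ fun hη => hm.trans (map_zero _).symm
    have hs : s = 0 := this
    rw [hs, map_zero]
  equiv := (LinearEquiv.ofBijective (stalkMap (toAway M x) (genericPoint X))
    ⟨stalkMap_toAway_injective p.genericPoint_mem_punctured,
      stalkMap_toAway_surjective p.genericPoint_mem_punctured⟩).symm.trans μ.equiv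

theorem away_emb (y : X) (m : M.presheaf.stalk y) :
    (μ.away p).emb y (stalkMap (toAway M x) y m) = μ.emb y m := by
  rw [emb_apply, emb_apply, toGeneric_stalkMap]
  refine congrArg μ.equiv ?_
  exact LinearEquiv.symm_apply_apply (LinearEquiv.ofBijective _ _) _

theorem away_lat_of_ne {y : X} (hy : y ≠ x) : (μ.away p).lat y = μ.lat y := by
  ext v
  rw [mem_lat, mem_lat, (stalkMap_toAway_surjective (p.mem_punctured.mpr hy)).exists]
  exact exists_congr fun m => by rw [away_emb]

/-- A vector lying in the lattices at all other points of a neighbourhood of x is a section of M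
over the punctured neighbourhood. -/
theorem mem_away_lat_self {v : V} {U : X.Opens} (hU : x ∈ U)
    (h : ∀ y ∈ U, y ≠ x → v ∈ μ.lat y) : v ∈ (μ.away p).lat x := by
  obtain ⟨s, hs⟩ := μ.exists_section (awayOpen x U) v fun y hy =>
    h y (awayOpen_le x U hy) (p.mem_punctured.mp ((mem_awayOpen x).mp hy).1)
  refine ⟨(OrthHecke.away M x).presheaf.germ U x hU (mkAway M x s), ?_⟩
  have h1 := genericPoint_mem hU
  have h2 := (μ.away p).emb_germ hU (mkAway M x s)
  rw [← (μ.away p).emb_germ h1, exists_stalkMap_toAway p.genericPoint_mem_punctured h1,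
    away_emb] at h2
  exact h2.trans (hs _ _)

/-- The model of a twist. -/
def twist (n : ℕ) : Model (OrthHecke.twist M x n) V := (μ.away p).subAt p (poleGerms M x n)

theorem twist_emb (n : ℕ) (y : X) (m : M.presheaf.stalk y) :
    (μ.twist p n).emb y (stalkMap (toTwist M x n) y m) = μ.emb y m := by
  refine ((μ.away p).subAt_emb p _ y _).trans ?_
  rw [← μ.away_emb p]
  congr 1
  exact (stalkMap_comp (toTwist M x n) (subAtι _ x _) y m).symm

theorem twist_lat_of_ne (n : ℕ) {y : X} (hy : y ≠ x) : (μ.twist p n).lat y = μ.lat y :=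
  ((μ.away p).subAt_lat_of_ne p _ hy).trans (μ.away_lat_of_ne p hy)

variable [IsDiscreteValuationRing (X.presheaf.stalk x)]

/-- Since 𝔪ⁿ is generated by ϖⁿ, the pole condition is a condition on τⁿv alone. Conversely, if τⁿv
lies in the lattice at x, it lies in those at nearby points, where τ is invertible off x; so v is a
section near x with x removed. -/
theorem mem_twist_lat_self (n : ℕ) {v : V} :
    v ∈ (μ.twist p n).lat x ↔ p.τ ^ n • v ∈ μ.lat x := by
  refine ((μ.away p).mem_subAt_lat_self p _).trans ?_
  have hm : maximalIdeal (X.presheaf.stalk x) ^ n = Ideal.span {p.ϖ ^ n} := by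
    rw [p.irreducible.maximalIdeal_eq, Ideal.span_singleton_pow]; rfl
  have hτ : p.τ ^ n = algebraMap (X.presheaf.stalk x) X.functionField (p.ϖ ^ n) := by
    rw [map_pow]; rfl
  constructor
  · rintro ⟨σ, hσ, rfl⟩
    obtain ⟨m, hm'⟩ := hσ (p.ϖ ^ n) (hm ▸ Ideal.mem_span_singleton_self _)
    refine μ.mem_lat.mpr ⟨m, ?_⟩
    rw [← μ.away_emb p, hm', map_smulₛₗ, hτ]
  · intro hv
    obtain ⟨U, hxU, hU⟩ := μ.exists_open_mem_lat hv
    obtain ⟨σ, hσ⟩ := μ.mem_away_lat_self p (v := v) (U := U ⊓ p.U) ⟨hxU, p.mem⟩ fun y hy hyx => by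
      obtain ⟨c, hc⟩ := p.exists_τ_inv hy.2 hyx n
      have := μ.smul_mem_lat (hU y hy.1) c
      rwa [smul_smul, mul_comm, hc, one_smul] at this
    refine ⟨σ, fun f hf => ?_, hσ⟩
    replace hσ : (μ.away p).emb x σ = v := hσ
    rw [hm, Ideal.mem_span_singleton'] at hf
    obtain ⟨a, rfl⟩ := hf
    obtain ⟨m, hm'⟩ := μ.mem_lat.mp hv
    refine ⟨a • m, (μ.away p).emb_injective x ?_⟩
    rw [map_smul, map_smulₛₗ, away_emb, hm', map_smulₛₗ, hσ, map_mul, mul_smul, hτ]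

end Model

end

/-! ### The structure sheaf inside the function field -/

section
variable {X : Scheme.{u}}

/-- Regular functions as sections of the structure sheaf. -/
def ofFunction {U : X.Opens} (s : Γ(X, U)) : Γ(structureModule X, U) := s

theorem structureModule_isFrame :
    IsFrame (structureModule X) (U := ⊤) (fun _ : Fin 1 => ofFunction 1) := by
  intro V h
  have h1 : res (structureModule X) h (ofFunction (1 : Γ(X, ⊤))) = ofFunction (1 : Γ(X, V)) :=
    map_one (X.presheaf.map (homOfLE h).op).hom
  have h2 (c : Γ(X, V)) : c • ofFunction (1 : Γ(X, V)) = ofFunction c := mul_one c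
  simp only [h1]
  constructor
  · rw [Fintype.linearIndependent_iff]
    intro c hc i
    rw [Fin.sum_univ_one, h2] at hc
    rw [Subsingleton.elim i 0]
    exact hc
  · refine eq_top_iff.mpr fun s _ => ?_
    have : s = toFunction s • ofFunction (1 : Γ(X, V)) := (h2 _).symm
    rw [this]
    exact Submodule.smul_mem _ _ (Submodule.subset_span ⟨0, rfl⟩)

theorem structureModule_isVectorBundle : IsVectorBundle (structureModule X) 1 := fun _ =>
  ⟨⊤, trivial, _, structureModule_isFrame⟩

variable [IsIntegral X]

variable (X) in
/-- The structure sheaf inside the function field. -/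
def structureModel : Model (structureModule X) X.functionField where
  torsionFree := structureModule_isVectorBundle.torsionFree
  equiv := (structureModule_isFrame.stalkBasis (y := genericPoint X) trivial).equivFun.trans
    (LinearEquiv.funUnique (Fin 1) _ _)

theorem structureModel_emb {U : X.Opens} {y : X} (hy : y ∈ U) (s : Γ(structureModule X, U)) :
    (structureModel X).emb y ((structureModule X).presheaf.germ U y hy s) =
      X.presheaf.germ U (genericPoint X) (genericPoint_mem hy) (toFunction s) := by
  rw [Model.emb_germ]
  have h : s = toFunction s • res (structureModule X) le_top (ofFunction 1) := by
    have h1 : res (structureModule X) le_top (ofFunction (1 : Γ(X, ⊤))) =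
      ofFunction (1 : Γ(X, U)) := map_one (X.presheaf.map (homOfLE le_top).op).hom
    rw [h1]
    exact (mul_one (toFunction s)).symm
  conv_lhs => rw [h, germ_smul, germ_res, map_smul,
    ← structureModule_isFrame.stalkBasis_apply (y := genericPoint X) trivial 0]
  simp [structureModel]

theorem mem_structureModel_lat {y : X} {k : X.functionField} :
    k ∈ (structureModel X).lat y ↔ k ∈ (algebraMap (X.presheaf.stalk y) X.functionField).range := by
  constructor
  · rintro ⟨m, rfl⟩
    obtain ⟨U, hU, s, rfl⟩ := TopCat.Presheaf.exists_germ_eq (structureModule X).presheaf m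
    refine ⟨X.presheaf.germ U y hU (toFunction s), ?_⟩
    rw [algebraMap_germ]
    exact (structureModel_emb hU s).symm
  · rintro ⟨c, rfl⟩
    obtain ⟨U, hU, c, rfl⟩ := X.presheaf.exists_germ_eq c
    refine (structureModel X).mem_lat.mpr
      ⟨(structureModule X).presheaf.germ U y hU (ofFunction c), ?_⟩
    rw [structureModel_emb, algebraMap_germ]
    rfl

theorem function_ext {U : X.Opens} (c c' : Γ(X, U)) (h : ∀ hη : genericPoint X ∈ U,
    X.presheaf.germ U (genericPoint X) hη c = X.presheaf.germ U (genericPoint X) hη c') :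
    c = c' := by
  have := (structureModel X).section_ext (ofFunction c) (ofFunction c') fun y hy => by
    rw [structureModel_emb, structureModel_emb]
    exact h _
  exact this

theorem exists_function (U : X.Opens) (k : X.functionField)
    (hk : ∀ y ∈ U, k ∈ (algebraMap (X.presheaf.stalk y) X.functionField).range) :
    ∃ c : Γ(X, U), ∀ hη, X.presheaf.germ U (genericPoint X) hη c = k := by
  obtain ⟨s, hs⟩ := (structureModel X).exists_section U k fun y hy =>
    mem_structureModel_lat.mpr (hk y hy)
  exact ⟨toFunction s, fun hη => by rw [← structureModel_emb hη s, hs]⟩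

theorem exists_open_mem_range {y : X} {k : X.functionField}
    (hk : k ∈ (algebraMap (X.presheaf.stalk y) X.functionField).range) :
    ∃ U : X.Opens, y ∈ U ∧ ∀ z ∈ U,
      k ∈ (algebraMap (X.presheaf.stalk z) X.functionField).range := by
  obtain ⟨U, hU, h⟩ := (structureModel X).exists_open_mem_lat (mem_structureModel_lat.mpr hk)
  exact ⟨U, hU, fun z hz => mem_structureModel_lat.mp (h z hz)⟩

/-! ### Lattices spanned by a basis, and local freeness -/

namespace Model

variable {M : X.Modules} {V : Type u} [AddCommGroup V] [Module X.functionField V] (μ : Model M V)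
  {ι : Type*}

/-- The lattice at `y` is spanned by the basis `b`. -/
def IsBasisAt (y : X) (b : Module.Basis ι X.functionField V) : Prop :=
  ∀ v, v ∈ μ.lat y ↔ ∀ i, b.repr v i ∈ (algebraMap (X.presheaf.stalk y) X.functionField).range

variable {μ} {y : X} {b : Module.Basis ι X.functionField V}

theorem IsBasisAt.mem_lat (h : μ.IsBasisAt y b) (i : ι) : b i ∈ μ.lat y := by
  classical
  rw [h]
  intro j
  rw [b.repr_self, Finsupp.single_apply]
  split_ifs
  · exact one_mem _
  · exact zero_mem _

theorem IsBasisAt.exists_basis [Finite ι] (h : μ.IsBasisAt y b) :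
    ∃ e : Module.Basis ι (X.presheaf.stalk y) (M.presheaf.stalk y), ∀ i, μ.emb y (e i) = b i := by
  have := Fintype.ofFinite ι
  choose e he using fun i => μ.mem_lat.mp (h.mem_lat i)
  refine ⟨.mk (v := e) ?_ ?_, fun i => by rw [Module.Basis.mk_apply, he]⟩
  · rw [Fintype.linearIndependent_iff]
    intro c hc i
    have h1 := congrArg (μ.emb y) hc
    simp only [map_sum, map_smulₛₗ, he, map_zero] at h1
    have h2 := Fintype.linearIndependent_iff.mp b.linearIndependent _ h1 i
    exact (map_eq_zero_iff _ (algebraMap_functionField_injective X y)).mp h2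
  · intro m _
    choose c hc using (h _).mp (μ.mem_lat.mpr ⟨m, rfl⟩)
    have : m = ∑ i, c i • e i := by
      apply μ.emb_injective y
      simp only [map_sum, map_smulₛₗ, he, hc, b.sum_repr]
    rw [this]
    exact Submodule.sum_mem _ fun i _ => Submodule.smul_mem _ _ (Submodule.subset_span ⟨i, rfl⟩)

theorem isBasisAt_of_basis [Finite ι]
    (e : Module.Basis ι (X.presheaf.stalk y) (M.presheaf.stalk y))
    (he : ∀ i, μ.emb y (e i) = b i) : μ.IsBasisAt y b :=
  mem_range_iff_of_basis e b (μ.emb y) he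

variable (μ) in
/-- The lattices are locally spanned by a common basis. -/
def LocallyFree (r : ℕ) : Prop :=
  ∀ y, ∃ U : X.Opens, y ∈ U ∧ ∃ b : Module.Basis (Fin r) X.functionField V,
    ∀ z ∈ U, μ.IsBasisAt z b

variable (μ) in
theorem locallyFree {r : ℕ} (hM : IsVectorBundle M r) : μ.LocallyFree r := by
  intro y
  obtain ⟨U, hy, e, he⟩ := hM y
  refine ⟨U, hy, (IsFrame.stalkBasis he (genericPoint_mem hy)).map μ.equiv, fun z hz => ?_⟩
  refine isBasisAt_of_basis (IsFrame.stalkBasis he hz) fun i => ?_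
  rw [emb_apply, IsFrame.toGeneric_stalkBasis he hz, Module.Basis.map_apply]

-- The coordinates of a section in the common basis are rational functions regular at every point of
-- the open set, hence regular functions on it. This criterion recognizes the twisted Hecke
-- transform F'(ax) as a vector bundle.
variable (μ) in
theorem LocallyFree.isVectorBundle {r : ℕ} (h : μ.LocallyFree r) : IsVectorBundle M r := by
  intro y
  obtain ⟨U, hy, b, hb⟩ := h y
  choose e he using fun i => μ.exists_section U (b i) fun z hz => (hb z hz).mem_lat i
  have hres (V : X.Opens) (hV : V ≤ U) (z : X) (hz : z ∈ V) (i) :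
      μ.emb z (M.presheaf.germ V z hz (res M hV (e i))) = b i := by
    rw [germ_res, he]
  have hsum (V : X.Opens) (hV : V ≤ U) (z : X) (hz : z ∈ V) (c : Fin r → Γ(X, V)) :
      μ.emb z (M.presheaf.germ V z hz (∑ i, c i • res M hV (e i))) =
        ∑ i, X.presheaf.germ V (genericPoint X) (genericPoint_mem hz) (c i) • b i := by
    simp only [map_sum, germ_smul, map_smulₛₗ, hres, algebraMap_germ]
  refine ⟨U, hy, e, fun V hV => ⟨?_, ?_⟩⟩
  · rw [Fintype.linearIndependent_iff]
    intro c hc i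
    refine function_ext _ _ fun hη => ?_
    have h1 := hsum V hV _ hη c
    rw [hc, map_zero, map_zero] at h1
    rw [Fintype.linearIndependent_iff.mp b.linearIndependent _ h1.symm i, map_zero]
  · refine eq_top_iff.mpr fun s _ => ?_
    have h1 (i) : ∃ c : Γ(X, V), ∀ z (hz : z ∈ V),
        X.presheaf.germ V (genericPoint X) (genericPoint_mem hz) c =
          b.repr (μ.emb z (M.presheaf.germ V z hz s)) i := by
      by_cases hη : genericPoint X ∈ V
      · obtain ⟨c, hc⟩ := exists_function V
          (b.repr (μ.emb (genericPoint X) (M.presheaf.germ V _ hη s)) i) fun z hz => by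
            rw [emb_germ, ← μ.emb_germ hz]
            exact (hb z (hV hz) _).mp (μ.mem_lat.mpr ⟨_, rfl⟩) i
        exact ⟨c, fun z hz => by rw [hc, emb_germ, emb_germ]⟩
      · exact ⟨0, fun z hz => (hη (genericPoint_mem hz)).elim⟩
    choose c hc using h1
    have : s = ∑ i, c i • res M hV (e i) := by
      refine μ.section_ext _ _ fun z hz => ?_
      rw [hsum V hV z hz]
      simp only [fun i => hc i z hz, b.sum_repr]
    rw [this]
    exact Submodule.sum_mem _ fun i _ => Submodule.smul_mem _ _ (Submodule.subset_span ⟨i, rfl⟩)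

/-! ### Models of exterior powers -/

theorem exteriorMap_basis {A K : Type u} [CommRing A] [CommRing K] {N W : Type u}
    [AddCommGroup N] [Module A N] [AddCommGroup W] [Module K W] {σ : A →+* K} (n : ℕ) {r : ℕ}
    (f : N →ₛₗ[σ] W) (e : Module.Basis (Fin r) A N) (b : Module.Basis (Fin r) K W)
    (h : ∀ i, f (e i) = b i) (I : Set.powersetCard (Fin r) n) :
    exteriorMap σ n f (e.exteriorPower n I) = b.exteriorPower n I := by
  rw [exteriorPower.basis_apply, exteriorPower.basis_apply, exteriorPower.ιMulti_family,
    exteriorPower.ιMulti_family, exteriorMap_ιMulti]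
  congr 1
  ext i
  exact h _

variable {r : ℕ} (μ) (hM : IsVectorBundle M r) (n : ℕ)

/-- The isomorphism of exterior powers induced by an isomorphism. -/
def extCongr {R N N' : Type*} [CommRing R] [AddCommGroup N] [Module R N] [AddCommGroup N']
    [Module R N'] (f : N ≃ₗ[R] N') (n : ℕ) : ⋀[R]^n N ≃ₗ[R] ⋀[R]^n N' :=
  LinearEquiv.ofLinearMap (exteriorPower.map n f.toLinearMap) (exteriorPower.map n f.symm.toLinearMap)
    (by rw [← exteriorPower.map_comp]; simp) (by rw [← exteriorPower.map_comp]; simp)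

theorem extCongr_ιMulti {R N N' : Type*} [CommRing R] [AddCommGroup N] [Module R N]
    [AddCommGroup N'] [Module R N'] (f : N ≃ₗ[R] N') (n : ℕ) (m : Fin n → N) :
    extCongr f n (exteriorPower.ιMulti R n m) = exteriorPower.ιMulti R n fun i => f (m i) :=
  exteriorPower.map_apply_ιMulti _ _

/-- The model of an exterior power. -/
def extPower : Model (OrthHecke.extPower M n) (⋀[X.functionField]^n V) where
  torsionFree y := by
    obtain ⟨U, hy, e, he⟩ := hM y
    have h1 : Function.Injective
        (exteriorMap (algebraMap (X.presheaf.stalk y) X.functionField) n (toGeneric M y)) :=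
      injective_of_basis ((IsFrame.stalkBasis he hy).exteriorPower n)
        ((IsFrame.stalkBasis he (genericPoint_mem hy)).exteriorPower n) _
        (algebraMap_functionField_injective X y)
        (exteriorMap_basis n _ _ _ (IsFrame.toGeneric_stalkBasis he hy))
    have h2 : Function.Injective (extStalkEquiv hM n (genericPoint X) ∘
        toGeneric (OrthHecke.extPower M n) y) := by
      have : extStalkEquiv hM n (genericPoint X) ∘ toGeneric (OrthHecke.extPower M n) y =
          exteriorMap (algebraMap (X.presheaf.stalk y) X.functionField) n (toGeneric M y) ∘
            extStalkEquiv hM n y := funext fun m => extStalkEquiv_toGeneric hM y m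
      rw [this]
      exact h1.comp (extStalkEquiv hM n y).injective
    exact h2.of_comp
  equiv := (extStalkEquiv hM n (genericPoint X)).trans (extCongr μ.equiv n)

theorem extPower_emb_germ_wedge {U : X.Opens} {y : X} (hy : y ∈ U) (s : Fin n → Γ(M, U)) :
    (μ.extPower hM n).emb y ((OrthHecke.extPower M n).presheaf.germ U y hy (wedge s)) =
      exteriorPower.ιMulti _ n fun i => μ.emb y (M.presheaf.germ U y hy (s i)) := by
  rw [emb_germ]
  refine (congrArg (extCongr μ.equiv n) (extStalkEquiv_germ_wedge hM _ s)).trans ?_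
  rw [extCongr_ιMulti]
  congr 1
  ext i
  exact (μ.emb_germ hy _).symm

theorem extPower_emb (y : X) (m : (OrthHecke.extPower M n).presheaf.stalk y) :
    (μ.extPower hM n).emb y m =
      exteriorMap (algebraMap (X.presheaf.stalk y) X.functionField) n (μ.emb y)
        (extStalkEquiv hM n y m) := by
  induction m using extStalk_induction hM with
  | hw W hW s => rw [extPower_emb_germ_wedge, extStalkEquiv_germ_wedge, exteriorMap_ιMulti]; rfl
  | hz => simp only [map_zero]
  | ha a b iha ihb => simp only [map_add, iha, ihb]
  | hs c a iha =>
    rw [map_smulₛₗ, map_smul, map_smulₛₗ, iha]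

theorem IsBasisAt.extPower {μ : Model M V} {b : Module.Basis (Fin r) X.functionField V}
    (h : μ.IsBasisAt y b) : (μ.extPower hM n).IsBasisAt y (b.exteriorPower n) := by
  obtain ⟨e, he⟩ := h.exists_basis
  intro v
  rw [← mem_range_iff_of_basis (e.exteriorPower n) (b.exteriorPower n)
    (exteriorMap (algebraMap (X.presheaf.stalk y) X.functionField) n (μ.emb y))
    (exteriorMap_basis n _ _ _ he), Model.mem_lat, (extStalkEquiv hM n y).surjective.exists]
  exact exists_congr fun m => by rw [extPower_emb]

end Model
end

/-! ### Submodules given by exponents, and their lengths -/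

section
variable {R N ι : Type*} [CommRing R] [AddCommGroup N] [Module R N]

/-- The vectors whose `i`-th coordinate is divisible by `ϖ ^ c i`. -/
def expSub (ϖ : R) (e : Module.Basis ι R N) (c : ι → ℕ) : Submodule R N where
  carrier := {v | ∀ i, ϖ ^ c i ∣ e.repr v i}
  add_mem' ha hb i := by
    rw [map_add, Finsupp.add_apply]
    exact dvd_add (ha i) (hb i)
  zero_mem' i := by simp
  smul_mem' r a ha i := by
    rw [map_smul, Finsupp.smul_apply, smul_eq_mul]
    exact (ha i).mul_left r

variable {ϖ : R} {e : Module.Basis ι R N} {c d : ι → ℕ}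

theorem mem_expSub {v : N} : v ∈ expSub ϖ e c ↔ ∀ i, ϖ ^ c i ∣ e.repr v i := Iff.rfl

theorem smul_mem_expSub {r : R} {i : ι} (h : ϖ ^ c i ∣ r) :
    r • e i ∈ expSub ϖ e c := fun j => by
  classical
  rw [map_smul, Finsupp.smul_apply, e.repr_self, Finsupp.single_apply]
  split_ifs with hij
  · subst hij
    simpa using h
  · simp

theorem expSub_anti (h : ∀ i, c i ≤ d i) : expSub ϖ e d ≤ expSub ϖ e c :=
  fun _ hv i => (pow_dvd_pow ϖ (h i)).trans (hv i)

theorem expSub_zero : expSub ϖ e 0 = ⊤ :=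
  eq_top_iff.mpr fun _ _ i => by simp

theorem expSub_inf : expSub ϖ e c ⊓ expSub ϖ e d = expSub ϖ e (c ⊔ d) := by
  refine le_antisymm (fun v hv i => ?_)
    (le_inf (expSub_anti fun i => le_sup_left) (expSub_anti fun i => le_sup_right))
  rcases le_total (c i) (d i) with h | h
  · simpa [h] using hv.2 i
  · simpa [h] using hv.1 i

section
variable [Finite ι]

theorem expSub_le {S : Submodule R N} (h : ∀ i, ϖ ^ c i • e i ∈ S) : expSub ϖ e c ≤ S := by
  have := Fintype.ofFinite ι
  intro v hv
  rw [← e.sum_repr v]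
  refine S.sum_mem fun i _ => ?_
  obtain ⟨a, ha⟩ := hv i
  rw [ha, mul_comm, mul_smul]
  exact S.smul_mem _ (h i)

theorem expSub_sup : expSub ϖ e c ⊔ expSub ϖ e d = expSub ϖ e (c ⊓ d) := by
  refine le_antisymm (sup_le (expSub_anti fun i => inf_le_left) (expSub_anti fun i => inf_le_right))
    (expSub_le fun i => ?_)
  rcases le_total (c i) (d i) with h | h
  · exact Submodule.mem_sup_left (smul_mem_expSub (by simp [h]))
  · exact Submodule.mem_sup_right (smul_mem_expSub (by simp [h]))

theorem span_smul_expSub (k : ℕ) :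
    Ideal.span {ϖ} ^ k • expSub ϖ e c = expSub ϖ e (fun i => c i + k) := by
  rw [Ideal.span_singleton_pow]
  refine le_antisymm (Submodule.smul_le.mpr fun r hr v hv i => ?_) (expSub_le fun i => ?_)
  · change ϖ ^ (c i + k) ∣ _
    rw [map_smul, Finsupp.smul_apply, smul_eq_mul, add_comm, pow_add]
    exact mul_dvd_mul (Ideal.mem_span_singleton.mp hr) (hv i)
  · rw [add_comm, pow_add, mul_smul]
    exact Submodule.smul_mem_smul (Ideal.mem_span_singleton_self _) (smul_mem_expSub dvd_rfl)

theorem span_smul_top (e : Module.Basis ι R N) (k : ℕ) :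
    (Ideal.span {ϖ} ^ k • ⊤ : Submodule R N) = expSub ϖ e (fun _ => k) := by
  rw [← expSub_zero (ϖ := ϖ) (e := e), span_smul_expSub]
  simp

end

section
variable [IsDomain R] [IsDiscreteValuationRing R]

/-- Induction along 0 → R/ϖ → R/ϖ^(k+1) → R/ϖ^k → 0, whose first map is multiplication by ϖ^k. -/
theorem length_quotient_pow (hϖ : Irreducible ϖ) (k : ℕ) :
    Module.length R (R ⧸ Ideal.span {ϖ ^ k}) = k := by
  induction k with
  | zero =>
    rw [pow_zero, Ideal.span_singleton_one, Nat.cast_zero, Module.length_eq_zero_iff]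
    exact Submodule.Quotient.subsingleton_iff.mpr rfl
  | succ k ih =>
    have hmax : (Ideal.span {ϖ}).IsMaximal := by
      rw [← hϖ.maximalIdeal_eq]
      infer_instance
    let f : (R ⧸ Ideal.span {ϖ}) →ₗ[R] (R ⧸ Ideal.span {ϖ ^ (k + 1)}) :=
      Submodule.mapQ _ _ (LinearMap.mulLeft R (ϖ ^ k)) (by
        rw [Ideal.span_le, Set.singleton_subset_iff]
        change ϖ ^ k * ϖ ∈ Ideal.span {ϖ ^ (k + 1)}
        rw [← pow_succ]
        exact Ideal.mem_span_singleton_self _)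
    let g : (R ⧸ Ideal.span {ϖ ^ (k + 1)}) →ₗ[R] (R ⧸ Ideal.span {ϖ ^ k}) :=
      Submodule.factor (Ideal.span_singleton_le_span_singleton.mpr (pow_dvd_pow ϖ k.le_succ))
    have hf : Function.Injective f := by
      rw [injective_iff_map_eq_zero]
      intro a ha
      obtain ⟨a, rfl⟩ := Submodule.Quotient.mk_surjective _ a
      have h1 : ϖ ^ k * a ∈ Ideal.span {ϖ ^ (k + 1)} := (Submodule.Quotient.mk_eq_zero _).mp ha
      rw [Ideal.mem_span_singleton, pow_succ] at h1
      exact (Submodule.Quotient.mk_eq_zero _).mpr (Ideal.mem_span_singleton.mpr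
        ((mul_dvd_mul_iff_left (pow_ne_zero _ hϖ.ne_zero)).mp h1))
    have hg : Function.Surjective g := by
      intro a
      obtain ⟨a, rfl⟩ := Submodule.Quotient.mk_surjective _ a
      exact ⟨Submodule.Quotient.mk a, rfl⟩
    have hfg : Function.Exact f g := by
      intro a
      obtain ⟨a, rfl⟩ := Submodule.Quotient.mk_surjective _ a
      constructor
      · intro ha
        have h1 : a ∈ Ideal.span {ϖ ^ k} := (Submodule.Quotient.mk_eq_zero _).mp ha
        obtain ⟨r, rfl⟩ := Ideal.mem_span_singleton.mp h1
        exact ⟨Submodule.Quotient.mk r, rfl⟩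
      · rintro ⟨r, hr⟩
        obtain ⟨r, rfl⟩ := Submodule.Quotient.mk_surjective _ r
        rw [← hr]
        exact (Submodule.Quotient.mk_eq_zero _).mpr
          (Ideal.mem_span_singleton.mpr (dvd_mul_right _ _))
    rw [Module.length_eq_add_of_exact f g hf hg hfg, ih]
    have : IsSimpleModule R (R ⧸ Ideal.span {ϖ}) := by
      rw [isSimpleModule_iff_isCoatom]
      exact hmax.out
    rw [Module.length_eq_one]
    push_cast
    ring

/-- Modulo ϖ^k the submodule becomes the direct sum of the R/ϖ^(k - c i). The condition c i ≤ k
makes the natural subtraction harmless. -/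
theorem length_map_expSub [Fintype ι] (hϖ : Irreducible ϖ)
    (e : Module.Basis ι R N) {k : ℕ} (hc : ∀ i, c i ≤ k) :
    Module.length R ((expSub ϖ e c).map (Submodule.mkQ (Ideal.span {ϖ} ^ k • ⊤ : Submodule R N))) =
      (∑ i, (k - c i) : ℕ) := by
  classical
  let φ : (ι → R) →ₗ[R] N := ∑ i, ((LinearMap.proj i).smulRight (ϖ ^ c i • e i) :
    (ι → R) →ₗ[R] N)
  have hφ (a : ι → R) : φ a = ∑ i, a i • ϖ ^ c i • e i := by
    simp [φ, LinearMap.sum_apply]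
  have hrepr (a : ι → R) (i : ι) : e.repr (φ a) i = a i * ϖ ^ c i := by
    rw [hφ]
    simp [Finsupp.finsetSum_apply, Finsupp.single_apply]
  have hrange : LinearMap.range φ = expSub ϖ e c := by
    refine le_antisymm ?_ (expSub_le fun i => ⟨Pi.single i 1, ?_⟩)
    · rintro _ ⟨a, rfl⟩ i
      rw [hrepr]
      exact dvd_mul_left _ _
    · rw [hφ, Finset.sum_eq_single i]
      · simp
      · intro j _ hj
        simp [hj]
      · simp
  let ψ := (Submodule.mkQ (Ideal.span {ϖ} ^ k • ⊤ : Submodule R N)).comp φ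
  have hψ : LinearMap.range ψ =
      (expSub ϖ e c).map (Submodule.mkQ (Ideal.span {ϖ} ^ k • ⊤ : Submodule R N)) := by
    rw [LinearMap.range_comp, hrange]
  have hker : LinearMap.ker ψ = Submodule.pi Set.univ fun i => Ideal.span {ϖ ^ (k - c i)} := by
    ext a
    rw [LinearMap.mem_ker, LinearMap.comp_apply, Submodule.mkQ_apply, Submodule.Quotient.mk_eq_zero,
      span_smul_top e, mem_expSub]
    simp only [Submodule.mem_pi, Set.mem_univ, true_imp_iff, Ideal.mem_span_singleton, hrepr]
    refine forall_congr' fun i => ?_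
    conv_lhs => rw [← Nat.sub_add_cancel (hc i), pow_add]
    exact mul_dvd_mul_iff_right (pow_ne_zero _ hϖ.ne_zero)
  rw [← hψ, ← ψ.quotKerEquivRange.length_eq, hker,
    (Submodule.quotientPi (R := R) (Ms := fun _ : ι => R) fun i => Ideal.span {ϖ ^ (k - c i)}).length_eq,
    Module.length_pi_of_fintype]
  push_cast
  exact Finset.sum_congr rfl fun i _ => length_quotient_pow hϖ _

end

/-! ### Comparison of submodules by length -/

section

theorem length_add_one_le {A B : Submodule R N} (h : A < B) :
    Module.length R A + 1 ≤ Module.length R B := by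
  let i := Submodule.inclusion h.le
  have h1 := Module.length_eq_add_of_exact (R := R) i (LinearMap.range i).mkQ
    (Submodule.inclusion_injective h.le) (Submodule.mkQ_surjective _) (LinearMap.exact_map_mkQ_range i)
  rw [h1]
  gcongr
  rw [Order.one_le_iff_pos, Module.length_pos_iff]
  refine Submodule.Quotient.nontrivial_iff.mpr fun htop => h.not_ge fun b hb => ?_
  obtain ⟨a, ha⟩ : (⟨b, hb⟩ : B) ∈ LinearMap.range i := by
    rw [htop]
    trivial
  have : b = a.1 := congrArg Subtype.val ha.symm
  rw [this]
  exact a.2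

theorem length_mono {A B : Submodule R N} (h : A ≤ B) :
    Module.length R A ≤ Module.length R B :=
  Module.length_le_of_injective (Submodule.inclusion h) (Submodule.inclusion_injective h)

/-- A proper inclusion raises the length by at least one; this excludes equality of lengths because
n is finite. -/
theorem eq_of_le_of_length_le {A B : Submodule R N} (h : A ≤ B) {n : ℕ}
    (hA : Module.length R A = n) (hB : Module.length R B ≤ n) : A = B := by
  by_contra hne
  have := (length_add_one_le (lt_of_le_of_ne h hne)).trans hB
  rw [hA] at this
  exact absurd this (by norm_cast; omega)

theorem length_sup_le (A B : Submodule R N) :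
    Module.length R (A ⊔ B : Submodule R N) ≤ Module.length R A + Module.length R B := by
  rw [← Module.length_prod]
  refine Module.length_le_of_surjective
    ((A.subtype.coprod B.subtype).codRestrict (A ⊔ B) fun v => ?_) ?_
  · exact Submodule.add_mem_sup v.1.2 v.2.2
  · rintro ⟨v, hv⟩
    obtain ⟨a, ha, b, hb, rfl⟩ := Submodule.mem_sup.mp hv
    exact ⟨(⟨a, ha⟩, ⟨b, hb⟩), rfl⟩

end

end


/-! ### Bases adapted to submodules of the fibre -/

section
variable {R N : Type*} [CommRing R] [IsLocalRing R] [AddCommGroup N] [Module R N]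

theorem length_span_le_one {v : N ⧸ (maximalIdeal R • ⊤ : Submodule R N)} :
    Module.length R (Submodule.span R {v}) ≤ 1 := by
  let f : (R ⧸ maximalIdeal R) →ₗ[R] N ⧸ (maximalIdeal R • ⊤ : Submodule R N) :=
    Submodule.liftQ _ (LinearMap.toSpanSingleton R _ v) fun r hr => by
      rw [LinearMap.mem_ker, LinearMap.toSpanSingleton_apply]
      obtain ⟨v, rfl⟩ := Submodule.Quotient.mk_surjective _ v
      exact (Submodule.Quotient.mk_eq_zero _).mpr (Submodule.smul_mem_smul hr trivial)
  have hf : LinearMap.range f = Submodule.span R {v} := by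
    rw [Submodule.range_liftQ, LinearMap.range_toSpanSingleton]
  have : IsSimpleModule R (R ⧸ maximalIdeal R) := by
    rw [isSimpleModule_iff_isCoatom]
    exact (maximalIdeal.isMaximal R).out
  rw [← hf]
  exact (Module.length_le_of_surjective f.rangeRestrict f.surjective_rangeRestrict).trans_eq
    (Module.length_eq_one R _)

/-- Submodules `S₀, …, S_{n-1}` whose images in the fibre have length at least `1, …, n` contain
vectors that are linearly independent in the fibre. -/
theorem exists_mem_of_lengths (S : ℕ → Submodule R N) (n : ℕ)
    (h : ∀ i < n, (i + 1 : ℕ) ≤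
      Module.length R ((S i).map (maximalIdeal R • ⊤ : Submodule R N).mkQ)) :
    ∃ v : ℕ → N, (∀ i < n, v i ∈ S i) ∧ Module.length R
      ((Submodule.span R (v '' Set.Iio n)).map (maximalIdeal R • ⊤ : Submodule R N).mkQ) = n := by
  induction n with
  | zero =>
    refine ⟨0, by simp, ?_⟩
    have : Set.Iio 0 = (∅ : Set ℕ) := by simp
    rw [this, Set.image_empty, Submodule.span_empty, Submodule.map_bot, Nat.cast_zero,
      Module.length_bot]
  | succ n ih =>
    obtain ⟨v, hv, hlen⟩ := ih fun i hi => h i (hi.trans n.lt_succ_self)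
    set π := (maximalIdeal R • ⊤ : Submodule R N).mkQ
    set T := (Submodule.span R (v '' Set.Iio n)).map π
    -- The image of S n has length at least n + 1, so it is not contained in the n-dimensional span
    -- of the vectors already chosen.
    obtain ⟨w, hw, hwT⟩ : ∃ w ∈ S n, π w ∉ T := by
      by_contra! hcon
      have h1 := (h n n.lt_succ_self).trans (length_mono (R := R) (B := T) (by
        rintro _ ⟨w, hw, rfl⟩
        exact hcon w hw))
      rw [hlen] at h1
      exact absurd h1 (by norm_cast; omega)
    refine ⟨Function.update v n w, fun i hi => ?_, ?_⟩
    · rcases eq_or_ne i n with rfl | hne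
      · rwa [Function.update_self]
      · rw [Function.update_of_ne hne]
        exact hv i (by omega)
    · have h1 : Function.update v n w '' Set.Iio (n + 1) = v '' Set.Iio n ∪ {w} := by
        have h2 : Set.Iio (n + 1) = insert n (Set.Iio n) := Order.Iio_succ_eq_insert n
        rw [h2, Set.image_insert_eq, Function.update_self, Set.union_singleton]
        congr 1
        exact Set.image_congr fun i hi => Function.update_of_ne (ne_of_lt hi) _ _
      rw [h1, Submodule.span_union, Submodule.map_sup, Submodule.map_span π {w},
        Set.image_singleton]
      refine le_antisymm ((length_sup_le _ _).trans ?_) ?_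
      · push_cast
        exact add_le_add hlen.le length_span_le_one
      · push_cast
        rw [← hlen]
        refine length_add_one_le (lt_of_le_of_ne le_sup_left fun heq => hwT ?_)
        rw [heq]
        exact Submodule.mem_sup_right (Submodule.mem_span_singleton_self _)

/-- Vectors independent in the fibre are chosen greedily, one in each S i. By Nakayama's lemma these
r vectors generate a free module of rank r, so they form a basis. -/
theorem exists_basis_of_lengths [IsDomain R] {r : ℕ} (b : Module.Basis (Fin r) R N)
    (hb : Module.length R (N ⧸ (maximalIdeal R • ⊤ : Submodule R N)) ≤ r)
    (S : ℕ → Submodule R N)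
    (h : ∀ i < r, (i + 1 : ℕ) ≤
      Module.length R ((S i).map (maximalIdeal R • ⊤ : Submodule R N).mkQ)) :
    ∃ e : Module.Basis (Fin r) R N, ∀ i : Fin r, e i ∈ S i := by
  obtain ⟨v, hv, hlen⟩ := exists_mem_of_lengths S r h
  have hN : Module.Finite R N := Module.Finite.of_basis b
  have h1 := eq_of_le_of_length_le (le_top (a := (Submodule.span R (v '' Set.Iio r)).map
    (maximalIdeal R • ⊤ : Submodule R N).mkQ)) hlen (by rwa [Module.length_top])
  have h2 : (⊤ : Submodule R N) ≤ Submodule.span R (v '' Set.Iio r) := by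
    refine Submodule.le_of_le_smul_of_le_jacobson_bot Module.Finite.fg_top
      (maximalIdeal_le_jacobson _) fun w _ => ?_
    obtain ⟨s, hs, hsw⟩ : (maximalIdeal R • ⊤ : Submodule R N).mkQ w ∈
        (Submodule.span R (v '' Set.Iio r)).map (maximalIdeal R • ⊤ : Submodule R N).mkQ := by
      rw [h1]
      trivial
    have h3 : w - s ∈ (maximalIdeal R • ⊤ : Submodule R N) :=
      (Submodule.Quotient.eq _).mp hsw.symm
    rw [← add_sub_cancel s w]
    exact Submodule.add_mem_sup hs h3
  have h4 : Set.range (fun i : Fin r => v i) = v '' Set.Iio r := by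
    ext w
    constructor
    · rintro ⟨i, rfl⟩
      exact ⟨i, i.2, rfl⟩
    · rintro ⟨i, hi, rfl⟩
      exact ⟨⟨i, hi⟩, rfl⟩
  rw [← h4] at h2
  have hfin : Module.finrank R N = r := by
    rw [Module.finrank_eq_card_basis b, Fintype.card_fin]
  refine ⟨basisOfTopLeSpanOfCardEqFinrank _ h2 (by rw [hfin, Fintype.card_fin]), fun i => ?_⟩
  rw [coe_basisOfTopLeSpanOfCardEqFinrank]
  exact hv i i.2

end

/-! ### Lattices determined by length, and extensions -/

section
theorem eq_of_map_mkQ_eq {R N : Type*} [CommRing R] [AddCommGroup N] [Module R N]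
    {A B I : Submodule R N} (hA : I ≤ A) (hB : I ≤ B)
    (h : A.map I.mkQ = B.map I.mkQ) : A = B := by
  rw [← sup_eq_right.mpr hA, ← sup_eq_right.mpr hB, ← Submodule.comap_map_mkQ, h,
    Submodule.comap_map_mkQ]

variable {R N : Type*} [CommRing R] [IsDomain R] [IsDiscreteValuationRing R] [AddCommGroup N]
  [Module R N] {ϖ : R} {r : ℕ}

/-- A submodule containing the vectors of a basis scaled by powers `ϖ ^ c i` is given by these
exponents if it has the right length. -/
theorem eq_expSub_of_length (hϖ : Irreducible ϖ) {ι : Type*} [Fintype ι] {e : Module.Basis ι R N}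
    {c : ι → ℕ} {A : Submodule R N} {k n : ℕ} (hc : ∀ i, c i ≤ k) (hn : ∑ i, (k - c i) = n)
    (hIA : Ideal.span {ϖ} ^ k • ⊤ ≤ A) (h : ∀ i, ϖ ^ c i • e i ∈ A)
    (hA : Module.length R (A.map (Ideal.span {ϖ} ^ k • ⊤ : Submodule R N).mkQ) ≤ n) :
    A = expSub ϖ e c := by
  refine (eq_of_map_mkQ_eq (I := Ideal.span {ϖ} ^ k • ⊤) ?_ hIA
    (eq_of_le_of_length_le (Submodule.map_mono (expSub_le h)) ?_ hA)).symm
  · rw [span_smul_top e]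
    exact expSub_anti hc
  · rw [length_map_expSub hϖ e hc, hn]

/-- The counterpart of `eq_expSub_of_length` with the inclusion known from the other side; it serves
when upper bounds on the coordinates are available. -/
theorem eq_expSub_of_le (hϖ : Irreducible ϖ) {ι : Type*} [Fintype ι] {e : Module.Basis ι R N}
    {c : ι → ℕ} {A : Submodule R N} {k n : ℕ} (hc : ∀ i, c i ≤ k) (hn : ∑ i, (k - c i) = n)
    (hIA : Ideal.span {ϖ} ^ k • ⊤ ≤ A) (h : A ≤ expSub ϖ e c)
    (hA : Module.length R (A.map (Ideal.span {ϖ} ^ k • ⊤ : Submodule R N).mkQ) = n) :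
    A = expSub ϖ e c := by
  refine eq_of_map_mkQ_eq (I := Ideal.span {ϖ} ^ k • ⊤) hIA ?_
    (eq_of_le_of_length_le (Submodule.map_mono h) hA ?_)
  · rw [span_smul_top e]
    exact expSub_anti hc
  · rw [length_map_expSub hϖ e hc, hn]

/-- The exponents `0` on the first `w` vectors and `1` on the others. -/
def flagExp (r w : ℕ) (i : Fin r) : ℕ := if (i : ℕ) < w then 0 else 1

theorem sum_flagExp {r w : ℕ} (h : w ≤ r) : ∑ i, (1 - flagExp r w i) = w := by
  have h1 (i : Fin r) : 1 - flagExp r w i = if (i : ℕ) < w then 1 else 0 := by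
    unfold flagExp
    split_ifs <;> rfl
  simp only [h1, Finset.sum_ite, Finset.sum_const_zero, add_zero, Finset.sum_const, smul_eq_mul,
    mul_one]
  rw [Fin.card_filter_val_lt, min_eq_right h]

theorem flagExp_le {r w : ℕ} (i : Fin r) : flagExp r w i ≤ 1 := by
  unfold flagExp
  split_ifs <;> simp

/-- An extension of `W` by `εG` inside `N / ϖ²`, lifted to `N`, is spanned by multiples of a basis
adapted to `W ≤ G`. -/
theorem exists_basis_of_extension (hϖ : Irreducible ϖ) (b : Module.Basis (Fin r) R N)
    {P G W : Submodule R N} {g w : ℕ} (hWG : W ≤ G)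
    (hG : Module.length R (G.map (maximalIdeal R • ⊤ : Submodule R N).mkQ) = g)
    (hW : Module.length R (W.map (maximalIdeal R • ⊤ : Submodule R N).mkQ) = w)
    (hmW : maximalIdeal R • ⊤ ≤ W)
    (hPW : P ⊔ maximalIdeal R • ⊤ = W) (hPG : P ⊓ maximalIdeal R • ⊤ = maximalIdeal R • G) :
    ∃ e : Module.Basis (Fin r) R N, W = expSub ϖ e (flagExp r w) ∧ G = expSub ϖ e (flagExp r g) ∧
      P = expSub ϖ e (fun i => flagExp r w i + flagExp r g i) := by
  have hm : maximalIdeal R = Ideal.span {ϖ} ^ 1 := by rw [pow_one, hϖ.maximalIdeal_eq]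
  set π := (maximalIdeal R • ⊤ : Submodule R N).mkQ
  have hmap : P.map π = W.map π := by
    rw [← hPW, Submodule.map_sup, Submodule.mkQ_map_self, sup_bot_eq]
  have htop : Module.length R ((⊤ : Submodule R N).map π) = r := by
    have h1 := length_map_expSub (c := 0) (k := 1) hϖ b (by simp)
    rw [expSub_zero, ← hm] at h1
    rw [h1]
    simp
  have htop' : Module.length R (N ⧸ (maximalIdeal R • ⊤ : Submodule R N)) = r := by
    rw [← htop, Submodule.map_top, Submodule.range_mkQ, Module.length_top]
  have hwg : w ≤ g := by
    have := length_mono (R := R) (Submodule.map_mono (f := π) hWG)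
    rw [hW, hG] at this
    exact_mod_cast this
  have hgr : g ≤ r := by
    have := length_mono (R := R) (Submodule.map_mono (f := π) (le_top (a := G)))
    rw [hG, htop] at this
    exact_mod_cast this
  -- The first w vectors are taken in P rather than merely in W, which is possible since P and W
  -- have the same image in the fibre. The next ones are taken in G, the remaining ones freely.
  obtain ⟨e, he⟩ := exists_basis_of_lengths b htop'.le
    (fun i => if i < w then P else if i < g then G else ⊤) fun i hi => by
      by_cases h1 : i < w
      · rw [if_pos h1, hmap, hW]
        exact_mod_cast h1
      · rw [if_neg h1]
        by_cases h2 : i < g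
        · rw [if_pos h2, hG]
          exact_mod_cast h2
        · rw [if_neg h2, htop]
          exact_mod_cast hi
  have heP (i : Fin r) (hi : (i : ℕ) < w) : e i ∈ P := by simpa [hi] using he i
  have hPleW : P ≤ W := hPW ▸ le_sup_left
  have heG (i : Fin r) (hi : (i : ℕ) < g) : e i ∈ G := by
    by_cases h : (i : ℕ) < w
    · exact hWG (hPleW (heP i h))
    · simpa [h, hi] using he i
  have hmem {S : Submodule R N} {s : ℕ} (hS : maximalIdeal R • ⊤ ≤ S)
      (h : ∀ i : Fin r, (i : ℕ) < s → e i ∈ S) (i : Fin r) : ϖ ^ flagExp r s i • e i ∈ S := by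
    unfold flagExp
    split_ifs with h1
    · simpa using h i h1
    · refine hS (Submodule.smul_mem_smul ?_ trivial)
      rw [pow_one, hϖ.maximalIdeal_eq]
      exact Ideal.mem_span_singleton_self _
  have hWe : W = expSub ϖ e (flagExp r w) :=
    eq_expSub_of_length hϖ (k := 1) flagExp_le (sum_flagExp (hwg.trans hgr)) (hm ▸ hmW)
      (hmem hmW fun i hi => hPleW (heP i hi)) (by rw [← hm, hW])
  have hGe : G = expSub ϖ e (flagExp r g) :=
    eq_expSub_of_length hϖ (k := 1) flagExp_le (sum_flagExp hgr) (hm ▸ (hmW.trans hWG))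
      (hmem (hmW.trans hWG) heG) (by rw [← hm, hG])
  have hmG : maximalIdeal R • G = expSub ϖ e (fun i => flagExp r g i + 1) := by
    rw [hGe, hm, span_smul_expSub]
  refine ⟨e, hWe, hGe, le_antisymm (fun v hv i => ?_) (expSub_le fun i => ?_)⟩
  -- Removing the components of v along the first w basis vectors, which lie in P, leaves an element
  -- of P ∩ 𝔪N = 𝔪G.
  · let s := ∑ j : Fin r, if (j : ℕ) < w then e.repr v j • e j else 0
    have hs : s ∈ P := P.sum_mem fun j _ => by
      split_ifs with h
      · exact P.smul_mem _ (heP j h)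
      · exact P.zero_mem
    have hsi (j : Fin r) : e.repr (v - s) j = if (j : ℕ) < w then 0 else e.repr v j := by
      have : e.repr s j = if (j : ℕ) < w then e.repr v j else 0 := by
        simp only [s, map_sum, Finsupp.finsetSum_apply]
        rw [Finset.sum_eq_single j]
        · split_ifs <;> simp
        · intro k _ hk
          split_ifs <;> simp [hk]
        · simp
      rw [map_sub, Finsupp.sub_apply, this]
      split_ifs <;> simp
    have h1 : v - s ∈ P ⊓ maximalIdeal R • ⊤ := by
      refine ⟨P.sub_mem hv hs, ?_⟩
      rw [hm, span_smul_top e]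
      intro j
      rw [hsi]
      have h2 := hWe ▸ hPleW hv
      have h3 := h2 j
      unfold flagExp at h3
      split_ifs at h3 ⊢
      · exact dvd_zero _
      · exact h3
    rw [hPG, hmG] at h1
    have h2 := h1 i
    rw [hsi] at h2
    by_cases h : (i : ℕ) < w
    · simp [flagExp, h, h.trans_le hwg]
    · rw [if_neg h] at h2
      simpa [flagExp, h, add_comm] using h2
  · by_cases h : (i : ℕ) < w
    · simpa [flagExp, h, h.trans_le hwg] using heP i h
    · have h1 : ϖ ^ (flagExp r w i + flagExp r g i) • e i ∈ maximalIdeal R • G := by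
        rw [hmG]
        refine smul_mem_expSub ?_
        simp only [flagExp, h, if_false]
        rw [add_comm]
      rw [← hPG] at h1
      exact h1.1

end


/-! ### The exterior square of a free module of rank four -/

/-- The first entries of the pairs `12, 13, 14, 23, 24, 34`. -/
def pfst : Fin 6 → Fin 4 := ![0, 0, 0, 1, 1, 2]

/-- The second entries of the pairs `12, 13, 14, 23, 24, 34`. -/
def psnd : Fin 6 → Fin 4 := ![1, 2, 3, 2, 3, 3]

section
variable {R N : Type*} [CommRing R] [AddCommGroup N] [Module R N]

/-- The pairs of indices as two-element subsets. -/
def pairEquiv : Fin 6 ≃ Set.powersetCard (Fin 4) 2 :=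
  Equiv.ofBijective
    (fun k => Set.powersetCard.ofFinEmbEquiv
      (OrderEmbedding.ofStrictMono ![pfst k, psnd k] (by revert k; decide)))
    ((Fintype.bijective_iff_injective_and_card _).mpr ⟨fun k l h => by
      have h1 := Set.powersetCard.ofFinEmbEquiv.injective h
      have h2 : pfst k = pfst l := congrArg (fun f => f 0) h1
      have h3 : psnd k = psnd l := congrArg (fun f => f 1) h1
      revert k l
      decide, by
      rw [← Nat.card_eq_fintype_card, ← Nat.card_eq_fintype_card, Set.powersetCard.card]
      simp; rfl⟩)

/-- The basis `e₁ ∧ e₂, e₁ ∧ e₃, e₁ ∧ e₄, e₂ ∧ e₃, e₂ ∧ e₄, e₃ ∧ e₄` of `⋀²N`. -/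
def pairBasis (e : Module.Basis (Fin 4) R N) : Module.Basis (Fin 6) R (⋀[R]^2 N) :=
  (e.exteriorPower 2).reindex pairEquiv.symm

theorem pairBasis_apply (e : Module.Basis (Fin 4) R N) (k : Fin 6) :
    pairBasis e k = exteriorPower.ιMulti R 2 ![e (pfst k), e (psnd k)] := by
  rw [pairBasis, Module.Basis.reindex_apply, exteriorPower.basis_apply, exteriorPower.ιMulti_family]
  simp only [pairEquiv, Equiv.symm_symm, Equiv.ofBijective_apply, Equiv.symm_apply_apply]
  congr 1
  ext i
  fin_cases i <;> rfl

/-- The exterior product `⋀²N × ⋀²N → ⋀⁴N`. -/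
def wedgeMul : ⋀[R]^2 N →ₗ[R] ⋀[R]^2 N →ₗ[R] ⋀[R]^4 N :=
  LinearMap.mk₂ R (fun v w => ⟨v.1 * w.1, SetLike.mul_mem_graded v.2 w.2⟩)
    (fun _ _ _ => Subtype.ext (add_mul _ _ _)) (fun _ _ _ => Subtype.ext (smul_mul_assoc _ _ _))
    (fun _ _ _ => Subtype.ext (mul_add _ _ _)) (fun _ _ _ => Subtype.ext (mul_smul_comm _ _ _))

theorem wedgeMul_ιMulti (a b c d : N) :
    wedgeMul (exteriorPower.ιMulti R 2 ![a, b]) (exteriorPower.ιMulti R 2 ![c, d]) =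
      exteriorPower.ιMulti R 4 ![a, b, c, d] := by
  refine Subtype.ext ?_
  simp only [wedgeMul, LinearMap.mk₂_apply, exteriorPower.ιMulti_apply_coe,
    ExteriorAlgebra.ιMulti_apply]
  simp [List.ofFn_succ, mul_assoc]

/-- The bilinear form on `⋀²N` defined by a linear form on `⋀⁴N`. -/
def wedgeForm (D : ⋀[R]^4 N →ₗ[R] R) : LinearMap.BilinForm R (⋀[R]^2 N) := wedgeMul.compr₂ D

theorem wedgeForm_ιMulti (D : ⋀[R]^4 N →ₗ[R] R) (a b c d : N) :
    wedgeForm D (exteriorPower.ιMulti R 2 ![a, b]) (exteriorPower.ιMulti R 2 ![c, d]) =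
      D (exteriorPower.ιMulti R 4 ![a, b, c, d]) := by
  rw [← wedgeMul_ιMulti]
  rfl

/-- The signs of the products `e_i ∧ e_j ∧ e_k ∧ e_l` of pairs. -/
def pairSign (k l : Fin 6) : ℤ :=
  -- In the lexicographic order of the pairs, `Fin.rev` exchanges complementary pairs; any other two
  -- pairs share an index.
  if l = Fin.rev k then ![1, -1, 1, 1, -1, 1] k else 0

/-- Checked by computation over the integers, so that it can be transported to every commutative
ring by `Int.castRingHom`. -/
theorem det_pairs : ∀ k l : Fin 6, (Matrix.of fun i j : Fin 4 =>
    if ![pfst k, psnd k, pfst l, psnd l] j = i then (1 : ℤ) else 0).det = pairSign k l := by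
  simp only [Matrix.det_succ_row_zero, Matrix.det_fin_zero]
  decide +kernel

theorem wedgeForm_pairBasis (D : ⋀[R]^4 N →ₗ[R] R) (e : Module.Basis (Fin 4) R N) (k l : Fin 6) :
    wedgeForm D (pairBasis e k) (pairBasis e l) =
      pairSign k l * D (exteriorPower.ιMulti R 4 e) := by
  have h1 (v : Fin 4 → N) : D (exteriorPower.ιMulti R 4 v) =
      D (exteriorPower.ιMulti R 4 e) * e.det v := by
    have := (D.compAlternatingMap (exteriorPower.ιMulti R 4)).eq_smul_basis_det e
    exact congrArg (fun f => f v) this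
  rw [pairBasis_apply, pairBasis_apply, wedgeForm_ιMulti, h1, mul_comm]
  congr 1
  rw [e.det_apply]
  have h2 : e.toMatrix ![e (pfst k), e (psnd k), e (pfst l), e (psnd l)] =
      (Int.castRingHom R).mapMatrix (Matrix.of fun i j =>
        if ![pfst k, psnd k, pfst l, psnd l] j = i then (1 : ℤ) else 0) := by
    have hs : ![e (pfst k), e (psnd k), e (pfst l), e (psnd l)] =
        e ∘ ![pfst k, psnd k, pfst l, psnd l] := by
      ext j
      fin_cases j <;> rfl
    ext i j
    rw [Module.Basis.toMatrix_apply, hs, Function.comp_apply, e.repr_self, Finsupp.single_apply]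
    simp
  rw [h2, ← RingHom.map_det]
  exact congrArg (Int.castRingHom R) (det_pairs k l)

/-- This is the polarized Pfaffian. On the diagonal the bracket is twice q₀q₅ - q₁q₄ + q₂q₃, whose
vanishing is the Plücker relation. -/
theorem wedgeForm_eq (D : ⋀[R]^4 N →ₗ[R] R) (e : Module.Basis (Fin 4) R N) (v w : ⋀[R]^2 N) :
    wedgeForm D v w = D (exteriorPower.ιMulti R 4 e) *
      ((pairBasis e).repr v 0 * (pairBasis e).repr w 5
        - (pairBasis e).repr v 1 * (pairBasis e).repr w 4
        + (pairBasis e).repr v 2 * (pairBasis e).repr w 3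
        + (pairBasis e).repr v 3 * (pairBasis e).repr w 2
        - (pairBasis e).repr v 4 * (pairBasis e).repr w 1
        + (pairBasis e).repr v 5 * (pairBasis e).repr w 0) := by
  conv_lhs => rw [← (pairBasis e).sum_repr v, ← (pairBasis e).sum_repr w]
  simp only [map_sum, LinearMap.sum_apply, map_smul, LinearMap.smul_apply, smul_eq_mul,
    wedgeForm_pairBasis]
  simp only [Fin.sum_univ_six, pairSign]
  simp [Fin.ext_iff]
  ring

end


section
variable {R N : Type*} [CommRing R] [AddCommGroup N] [Module R N]

theorem pairBasis_repr_ιMulti (e : Module.Basis (Fin 4) R N) (p q : N) (k : Fin 6) :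
    (pairBasis e).repr (exteriorPower.ιMulti R 2 ![p, q]) k =
      e.repr p (pfst k) * e.repr q (psnd k) - e.repr p (psnd k) * e.repr q (pfst k) := by
  rw [pairBasis, Module.Basis.repr_reindex_apply, exteriorPower.basis_repr_apply,
    exteriorPower.ιMultiDual_apply_ιMulti, Matrix.det_fin_two]
  simp [pairEquiv]

theorem exists_basis_of_mem_span [Nontrivial R] (e : Module.Basis (Fin 4) R N) (v : Fin 4 → N)
    (h : ∀ i, e i ∈ Submodule.span R (Set.range v)) : ∃ f : Module.Basis (Fin 4) R N, ⇑f = v := by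
  have h1 : (⊤ : Submodule R N) ≤ Submodule.span R (Set.range v) := by
    rw [← e.span_eq, Submodule.span_le]
    rintro _ ⟨i, rfl⟩
    exact h i
  exact ⟨basisOfTopLeSpanOfCardEqFinrank v h1
    (by rw [Module.finrank_eq_card_basis e]), coe_basisOfTopLeSpanOfCardEqFinrank _ _ _⟩

theorem exists_basis_comp (e : Module.Basis (Fin 4) R N) (s : Fin 4 → Fin 4)
    (hs : Function.Bijective s) : ∃ f : Module.Basis (Fin 4) R N, ∀ i, f i = e (s i) :=
  ⟨e.reindex (Equiv.ofBijective s hs).symm, fun i => by simp⟩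

theorem pairBasis_eq_of_apply {e f : Module.Basis (Fin 4) R N} {k l : Fin 6}
    (h : f (pfst k) = e (pfst l)) (h' : f (psnd k) = e (psnd l)) :
    pairBasis f k = pairBasis e l := by
  rw [pairBasis_apply, pairBasis_apply, h, h']

theorem ιMulti_swap (a b : N) :
    exteriorPower.ιMulti R 2 ![b, a] = -exteriorPower.ιMulti R 2 ![a, b] := by
  have h := (exteriorPower.ιMulti R 2).map_swap ![a, b] (i := 0) (j := 1) (by decide)
  rw [← h]
  congr 1
  ext i
  fin_cases i <;> rfl

theorem wedgeForm_comm (e : Module.Basis (Fin 4) R N) (D : ⋀[R]^4 N →ₗ[R] R) (v w : ⋀[R]^2 N) :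
    wedgeForm D v w = wedgeForm D w v := by
  rw [wedgeForm_eq D e, wedgeForm_eq D e]
  ring

theorem wedgeForm_pairBasis_rev (e : Module.Basis (Fin 4) R N) (D : ⋀[R]^4 N →ₗ[R] R)
    (v : ⋀[R]^2 N) (k : Fin 6) : wedgeForm D v (pairBasis e (Fin.rev k)) =
      D (exteriorPower.ιMulti R 4 e) * (![1, -1, 1, 1, -1, 1] k * (pairBasis e).repr v k) := by
  rw [wedgeForm_eq D e]
  fin_cases k <;> simp [Fin.rev, Fin.ext_iff]

/-- Pairing with the complementary basis vector reads off a coordinate up to a unit. This turns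
orthogonality into divisibility of coordinates. -/
theorem dvd_wedgeForm_iff {e : Module.Basis (Fin 4) R N} {D : ⋀[R]^4 N →ₗ[R] R}
    (hD : IsUnit (D (exteriorPower.ιMulti R 4 e))) {v : ⋀[R]^2 N} {k : Fin 6} {r : R} :
    r ∣ wedgeForm D v (pairBasis e (Fin.rev k)) ↔ r ∣ (pairBasis e).repr v k := by
  rw [wedgeForm_pairBasis_rev, hD.dvd_mul_left]
  have : IsUnit (![1, -1, 1, 1, -1, 1] k : R) := by
    fin_cases k <;> simp
  exact this.dvd_mul_left

end

/-! ### Isotropic lattices and the Plücker relation modulo ϖ² -/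

section
variable {R N : Type*} [CommRing R] [IsDomain R] [IsDiscreteValuationRing R] [AddCommGroup N]
  [Module R N]

omit [IsDomain R] [IsDiscreteValuationRing R] in
theorem mem_of_smul_mem {W : Type*} [AddCommGroup W] [Module R W] {L : Submodule R W} {a : R}
    (ha : IsUnit a) {w : W} (hw : a • w ∈ L) : w ∈ L := by
  obtain ⟨a, rfl⟩ := ha
  have := L.smul_mem (↑a⁻¹ : R) hw
  rwa [smul_smul, Units.inv_mul, one_smul] at this

/-- A submodule of `⋀²N` containing `ϖ²⋀²N` and isotropic modulo `ϖ²`. -/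
structure IsotropicLattice (ϖ : R) (D : ⋀[R]^4 N →ₗ[R] R) (L : Submodule R (⋀[R]^2 N)) : Prop where
  irreducible : Irreducible ϖ
  isUnit_two : IsUnit (2 : R)
  isUnit (e : Module.Basis (Fin 4) R N) : IsUnit (D (exteriorPower.ιMulti R 4 e))
  le : Ideal.span {ϖ} ^ 2 • ⊤ ≤ L
  dvd (l : ⋀[R]^2 N) (hl : l ∈ L) : ϖ ^ 2 ∣ wedgeForm D l l

namespace IsotropicLattice
variable {ϖ : R} {D : ⋀[R]^4 N →ₗ[R] R} {L : Submodule R (⋀[R]^2 N)} (h : IsotropicLattice ϖ D L)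
include h

theorem isUnit_of_not_dvd {a : R} (ha : ¬ ϖ ∣ a) : IsUnit a := by
  by_contra hcon
  have := (mem_maximalIdeal _).mpr hcon
  rw [h.irreducible.maximalIdeal_eq, Ideal.mem_span_singleton] at this
  exact ha this

-- Polarization, with 2 invertible.
omit [IsDomain R] [IsDiscreteValuationRing R] in
theorem dvd_wedgeForm (e : Module.Basis (Fin 4) R N) {l l' : ⋀[R]^2 N} (hl : l ∈ L) (hl' : l' ∈ L) :
    ϖ ^ 2 ∣ wedgeForm D l l' := by
  have h1 := h.dvd _ (L.add_mem hl hl')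
  have h2 : wedgeForm D (l + l') (l + l') =
      2 * wedgeForm D l l' + (wedgeForm D l l + wedgeForm D l' l') := by
    simp only [map_add, LinearMap.add_apply]
    rw [wedgeForm_comm e D l' l]
    ring
  rw [h2, dvd_add_left (dvd_add (h.dvd _ hl) (h.dvd _ hl'))] at h1
  exact (h.isUnit_two.dvd_mul_left).mp h1

omit [IsDomain R] [IsDiscreteValuationRing R] in
theorem dvd_repr {e : Module.Basis (Fin 4) R N} {k : Fin 6} (hk : pairBasis e (Fin.rev k) ∈ L)
    {l : ⋀[R]^2 N} (hl : l ∈ L) : ϖ ^ 2 ∣ (pairBasis e).repr l k :=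
  (dvd_wedgeForm_iff (h.isUnit e)).mp (h.dvd_wedgeForm e hl hk)

-- The Plücker relation modulo ϖ², after the factor 2 and the unit value of D have been cancelled.
omit [IsDomain R] [IsDiscreteValuationRing R] in
theorem dvd_pfaffian (e : Module.Basis (Fin 4) R N) {l : ⋀[R]^2 N} (hl : l ∈ L) :
    ϖ ^ 2 ∣ (pairBasis e).repr l 0 * (pairBasis e).repr l 5
      - (pairBasis e).repr l 1 * (pairBasis e).repr l 4
      + (pairBasis e).repr l 2 * (pairBasis e).repr l 3 := by
  have h1 := h.dvd l hl
  rw [wedgeForm_eq D e, (h.isUnit e).dvd_mul_left] at h1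
  refine (h.isUnit_two.dvd_mul_left).mp ?_
  convert h1 using 1
  ring

omit [IsDomain R] [IsDiscreteValuationRing R] in
theorem mem_of_dvd_sub (e : Module.Basis (Fin 4) R N) {l w : ⋀[R]^2 N} (hl : l ∈ L)
    (hw : ∀ k, ϖ ^ 2 ∣ (pairBasis e).repr l k - (pairBasis e).repr w k) : w ∈ L := by
  have h1 : l - w ∈ L := by
    refine h.le ?_
    rw [span_smul_top (pairBasis e)]
    intro k
    rw [map_sub]
    exact hw k
  rw [← sub_sub_cancel l w]
  exact L.sub_mem hl h1

/-- Some l in L has a unit coordinate, which a permutation of the basis makes the coordinate q 0. By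
the Plücker relation modulo ϖ², l is then congruent to q 0 times a decomposable vector whose two
factors can be completed to a basis. -/
theorem exists_zero_mem (e : Module.Basis (Fin 4) R N)
    (hL : ¬ L ≤ expSub ϖ (pairBasis e) fun _ => 1) :
    ∃ f : Module.Basis (Fin 4) R N, pairBasis f 0 ∈ L := by
  obtain ⟨l, hl, hle⟩ := SetLike.not_le_iff_exists.mp hL
  rw [mem_expSub] at hle
  push Not at hle
  obtain ⟨k, hk⟩ := hle
  rw [pow_one] at hk
  -- The permutation sends the pair k to the first place and its complement to the last one. The
  -- unit coordinate is followed by pairing with the complement, which avoids computing signs.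
  obtain ⟨f, hf⟩ := exists_basis_comp e
    ![pfst k, psnd k, pfst (Fin.rev k), psnd (Fin.rev k)] (by clear hk; revert k; decide)
  have hf5 : pairBasis f (Fin.rev 0) = pairBasis e (Fin.rev k) :=
    pairBasis_eq_of_apply (hf _) (hf _)
  rw [← dvd_wedgeForm_iff (h.isUnit e), ← hf5, dvd_wedgeForm_iff (h.isUnit f)] at hk
  have hu := h.isUnit_of_not_dvd hk
  obtain ⟨u, hu⟩ := hu
  set q := (pairBasis f).repr l with hq
  let v : R := ↑u⁻¹
  have huv : q 0 * v = 1 := by rw [← hu, Units.mul_inv]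
  -- The first two vectors are chosen so that the product w 0 ∧ w 1 has the coordinates q k / q 0
  -- for k ≤ 4.
  let w : Fin 4 → N :=
    ![f 0 - (v * q 3) • f 2 - (v * q 4) • f 3, f 1 + (v * q 1) • f 2 + (v * q 2) • f 3, f 2, f 3]
  obtain ⟨g, hg⟩ := exists_basis_of_mem_span f w
    (by
      have hw (i : Fin 4) : w i ∈ Submodule.span R (Set.range w) := Submodule.subset_span ⟨i, rfl⟩
      have e0 : f 0 = w 0 + (v * q 3) • w 2 + (v * q 4) • w 3 := by simp [w]; abel
      have e1 : f 1 = w 1 - (v * q 1) • w 2 - (v * q 2) • w 3 := by simp [w]; abel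
      intro i
      fin_cases i
      · change f 0 ∈ _
        rw [e0]
        exact add_mem (add_mem (hw 0) (Submodule.smul_mem _ _ (hw 2)))
          (Submodule.smul_mem _ _ (hw 3))
      · change f 1 ∈ _
        rw [e1]
        exact sub_mem (sub_mem (hw 1) (Submodule.smul_mem _ _ (hw 2)))
          (Submodule.smul_mem _ _ (hw 3))
      · exact hw 2
      · exact hw 3)
  refine ⟨g, mem_of_smul_mem (hu ▸ u.isUnit) (h.mem_of_dvd_sub f hl fun k => ?_)⟩
  rw [map_smul, Finsupp.smul_apply, smul_eq_mul, pairBasis_apply, pairBasis_repr_ιMulti, hg]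
  have hpf := h.dvd_pfaffian f hl
  rw [← hq] at hpf
  fin_cases k
  · simp [pfst, psnd, w, ← hq]
  · simp [pfst, psnd, w, ← mul_assoc, huv, ← hq]
  · simp [pfst, psnd, w, ← mul_assoc, huv, ← hq]
  · simp [pfst, psnd, w, ← mul_assoc, huv, ← hq]
  · simp [pfst, psnd, w, ← mul_assoc, huv, ← hq]
  -- Only the last coordinate needs the Plücker relation: it gives q 5 ≡ (q 1 q 4 - q 2 q 3) / q 0
  -- modulo ϖ².
  · simp [pfst, psnd, w, ← hq]
    refine (hpf.mul_left v).trans (dvd_of_eq ?_)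
    linear_combination (q 5 - v * (q 2 * q 3 - q 1 * q 4)) * huv

/-- Orthogonality to e 0 ∧ e 1 makes the last coordinate of l divisible by ϖ², so one of the
coordinates 1, …, 4 is a unit. After a permutation, l minus its component along the first pair is
decomposable modulo ϖ², with a factor in the plane already found. -/
theorem exists_one_mem {e : Module.Basis (Fin 4) R N} (he : pairBasis e 0 ∈ L)
    (hL : ¬ L ≤ expSub ϖ (pairBasis e) ![0, 1, 1, 1, 1, 1]) :
    ∃ f : Module.Basis (Fin 4) R N, pairBasis f 0 ∈ L ∧ pairBasis f 1 ∈ L := by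
  obtain ⟨l, hl, hle⟩ := SetLike.not_le_iff_exists.mp hL
  rw [mem_expSub] at hle
  push Not at hle
  obtain ⟨k, hk⟩ := hle
  obtain ⟨f, hf0, hk⟩ : ∃ f : Module.Basis (Fin 4) R N, pairBasis f 0 ∈ L ∧
      ¬ ϖ ∣ (pairBasis f).repr l 1 := by
    have h5 := (dvd_pow_self ϖ two_ne_zero).trans (h.dvd_repr (k := 5) he hl)
    -- Permutations that preserve the plane of the first two vectors and move the pair k to the
    -- second place of the list. The entries for k = 0 and k = 5 are never used.
    let τ : Fin 6 → Fin 4 → Fin 4 := ![id, id, ![0, 1, 3, 2], ![1, 0, 2, 3], ![1, 0, 3, 2], id]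
    have key (k : Fin 6) (h4 : pfst (Fin.rev k) = τ k 1 ∧ psnd (Fin.rev k) = τ k 3)
        (hk : ¬ ϖ ∣ (pairBasis e).repr l k)
        (h0 : (τ k 0 = 0 ∧ τ k 1 = 1) ∨ (τ k 0 = 1 ∧ τ k 1 = 0)) :
        ∃ f : Module.Basis (Fin 4) R N, pairBasis f 0 ∈ L ∧ ¬ ϖ ∣ (pairBasis f).repr l 1 := by
      obtain ⟨f, hf⟩ := exists_basis_comp e (τ k) (by clear h4 hk h0; revert k; decide)
      have hf4 : pairBasis f (Fin.rev 1) = pairBasis e (Fin.rev k) :=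
        pairBasis_eq_of_apply ((hf _).trans (by rw [h4.1]; rfl)) ((hf _).trans (by rw [h4.2]; rfl))
      refine ⟨f, ?_, ?_⟩
      · rw [pairBasis_apply] at he ⊢
        change exteriorPower.ιMulti R 2 ![f 0, f 1] ∈ L
        change exteriorPower.ιMulti R 2 ![e 0, e 1] ∈ L at he
        rw [hf, hf]
        obtain h0 | h0 := h0
        · rwa [h0.1, h0.2]
        · rw [h0.1, h0.2, ιMulti_swap]
          exact L.neg_mem he
      · rwa [← dvd_wedgeForm_iff (h.isUnit f), hf4, dvd_wedgeForm_iff (h.isUnit e)]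
    fin_cases k
    · simp at hk
    · exact key 1 (by decide) (by simpa using hk) (by decide)
    · exact key 2 (by decide) (by simpa using hk) (by decide)
    · exact key 3 (by decide) (by simpa using hk) (by decide)
    · exact key 4 (by decide) (by simpa using hk) (by decide)
    · exact absurd h5 (by simpa using hk)
  obtain ⟨u, hu⟩ := h.isUnit_of_not_dvd hk
  set q := (pairBasis f).repr l with hq
  let v : R := ↑u⁻¹
  have huv : q 1 * v = 1 := by rw [← hu, Units.mul_inv]
  -- The plane of f 0 and f 1 is kept with its exterior product, and w 0 ∧ w 2 has the coordinates q
  -- 1, q 2, q 3 and q 2 q 3 / q 1. The last is congruent to q 4 modulo ϖ² by the Plücker relation,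
  -- because ϖ² divides q 5.
  let w : Fin 4 → N :=
    ![f 0 + (v * q 3) • f 1, f 1, q 1 • f 2 + q 2 • f 3, f 3]
  obtain ⟨g, hg⟩ := exists_basis_of_mem_span f w
    (by
      have hw (i : Fin 4) : w i ∈ Submodule.span R (Set.range w) := Submodule.subset_span ⟨i, rfl⟩
      have e0 : f 0 = w 0 - (v * q 3) • w 1 := by simp [w]
      have e2 : f 2 = v • w 2 - (v * q 2) • w 3 := by
        simp [w, smul_smul, mul_comm v (q 1), huv]
      intro i
      fin_cases i
      · change f 0 ∈ _
        rw [e0]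
        exact sub_mem (hw 0) (Submodule.smul_mem _ _ (hw 1))
      · exact hw 1
      · change f 2 ∈ _
        rw [e2]
        exact sub_mem (Submodule.smul_mem _ _ (hw 2)) (Submodule.smul_mem _ _ (hw 3))
      · exact hw 3)
  have hpf := h.dvd_pfaffian f hl
  have h5 : ϖ ^ 2 ∣ q 5 := h.dvd_repr (k := 5) hf0 hl
  rw [← hq] at hpf
  refine ⟨g, h.mem_of_dvd_sub f hf0 fun k => ?_,
    h.mem_of_dvd_sub f (L.sub_mem hl (L.smul_mem (q 0) hf0)) fun k => ?_⟩
  · rw [(pairBasis f).repr_self, pairBasis_apply g, pairBasis_repr_ιMulti, hg]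
    fin_cases k <;> simp [pfst, psnd, w, Fin.ext_iff]
  · rw [map_sub, map_smul, Finsupp.sub_apply, Finsupp.smul_apply, smul_eq_mul,
      (pairBasis f).repr_self, pairBasis_apply g, pairBasis_repr_ιMulti, hg]
    fin_cases k
    · simp [pfst, psnd, w, ← hq]
    · simp [pfst, psnd, w, ← hq]
    · simp [pfst, psnd, w, ← hq]
    · simp [pfst, psnd, w, ← hq]
      refine (dvd_zero _).trans (dvd_of_eq ?_)
      linear_combination q 3 * huv
    · simp [pfst, psnd, w, ← hq]
      have h4 := dvd_sub (h5.mul_left (v * q 0)) (hpf.mul_left v)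
      refine h4.trans (dvd_of_eq ?_)
      linear_combination q 4 * huv
    · simpa [pfst, psnd, w, ← hq] using h5

/-- Orthogonality kills the coordinates 4 and 5 modulo ϖ², and the Plücker relation becomes q 2 q 3
≡ 0. Some element of L has one of these two coordinates a unit, and then the other vanishes modulo
ϖ². The two outcomes correspond to the two families of maximal isotropic subspaces. -/
theorem two_or_three_mem {e : Module.Basis (Fin 4) R N} (he : pairBasis e 0 ∈ L)
    (he' : pairBasis e 1 ∈ L) (hL : ¬ L ≤ expSub ϖ (pairBasis e) ![0, 0, 1, 1, 1, 1]) :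
    pairBasis e 2 ∈ L ∨ pairBasis e 3 ∈ L := by
  obtain ⟨l, hl, hle⟩ := SetLike.not_le_iff_exists.mp hL
  have h5 := h.dvd_repr (k := 5) he hl
  have h4 := h.dvd_repr (k := 4) he' hl
  have hpf := h.dvd_pfaffian e hl
  set q := (pairBasis e).repr l with hq
  rw [dvd_add_right (dvd_sub (h5.mul_left _) (h4.mul_left _))] at hpf
  have hdvd : ϖ ∣ ϖ ^ 2 := dvd_pow_self ϖ two_ne_zero
  have hl' := L.sub_mem (L.sub_mem hl (L.smul_mem (q 0) he)) (L.smul_mem (q 1) he')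
  by_cases h2 : ϖ ∣ q 2
  · have h3 : ¬ ϖ ∣ q 3 := fun h3 => hle fun k => by
      fin_cases k
      · simp
      · simp
      · simpa using h2
      · simpa using h3
      · simpa using hdvd.trans h4
      · simpa using hdvd.trans h5
    have hu := h.isUnit_of_not_dvd h3
    right
    refine mem_of_smul_mem hu (h.mem_of_dvd_sub e hl' fun k => ?_)
    rw [hu.dvd_mul_right] at hpf
    fin_cases k <;> simp [← hq, Fin.ext_iff] <;> assumption
  · have hu := h.isUnit_of_not_dvd h2
    left
    refine mem_of_smul_mem hu (h.mem_of_dvd_sub e hl' fun k => ?_)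
    rw [hu.dvd_mul_left] at hpf
    fin_cases k <;> simp [← hq, Fin.ext_iff] <;> assumption

end IsotropicLattice

end


/-! ### Normal forms according to the dimension of the image in the fibre -/

section
variable {R N : Type*} [CommRing R] [IsDomain R] [IsDiscreteValuationRing R] [AddCommGroup N]
  [Module R N] {ϖ : R} {D : ⋀[R]^4 N →ₗ[R] R} {L : Submodule R (⋀[R]^2 N)}

/-- The length of the image of a submodule in the quotient by `ϖ ^ k`. -/
abbrev lengthMod {W : Type*} [AddCommGroup W] [Module R W] (ϖ : R) (k : ℕ) (A : Submodule R W) :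
    ℕ∞ := Module.length R (A.map (Ideal.span {ϖ} ^ k • ⊤ : Submodule R W).mkQ)

theorem lengthMod_le_of_le_expSub {W ι : Type*} [AddCommGroup W] [Module R W] [Fintype ι]
    (hϖ : Irreducible ϖ) {b : Module.Basis ι R W} {c : ι → ℕ} {k : ℕ} (hc : ∀ i, c i ≤ k)
    {A : Submodule R W} (h : A ≤ expSub ϖ b c) : lengthMod ϖ k A ≤ (∑ i, (k - c i) : ℕ) := by
  rw [← length_map_expSub hϖ b hc]
  exact length_mono (Submodule.map_mono h)

namespace IsotropicLattice
variable (h : IsotropicLattice ϖ D L)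
include h

theorem not_le_expSub {e : Module.Basis (Fin 4) R N} {i : ℕ} (hL : lengthMod ϖ 1 L = i)
    {c : Fin 6 → ℕ} (hc : ∀ k, c k ≤ 1) (hi : ∑ k, (1 - c k) < i) :
    ¬ L ≤ expSub ϖ (pairBasis e) c := fun hle => by
  have h1 := lengthMod_le_of_le_expSub h.irreducible hc hle
  rw [hL] at h1
  exact absurd h1 (by exact_mod_cast hi.not_ge)

theorem eq_expSub {e : Module.Basis (Fin 4) R N} (hL : lengthMod ϖ 2 L = 6) {c : Fin 6 → ℕ}
    (hc : ∀ k, c k ≤ 2) (hs : ∑ k, (2 - c k) = 6) (hle : L ≤ expSub ϖ (pairBasis e) c) :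
    L = expSub ϖ (pairBasis e) c :=
  eq_expSub_of_le h.irreducible hc hs h.le hle hL

/-- L contains f 0 ∧ f 1, whose class spans the image in the fibre, so the other coordinates are
divisible by ϖ; orthogonality to it makes the last one divisible by ϖ². The resulting upper bound
has length 2 + 1 + 1 + 1 + 1 + 0 = 6, so it is attained. -/
theorem exists_eq_of_length_eq_one (e : Module.Basis (Fin 4) R N) (hL : lengthMod ϖ 2 L = 6)
    (hL1 : lengthMod ϖ 1 L = 1) :
    ∃ f : Module.Basis (Fin 4) R N, L = expSub ϖ (pairBasis f) ![0, 1, 1, 1, 1, 2] := by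
  obtain ⟨f, hf⟩ := h.exists_zero_mem e
    (h.not_le_expSub (i := 1) (by rw [hL1]; rfl) (by decide) (by decide))
  refine ⟨f, h.eq_expSub hL (by decide) (by decide) fun l hl k => ?_⟩
  have h1 : L ⊔ Ideal.span {ϖ} ^ 1 • ⊤ = expSub ϖ (pairBasis f) ![0, 1, 1, 1, 1, 1] := by
    refine eq_expSub_of_length h.irreducible (k := 1) (n := 1) (by decide) (by decide)
      le_sup_right (fun k => ?_) ?_
    · by_cases hk : k = 0
      · subst hk
        refine Submodule.mem_sup_left ?_
        simpa using hf
      · refine Submodule.mem_sup_right ?_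
        rw [span_smul_top (pairBasis f)]
        refine smul_mem_expSub (pow_dvd_pow _ ?_)
        revert k
        decide
    · rw [Submodule.map_sup, Submodule.mkQ_map_self, sup_bot_eq]
      exact hL1.le
  have h2 : l ∈ expSub ϖ (pairBasis f) ![0, 1, 1, 1, 1, 1] := h1 ▸ Submodule.mem_sup_left hl
  by_cases hk : k = 5
  · subst hk
    exact h.dvd_repr (k := 5) hf hl
  · have h3 : ![0, 1, 1, 1, 1, 2] k = ![0, 1, 1, 1, 1, 1] k := by
      revert k
      decide
    rw [h3]
    exact h2 k

theorem exists_eq_of_length_eq_two (e : Module.Basis (Fin 4) R N) (hL : lengthMod ϖ 2 L = 6)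
    (hL1 : lengthMod ϖ 1 L = 2) :
    ∃ f : Module.Basis (Fin 4) R N, L = expSub ϖ (pairBasis f) ![0, 0, 1, 1, 2, 2] := by
  obtain ⟨f, hf⟩ := h.exists_zero_mem e
    (h.not_le_expSub (i := 2) (by rw [hL1]; rfl) (by decide) (by decide))
  obtain ⟨f, hf, hf'⟩ := h.exists_one_mem hf
    (h.not_le_expSub (i := 2) (by rw [hL1]; rfl) (by decide) (by decide))
  refine ⟨f, h.eq_expSub hL (by decide) (by decide) fun l hl k => ?_⟩
  have h1 : L ⊔ Ideal.span {ϖ} ^ 1 • ⊤ = expSub ϖ (pairBasis f) ![0, 0, 1, 1, 1, 1] := by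
    refine eq_expSub_of_length h.irreducible (k := 1) (n := 2) (by decide) (by decide)
      le_sup_right (fun k => ?_) ?_
    · by_cases hk : k = 0
      · subst hk
        refine Submodule.mem_sup_left ?_
        simpa using hf
      by_cases hk' : k = 1
      · subst hk'
        refine Submodule.mem_sup_left ?_
        simpa using hf'
      · refine Submodule.mem_sup_right ?_
        rw [span_smul_top (pairBasis f)]
        refine smul_mem_expSub (pow_dvd_pow _ ?_)
        revert k
        decide
    · rw [Submodule.map_sup, Submodule.mkQ_map_self, sup_bot_eq]
      exact hL1.le
  have h2 : l ∈ expSub ϖ (pairBasis f) ![0, 0, 1, 1, 1, 1] := h1 ▸ Submodule.mem_sup_left hl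
  by_cases hk : k = 5
  · subst hk
    exact h.dvd_repr (k := 5) hf hl
  by_cases hk' : k = 4
  · subst hk'
    exact h.dvd_repr (k := 4) hf' hl
  · have h3 : ![0, 0, 1, 1, 2, 2] k = ![0, 0, 1, 1, 1, 1] k := by
      revert k
      decide
    rw [h3]
    exact h2 k

/-- With three of the basis products in L, orthogonality alone kills the three complementary
coordinates modulo ϖ². The resulting bound has length 3 · 2 = 6. -/
theorem exists_eq_of_length_eq_three (e : Module.Basis (Fin 4) R N) (hL : lengthMod ϖ 2 L = 6)
    (hL1 : lengthMod ϖ 1 L = 3) :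
    ∃ f : Module.Basis (Fin 4) R N, L = expSub ϖ (pairBasis f) ![0, 0, 2, 0, 2, 2] ∨
      L = expSub ϖ (pairBasis f) ![0, 0, 0, 2, 2, 2] := by
  obtain ⟨f, hf⟩ := h.exists_zero_mem e
    (h.not_le_expSub (i := 3) (by rw [hL1]; rfl) (by decide) (by decide))
  obtain ⟨f, hf, hf'⟩ := h.exists_one_mem hf
    (h.not_le_expSub (i := 3) (by rw [hL1]; rfl) (by decide) (by decide))
  refine ⟨f, ?_⟩
  obtain hf3 | hf3 := h.two_or_three_mem hf hf'
    (h.not_le_expSub (i := 3) (by rw [hL1]; rfl) (by decide) (by decide))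
  · refine Or.inr (h.eq_expSub hL (by decide) (by decide) fun l hl k => ?_)
    fin_cases k
    · simp
    · simp
    · simp
    · exact h.dvd_repr (k := 3) hf3 hl
    · exact h.dvd_repr (k := 4) hf' hl
    · exact h.dvd_repr (k := 5) hf hl
  · refine Or.inl (h.eq_expSub hL (by decide) (by decide) fun l hl k => ?_)
    fin_cases k
    · simp
    · simp
    · exact h.dvd_repr (k := 2) hf3 hl
    · simp
    · exact h.dvd_repr (k := 4) hf' hl
    · exact h.dvd_repr (k := 5) hf hl

end IsotropicLattice

/-- The exponents of `P ∧ Q` modulo `ϖ²` for `P` and `Q` with exponents `a` and `b`. -/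
def wedgeExp (a b : Fin 4 → ℕ) (k : Fin 6) : ℕ :=
  min (min (a (pfst k) + b (psnd k)) (a (psnd k) + b (pfst k))) 2

-- The coordinates of p ∧ q are two-by-two minors, which bounds the exponents from below; products
-- of scaled basis vectors attain the bound. The summand generated by ϖ² is what truncates
-- `wedgeExp` at 2.
omit [IsDomain R] [IsDiscreteValuationRing R] in
theorem span_wedge_sup (e : Module.Basis (Fin 4) R N) (a b : Fin 4 → ℕ) :
    Submodule.span R {ω | ∃ p q, p ∈ expSub ϖ e a ∧ q ∈ expSub ϖ e b ∧
      ω = exteriorPower.ιMulti R 2 ![p, q]} ⊔ Ideal.span {ϖ} ^ 2 • ⊤ =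
      expSub ϖ (pairBasis e) (wedgeExp a b) := by
  refine le_antisymm (sup_le (Submodule.span_le.mpr ?_) ?_) (expSub_le fun k => ?_)
  · rintro _ ⟨p, q, hp, hq, rfl⟩ k
    rw [pairBasis_repr_ιMulti]
    refine dvd_sub ((pow_dvd_pow ϖ ?_).trans ((pow_add ϖ _ _).symm ▸ mul_dvd_mul (hp _) (hq _)))
      ((pow_dvd_pow ϖ ?_).trans ((pow_add ϖ _ _).symm ▸ mul_dvd_mul (hp _) (hq _)))
    · exact (min_le_left _ _).trans (min_le_left _ _)
    · exact (min_le_left _ _).trans (min_le_right _ _)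
  · rw [span_smul_top (pairBasis e)]
    exact expSub_anti fun k => min_le_right _ _
  · have hw (r s : R) (x y : N) : exteriorPower.ιMulti R 2 ![r • x, s • y] =
        (r * s) • exteriorPower.ιMulti R 2 ![x, y] := by
      have h1 : ![r • x, s • y] = fun i => ![r, s] i • ![x, y] i := by
        ext i
        fin_cases i <;> rfl
      rw [h1, AlternatingMap.map_smul_univ, Fin.prod_univ_two]
      rfl
    unfold wedgeExp
    rcases min_choice (min (a (pfst k) + b (psnd k)) (a (psnd k) + b (pfst k))) 2 with h | h
    · rw [h]
      refine Submodule.mem_sup_left ?_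
      rcases min_choice (a (pfst k) + b (psnd k)) (a (psnd k) + b (pfst k)) with h | h
      · rw [h, pow_add, pairBasis_apply, ← hw]
        exact Submodule.subset_span ⟨_, _, smul_mem_expSub dvd_rfl, smul_mem_expSub dvd_rfl, rfl⟩
      · rw [h, pow_add, pairBasis_apply, ← neg_neg (exteriorPower.ιMulti R 2 _), ← ιMulti_swap,
          smul_neg, ← hw]
        exact neg_mem (Submodule.subset_span
          ⟨_, _, smul_mem_expSub dvd_rfl, smul_mem_expSub dvd_rfl, rfl⟩)
    · rw [h]
      refine Submodule.mem_sup_right ?_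
      rw [span_smul_top (pairBasis e)]
      exact smul_mem_expSub dvd_rfl

omit [IsDomain R] [IsDiscreteValuationRing R] in
/-- The second exterior power of a hyperplane in a four-dimensional space is not of the form
`D ∧ F`. -/
theorem expSub_hyperplane_ne_expSub_line (hϖ : Irreducible ϖ) (e f : Module.Basis (Fin 4) R N) :
    expSub ϖ (pairBasis e) ![0, 0, 1, 0, 1, 1] ≠ expSub ϖ (pairBasis f) ![0, 0, 0, 1, 1, 1] := by
  intro heq
  -- Every multiple of f 0 by a vector v lies in the second submodule, hence in the first. Taking v
  -- = e 3 and v = e 0 shows that all four coordinates of f 0 are divisible by ϖ, which is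
  -- impossible for a basis vector.
  have h (v : N) (k : Fin 6) := by
    have h1 : exteriorPower.ιMulti R 2 ![f 0, v] ∈ expSub ϖ (pairBasis f) ![0, 0, 0, 1, 1, 1] := by
      intro k
      rw [pairBasis_repr_ιMulti]
      fin_cases k <;> simp [pfst, psnd, Fin.ext_iff]
    rw [← heq] at h1
    have h2 := h1 k
    rw [pairBasis_repr_ιMulti] at h2
    exact h2
  have h0 : ϖ ∣ e.repr (f 0) 0 := by simpa [pfst, psnd] using h (e 3) 2
  have h1 : ϖ ∣ e.repr (f 0) 1 := by simpa [pfst, psnd] using h (e 3) 4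
  have h2 : ϖ ∣ e.repr (f 0) 2 := by simpa [pfst, psnd] using h (e 3) 5
  have h3 : ϖ ∣ e.repr (f 0) 3 := by simpa [pfst, psnd] using h (e 0) 2
  have h4 : f 0 ∈ expSub ϖ e fun _ => 1 := fun i => by
    rw [pow_one]
    fin_cases i <;> assumption
  rw [← span_smul_top e, span_smul_top f] at h4
  have h5 := h4 0
  rw [f.repr_self, Finsupp.single_eq_same, pow_one] at h5
  exact hϖ.not_isUnit (isUnit_of_dvd_one h5)

end


/-! ### Change of basis and modification at one point -/

section
variable {X : Scheme.{u}} [IsIntegral X]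

/-- The rational functions that are regular at `y`. -/
abbrev regularAt (y : X) : Subring X.functionField :=
  (algebraMap (X.presheaf.stalk y) X.functionField).range

namespace Model

variable {M M' : X.Modules} {V : Type u} [AddCommGroup V] [Module X.functionField V]
  {μ : Model M V} {μ' : Model M' V} {ι ι' : Type} {y : X} {b b' : Module.Basis ι X.functionField V}

theorem IsBasisAt.of_repr [Finite ι] [Finite ι'] (h : μ.IsBasisAt y b)
    {b' : Module.Basis ι' X.functionField V} (h1 : ∀ i j, b.repr (b' j) i ∈ regularAt y)
    (h2 : ∀ i j, b'.repr (b j) i ∈ regularAt y) : μ.IsBasisAt y b' := by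
  have := Fintype.ofFinite ι
  have := Fintype.ofFinite ι'
  have key {κ κ' : Type} [Fintype κ] [Fintype κ'] (c : Module.Basis κ X.functionField V)
      (c' : Module.Basis κ' X.functionField V) (h1 : ∀ i j, c.repr (c' j) i ∈ regularAt y) (v : V)
      (hv : ∀ i, c'.repr v i ∈ regularAt y) (i : κ) : c.repr v i ∈ regularAt y := by
    rw [← c'.sum_repr v, map_sum, Finsupp.finsetSum_apply]
    refine sum_mem fun j _ => ?_
    rw [map_smul, Finsupp.smul_apply, smul_eq_mul]
    exact mul_mem (hv j) (h1 i j)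
  exact fun v => (h v).trans ⟨key _ _ h2 v, key _ _ h1 v⟩

theorem IsBasisAt.reindex (h : μ.IsBasisAt y b) (σ : ι ≃ ι') : μ.IsBasisAt y (b.reindex σ) := by
  intro v
  rw [h v, σ.forall_congr_left]
  exact forall_congr' fun i => by rw [Module.Basis.repr_reindex_apply]

theorem IsBasisAt.mem_lat_iff (h : μ.IsBasisAt y b) (h' : μ'.IsBasisAt y b) (v : V) :
    v ∈ μ'.lat y ↔ v ∈ μ.lat y := (h' v).trans (h v).symm

theorem IsBasisAt.of_lat_eq (h : μ.IsBasisAt y b) (h' : μ'.lat y = μ.lat y) : μ'.IsBasisAt y b :=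
  fun v => by rw [h', h v]

theorem IsBasisAt.repr_mem [Finite ι] (h : μ.IsBasisAt y b) (h' : μ.IsBasisAt y b') (i j : ι) :
    b.repr (b' j) i ∈ regularAt y := (h _).mp (h'.mem_lat j) i

end Model

namespace LocalParameter
variable {x : X} (p : LocalParameter x)

include p in
/-- A rational function has no poles near `x` except possibly at `x`. -/
theorem exists_open_mem_regularAt [IsDiscreteValuationRing (X.presheaf.stalk x)]
    (k : X.functionField) : ∃ U : X.Opens, x ∈ U ∧ ∀ y ∈ U, y ≠ x → k ∈ regularAt y := by
  obtain ⟨a, d, hd, rfl⟩ := IsFractionRing.div_surjective (A := X.presheaf.stalk x) k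
  -- The denominator is a unit times ϖⁿ at x, and the parameter is invertible at the other points of
  -- its domain.
  obtain ⟨n, u, hu⟩ := IsDiscreteValuationRing.eq_unit_mul_pow_irreducible
    (nonZeroDivisors.ne_zero hd) p.irreducible
  obtain ⟨U, hU, h⟩ := exists_open_mem_range (y := x)
    (k := algebraMap (X.presheaf.stalk x) X.functionField (a * ↑u⁻¹)) ⟨_, rfl⟩
  refine ⟨U ⊓ p.U, ⟨hU, p.mem⟩, fun y hy hyx => ?_⟩
  obtain ⟨c, hc⟩ := p.exists_τ_inv hy.2 hyx n
  have h1 : algebraMap (X.presheaf.stalk x) X.functionField a /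
      algebraMap (X.presheaf.stalk x) X.functionField d =
      algebraMap (X.presheaf.stalk x) X.functionField (a * ↑u⁻¹) *
        algebraMap (X.presheaf.stalk y) X.functionField c := by
    have hd' : algebraMap (X.presheaf.stalk x) X.functionField d ≠ 0 := by
      rw [Ne, map_eq_zero_iff _ (algebraMap_functionField_injective X x)]
      exact nonZeroDivisors.ne_zero hd
    have hd2 : algebraMap (X.presheaf.stalk x) X.functionField d =
        algebraMap (X.presheaf.stalk x) X.functionField u * p.τ ^ n := by
      rw [hu, map_mul, map_pow]; rfl
    rw [div_eq_iff hd', hd2, map_mul]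
    have hu1 : algebraMap (X.presheaf.stalk x) X.functionField ↑u⁻¹ *
        algebraMap (X.presheaf.stalk x) X.functionField u = 1 := by
      rw [← map_mul, Units.inv_mul, map_one]
    linear_combination (-(algebraMap (X.presheaf.stalk x) X.functionField a) *
      (algebraMap (X.presheaf.stalk x) X.functionField ↑u⁻¹ *
        algebraMap (X.presheaf.stalk x) X.functionField u)) * hc -
      algebraMap (X.presheaf.stalk x) X.functionField a * hu1
  rw [h1]
  exact mul_mem (h y hy.1) ⟨c, rfl⟩

end LocalParameter

namespace Model
variable {M M' : X.Modules} {V : Type u} [AddCommGroup V] [Module X.functionField V]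
  {μ : Model M V} {μ' : Model M' V} {r : ℕ} {x : X} (p : LocalParameter x)
  [IsDiscreteValuationRing (X.presheaf.stalk x)]

include p in
/-- A modification of a vector bundle at a point is a vector bundle if its stalk there is free. -/
theorem LocallyFree.of_lat_eq (h : μ.LocallyFree r) (hne : ∀ y ≠ x, μ'.lat y = μ.lat y)
    {b : Module.Basis (Fin r) X.functionField V} (hb : μ'.IsBasisAt x b) : μ'.LocallyFree r := by
  intro y
  by_cases hyx : y = x
  · subst hyx
    obtain ⟨U, hU, b', hb'⟩ := h y
    -- All entries of both transition matrices between b and b', finitely many rational functions,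
    -- are regular on a punctured neighbourhood. There b spans the same lattices as b', and at the
    -- point itself it does so by assumption.
    choose W hW hW' using fun i : (Fin r × Fin r) × Bool => p.exists_open_mem_regularAt
      (if i.2 then b.repr (b' i.1.2) i.1.1 else b'.repr (b i.1.2) i.1.1)
    refine ⟨U ⊓ ⟨⋂ i, (W i : Set X), isOpen_iInter_of_finite fun i => (W i).2⟩,
      ⟨hU, Set.mem_iInter.mpr hW⟩, b, fun z hz => ?_⟩
    by_cases hzy : z = y
    · exact hzy ▸ hb
    · refine ((hb' z hz.1).of_repr (fun i j => ?_) fun i j => ?_).of_lat_eq (hne z hzy)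
      · exact hW' ((i, j), false) z (Set.mem_iInter.mp hz.2 _) hzy
      · exact hW' ((i, j), true) z (Set.mem_iInter.mp hz.2 _) hzy
  · obtain ⟨U, hU, b', hb'⟩ := h y
    exact ⟨U ⊓ punctured x, ⟨hU, p.mem_punctured.mpr hyx⟩, b', fun z hz =>
      (hb' z hz.1).of_lat_eq (hne z (p.mem_punctured.mp hz.2))⟩

end Model

/-! ### Bases scaled by powers of a parameter -/

section
variable {K V ι : Type*} [Field K] [AddCommGroup V] [Module K V]

/-- The basis `t ^ z i • b i`. -/
def scaled (t : Kˣ) (b : Module.Basis ι K V) (z : ι → ℤ) : Module.Basis ι K V :=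
  b.unitsSMul fun i => t ^ z i

theorem scaled_apply (t : Kˣ) (b : Module.Basis ι K V) (z : ι → ℤ) (i : ι) :
    scaled t b z i = ((t ^ z i : Kˣ) : K) • b i := Module.Basis.unitsSMul_apply _

theorem scaled_repr (t : Kˣ) (b : Module.Basis ι K V) (z : ι → ℤ) (v : V) (i : ι) :
    (scaled t b z).repr v i = ((t ^ (-z i) : Kˣ) : K) * b.repr v i := by
  rw [scaled, Module.Basis.repr_unitsSMul, zpow_neg]
  rfl

theorem scaled_scaled (t : Kˣ) (b : Module.Basis ι K V) (z w : ι → ℤ) :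
    scaled t (scaled t b z) w = scaled t b (z + w) := by
  refine Module.Basis.eq_of_apply_eq fun i => ?_
  rw [scaled_apply, scaled_apply, scaled_apply, smul_smul, Pi.add_apply, add_comm, zpow_add,
    Units.val_mul]

theorem scaled_one (b : Module.Basis ι K V) (z : ι → ℤ) : scaled 1 b z = b :=
  Module.Basis.eq_of_apply_eq fun i => by rw [scaled_apply, one_zpow, Units.val_one, one_smul]

theorem pairBasis_scaled (t : Kˣ) (b : Module.Basis (Fin 4) K V) (z : Fin 4 → ℤ) :
    pairBasis (scaled t b z) = scaled t (pairBasis b) fun k => z (pfst k) + z (psnd k) := by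
  refine Module.Basis.eq_of_apply_eq fun k => ?_
  rw [scaled_apply, pairBasis_apply, pairBasis_apply, scaled_apply, scaled_apply]
  have h1 : ![((t ^ z (pfst k) : Kˣ) : K) • b (pfst k), ((t ^ z (psnd k) : Kˣ) : K) • b (psnd k)] =
      fun i => ![((t ^ z (pfst k) : Kˣ) : K), ((t ^ z (psnd k) : Kˣ) : K)] i •
        ![b (pfst k), b (psnd k)] i := by
    ext i
    fin_cases i <;> rfl
  rw [h1, AlternatingMap.map_smul_univ, Fin.prod_univ_two, zpow_add, Units.val_mul]
  rfl

theorem ιMulti_scaled (t : Kˣ) (b : Module.Basis (Fin 4) K V) (z : Fin 4 → ℤ) :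
    exteriorPower.ιMulti K 4 (scaled t b z) =
      ((t ^ (∑ i, z i) : Kˣ) : K) • exteriorPower.ιMulti K 4 b := by
  have h1 : ⇑(scaled t b z) = fun i => ((t ^ z i : Kˣ) : K) • b i :=
    funext fun i => scaled_apply t b z i
  rw [h1, AlternatingMap.map_smul_univ]
  congr 1
  simp only [Fin.sum_univ_four, Fin.prod_univ_four, zpow_add, Units.val_mul]

/-- The basis `e₁ ∧ e₂ ∧ e₃ ∧ e₄` of `⋀⁴N`. -/
def topBasis {R N : Type*} [CommRing R] [AddCommGroup N] [Module R N]
    (e : Module.Basis (Fin 4) R N) : Module.Basis (Fin 1) R (⋀[R]^4 N) :=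
  (e.exteriorPower 4).reindex (Equiv.ofBijective
    (fun _ : Fin 1 => Set.powersetCard.ofFinEmbEquiv (RelEmbedding.refl _))
    ((Fintype.bijective_iff_injective_and_card _).mpr ⟨fun _ _ _ => Subsingleton.elim _ _, by
      rw [← Nat.card_eq_fintype_card, ← Nat.card_eq_fintype_card, Set.powersetCard.card]
      simp⟩)).symm

theorem topBasis_apply {R N : Type*} [CommRing R] [AddCommGroup N] [Module R N]
    (e : Module.Basis (Fin 4) R N) (i : Fin 1) : topBasis e i = exteriorPower.ιMulti R 4 e := by
  rw [topBasis, Module.Basis.reindex_apply, exteriorPower.basis_apply, exteriorPower.ιMulti_family]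
  simp only [Equiv.symm_symm, Equiv.ofBijective_apply, Equiv.symm_apply_apply]
  rfl

end

namespace Model
variable {M : X.Modules} {V : Type u} [AddCommGroup V] [Module X.functionField V]
  {μ : Model M V} {y : X} {b : Module.Basis (Fin 4) X.functionField V}

theorem IsBasisAt.pairBasis (hM : IsVectorBundle M 4) (h : μ.IsBasisAt y b) :
    (μ.extPower hM 2).IsBasisAt y (pairBasis b) := (h.extPower hM 2).reindex _

theorem IsBasisAt.topBasis (hM : IsVectorBundle M 4) (h : μ.IsBasisAt y b) :
    (μ.extPower hM 4).IsBasisAt y (topBasis b) := (h.extPower hM 4).reindex _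

end Model

namespace LocalParameter
variable {x : X} (p : LocalParameter x)

open Classical in
/-- The parameter at `x`, replaced by `1` at other points. -/
def unit (y : X) : X.functionFieldˣ := if y = x then Units.mk0 p.τ p.τ_ne_zero else 1

theorem unit_self : p.unit x = Units.mk0 p.τ p.τ_ne_zero := if_pos rfl

theorem unit_of_ne {y : X} (h : y ≠ x) : p.unit y = 1 := if_neg h

variable {M : X.Modules} {V : Type u} [AddCommGroup V] [Module X.functionField V]
  {μ : Model M V} {y : X} {ι : Type} {b : Module.Basis ι X.functionField V}

/-- Since `p.unit y` is 1 away from x, one formula describes the lattices at all points, and later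
comparisons need no case distinction. -/
theorem isBasisAt_twist [IsDiscreteValuationRing (X.presheaf.stalk x)] (h : μ.IsBasisAt y b)
    (n : ℕ) : (μ.twist p n).IsBasisAt y (scaled (p.unit y) b fun _ => -(n : ℤ)) := by
  by_cases hy : y = x
  · subst hy
    intro v
    rw [μ.mem_twist_lat_self, h]
    refine forall_congr' fun i => ?_
    rw [scaled_repr, neg_neg, zpow_natCast, unit_self, map_smul, Finsupp.smul_apply, smul_eq_mul,
      Units.val_pow_eq_pow_val, Units.val_mk0]
  · rw [p.unit_of_ne hy, scaled_one]
    exact h.of_lat_eq (μ.twist_lat_of_ne p n hy)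

theorem isBasisAt_subAt_of_ne (h : μ.IsBasisAt y b) (hy : y ≠ x)
    (N : Submodule (X.presheaf.stalk x) (M.presheaf.stalk x)) (z : ι → ℤ) :
    (μ.subAt p N).IsBasisAt y (scaled (p.unit y) b z) := by
  rw [p.unit_of_ne hy, scaled_one]
  exact h.of_lat_eq (μ.subAt_lat_of_ne p N hy)

theorem isBasisAt_subAt [Finite ι] {b : Module.Basis ι X.functionField V}
    (e : Module.Basis ι (X.presheaf.stalk x) (M.presheaf.stalk x)) (he : ∀ i, μ.emb x (e i) = b i)
    (c : ι → ℕ) : (μ.subAt p (expSub p.ϖ e c)).IsBasisAt x (scaled (p.unit x) b fun i => c i) := by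
  intro v
  rw [μ.mem_subAt_lat_self]
  have hr (m : M.presheaf.stalk x) (i : ι) := repr_semilinear e b (μ.emb x) he m i
  have hτ (n : ℕ) : ((p.unit x ^ (-(n : ℤ)) : X.functionFieldˣ) : X.functionField) *
      algebraMap (X.presheaf.stalk x) X.functionField (p.ϖ ^ n) = 1 := by
    rw [unit_self, zpow_neg, zpow_natCast, map_pow]
    exact Units.inv_mul (Units.mk0 p.τ p.τ_ne_zero ^ n)
  constructor
  · rintro ⟨m, hm, rfl⟩ i
    obtain ⟨r, hr'⟩ := hm i
    refine ⟨r, ?_⟩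
    rw [scaled_repr, hr, hr', map_mul, ← mul_assoc, hτ, one_mul]
  · intro h
    choose r hr' using h
    have := Fintype.ofFinite ι
    refine ⟨∑ i, (p.ϖ ^ c i * r i) • e i, Submodule.sum_mem _ fun i _ =>
      smul_mem_expSub (dvd_mul_right _ _), ?_⟩
    refine b.ext_elem fun i => ?_
    rw [hr, e.repr_sum_self, map_mul, hr', scaled_repr, ← mul_assoc, mul_comm (algebraMap _ _ _),
      hτ, one_mul]

end LocalParameter

end


/-! ### Transport of orthogonal forms -/

section
variable {X : Scheme.{u}} {M M' : X.Modules}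

theorem stalkMap_inv_hom (φ : M ≅ M') (y : X) (m : M.presheaf.stalk y) :
    stalkMap φ.inv y (stalkMap φ.hom y m) = m := by
  rw [← stalkMap_comp, φ.hom_inv_id, stalkMap_id]

theorem stalkMap_bijective (φ : M ≅ M') (y : X) : Function.Bijective (stalkMap φ.hom y) :=
  Function.bijective_iff_has_inverse.mpr
    ⟨stalkMap φ.inv y, stalkMap_inv_hom φ y, stalkMap_inv_hom φ.symm y⟩

/-- The form obtained by transport along an isomorphism. -/
def OrthogonalForm.transport (φ : M ≅ M') (b : OrthogonalForm M') : OrthogonalForm M where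
  form U := LinearMap.mk₂ _ (fun s t => b.form U (φ.hom.app U s) (φ.hom.app U t))
    (fun s s' t => by rw [map_add, map_add, LinearMap.add_apply])
    (fun c s t => by rw [Scheme.Modules.Hom.app_smul, map_smul, LinearMap.smul_apply])
    (fun s t t' => by rw [map_add, map_add])
    (fun c s t => by rw [Scheme.Modules.Hom.app_smul, map_smul])
  form_res h s t := by
    simp only [LinearMap.mk₂_apply]
    rw [app_res, app_res, b.form_res]
  symm U s t := b.symm U _ _
  nondegenerate y U hy s hs := by
    have h := b.nondegenerate y U hy (φ.hom.app U s) fun V hV hyV t => by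
      have ht : φ.hom.app V (φ.inv.app V t) = t := by
        change (φ.inv ≫ φ.hom).app V t = t
        rw [φ.inv_hom_id]
        rfl
      have := hs V hV hyV (φ.inv.app V t)
      simp only [LinearMap.mk₂_apply] at this
      rwa [app_res, ht] at this
    rw [← stalkMap_inv_hom φ y (M.presheaf.germ U y hy s), stalkMap_germ φ.hom]
    have h1 := Submodule.mem_map_of_mem (f := stalkMap φ.inv y) h
    rw [Submodule.map_smul''] at h1
    exact Submodule.smul_mono le_rfl le_top h1

theorem OrthogonalForm.transport_form (φ : M ≅ M') (b : OrthogonalForm M') (U : X.Opens)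
    (s t : Γ(M, U)) : b.form U (φ.hom.app U s) (φ.hom.app U t) = (b.transport φ).form U s t := rfl

end

/-! ### Orthogonal forms from bilinear forms on the ambient space -/

section
variable {X : Scheme.{u}} [IsIntegral X]

namespace Model
variable {M M' : X.Modules} {V V' : Type u} [AddCommGroup V] [Module X.functionField V]
  [AddCommGroup V'] [Module X.functionField V'] (μ : Model M V) (μ' : Model M' V')

/-- The isomorphism of ambient spaces induced by an isomorphism of sheaves. -/
def mapIso (φ : M ≅ M') : V ≃ₗ[X.functionField] V' :=
  (μ.equiv.symm.trans (LinearEquiv.ofBijective (stalkMap φ.hom (genericPoint X))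
    (stalkMap_bijective φ _))).trans μ'.equiv

theorem mapIso_emb (φ : M ≅ M') (y : X) (m : M.presheaf.stalk y) :
    μ'.emb y (stalkMap φ.hom y m) = μ.mapIso μ' φ (μ.emb y m) := by
  rw [emb_apply, toGeneric_stalkMap]
  refine congrArg μ'.equiv ?_
  change _ = stalkMap φ.hom (genericPoint X) (μ.equiv.symm (μ.equiv (toGeneric M y m)))
  rw [LinearEquiv.symm_apply_apply]

theorem mapIso_mem_lat (φ : M ≅ M') {y : X} {v : V} :
    μ.mapIso μ' φ v ∈ μ'.lat y ↔ v ∈ μ.lat y := by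
  rw [mem_lat, mem_lat, (stalkMap_bijective φ y).surjective.exists]
  exact exists_congr fun m => by
    rw [μ.mapIso_emb μ' φ, (μ.mapIso μ' φ).injective.eq_iff]

/-- The form `b` is induced by the bilinear form `β` on the generic stalk. -/
def FormIs (b : OrthogonalForm M) (β : LinearMap.BilinForm X.functionField V) : Prop :=
  ∀ (U : X.Opens) (hη : genericPoint X ∈ U) (s t : Γ(M, U)),
    X.presheaf.germ U (genericPoint X) hη (b.form U s t) =
      β (μ.emb _ (M.presheaf.germ U _ hη s)) (μ.emb _ (M.presheaf.germ U _ hη t))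

/-- The value on two sections is a rational function regular at every point, hence a regular
function. The last hypothesis is fibrewise non-degeneracy in terms of lattices: a germ that pairs
into the maximal ideal with the whole lattice is zero in the fibre. -/
theorem exists_form (β : LinearMap.BilinForm X.functionField V) (hsymm : ∀ v w, β v w = β w v)
    (hreg : ∀ y, ∀ v ∈ μ.lat y, ∀ w ∈ μ.lat y, β v w ∈ regularAt y)
    (hnd : ∀ y (m : M.presheaf.stalk y), (∀ w ∈ μ.lat y, ∃ r ∈ maximalIdeal (X.presheaf.stalk y),
      algebraMap (X.presheaf.stalk y) X.functionField r = β (μ.emb y m) w) →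
      m ∈ (maximalIdeal (X.presheaf.stalk y) • ⊤ :
        Submodule (X.presheaf.stalk y) (M.presheaf.stalk y))) :
    ∃ b : OrthogonalForm M, μ.FormIs b β := by
  have hex (U : X.Opens) (s t : Γ(M, U)) : ∃ c : Γ(X, U), ∀ hη : genericPoint X ∈ U,
      X.presheaf.germ U (genericPoint X) hη c =
        β (μ.emb _ (M.presheaf.germ U _ hη s)) (μ.emb _ (M.presheaf.germ U _ hη t)) := by
    by_cases hη : genericPoint X ∈ U
    · obtain ⟨c, hc⟩ := exists_function U
        (β (μ.emb _ (M.presheaf.germ U _ hη s)) (μ.emb _ (M.presheaf.germ U _ hη t)))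
        fun y hy => by
          rw [emb_germ, emb_germ, ← μ.emb_germ hy, ← μ.emb_germ hy]
          exact hreg y _ ⟨_, rfl⟩ _ ⟨_, rfl⟩
      exact ⟨c, fun _ => hc _⟩
    · exact ⟨0, fun h => (hη h).elim⟩
  choose c hc using hex
  let form (U : X.Opens) : LinearMap.BilinForm Γ(X, U) Γ(M, U) := LinearMap.mk₂ _ (c U)
    (fun s s' t => function_ext _ _ fun hη => by
      rw [map_add, hc, hc, hc]; simp only [map_add, LinearMap.add_apply])
    (fun a s t => function_ext _ _ fun hη => by
      rw [smul_eq_mul, map_mul, hc, hc, germ_smul, map_smulₛₗ, map_smul, algebraMap_genericPoint]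
      rfl)
    (fun s t t' => function_ext _ _ fun hη => by
      rw [map_add, hc, hc, hc]; simp only [map_add])
    (fun a s t => function_ext _ _ fun hη => by
      rw [smul_eq_mul, map_mul, hc, hc, germ_smul, map_smulₛₗ, map_smul, algebraMap_genericPoint]
      rfl)
  have hform (U : X.Opens) (s t : Γ(M, U)) : form U s t = c U s t := rfl
  refine ⟨⟨form, ?_, ?_, ?_⟩, fun U hη s t => hc U s t hη⟩
  · intro U V h s t
    refine function_ext _ _ fun hη => ?_
    rw [hform, hform, hc, germ_resO, hc, germ_res, germ_res]
  · intro U s t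
    refine function_ext _ _ fun hη => ?_
    rw [hform, hform, hc, hc, hsymm]
  · intro y U hy s hs
    refine hnd y _ ?_
    rintro _ ⟨m, rfl⟩
    obtain ⟨V, hV, t, rfl⟩ := TopCat.Presheaf.exists_germ_eq M.presheaf m
    -- The test germ is represented over a neighbourhood of its own, so both sections are restricted
    -- to the intersection.
    have hyV : y ∈ U ⊓ V := ⟨hy, hV⟩
    have h1 := hs (U ⊓ V) inf_le_left hyV (res M inf_le_right t)
    refine ⟨_, h1, (algebraMap_germ hyV _).trans ((hc _ _ _ (genericPoint_mem hyV)).trans ?_)⟩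
    have h2 : μ.emb y (M.presheaf.germ U y hy s) = μ.emb (genericPoint X)
      (M.presheaf.germ (U ⊓ V) _ (genericPoint_mem hyV)
        (res M inf_le_left s)) := by rw [germ_res, emb_germ, emb_germ]
    have h3 : μ.emb y (M.presheaf.germ V y hV t) = μ.emb (genericPoint X)
      (M.presheaf.germ (U ⊓ V) _ (genericPoint_mem hyV)
        (res M inf_le_right t)) := by rw [germ_res, emb_germ, emb_germ]
    rw [← h2, ← h3]
    rfl

/-- The exterior product defines a non-degenerate form if the lattices of `Λ²` have bases scaled to
be unimodular. -/
theorem exists_wedgeForm {E : X.Modules} {W : Type u} [AddCommGroup W] [Module X.functionField W]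
    (μ : Model E (⋀[X.functionField]^2 W)) (D : ⋀[X.functionField]^4 W →ₗ[X.functionField]
      X.functionField)
    (h : ∀ y, ∃ (f : Module.Basis (Fin 4) X.functionField W) (t : X.functionFieldˣ) (n : ℤ)
      (u : (X.presheaf.stalk y)ˣ), μ.IsBasisAt y (scaled t (pairBasis f) fun _ => n) ∧
      ((t ^ (2 * n) : X.functionFieldˣ) : X.functionField) * D (exteriorPower.ιMulti _ 4 f) =
        algebraMap (X.presheaf.stalk y) X.functionField u) :
    ∃ b : OrthogonalForm E, μ.FormIs b (wedgeForm D) := by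
  refine μ.exists_form _ (fun v w => ?_) (fun y => ?_) fun y => ?_
  · obtain ⟨f, -⟩ := h (genericPoint X)
    exact wedgeForm_comm f D v w
  -- Coordinates of lattice vectors are tⁿ times regular functions, so the form acquires the factor
  -- t^(2n) times the value of D on the basis, which is the unit u.
  · obtain ⟨f, t, n, u, hb, hu⟩ := h y
    intro v hv w hw
    have hr {v} (hv : v ∈ μ.lat y) (k : Fin 6) : ∃ a : X.presheaf.stalk y,
        (pairBasis f).repr v k = ((t ^ n : X.functionFieldˣ) : X.functionField) *
          algebraMap (X.presheaf.stalk y) X.functionField a := by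
      obtain ⟨a, ha⟩ := (hb v).mp hv k
      exact ⟨a, by rw [ha, scaled_repr, ← mul_assoc, ← Units.val_mul, ← zpow_add, add_neg_cancel,
        zpow_zero, Units.val_one, one_mul]⟩
    choose a ha using hr hv
    choose c hc using hr hw
    rw [wedgeForm_eq D f]
    simp only [ha, hc]
    refine ⟨u * (a 0 * c 5 - a 1 * c 4 + a 2 * c 3 + a 3 * c 2 - a 4 * c 1 + a 5 * c 0), ?_⟩
    rw [two_mul, zpow_add, Units.val_mul] at hu
    rw [map_mul, ← hu]
    simp only [map_add, map_sub, map_mul]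
    ring
  · obtain ⟨f, t, n, u, hb, hu⟩ := h y
    intro m hm
    obtain ⟨e, he⟩ := hb.exists_basis
    -- Pairing with the complementary vector of the scaled basis gives the coordinate of m up to a
    -- unit.
    have hr (k : Fin 6) : e.repr m k ∈ maximalIdeal (X.presheaf.stalk y) := by
      obtain ⟨r, hr, hr'⟩ := hm _ (hb.mem_lat (Fin.rev k))
      have h1 := repr_semilinear e _ _ he m k
      have h2 : (pairBasis f).repr (μ.emb y m) k = ((t ^ n : X.functionFieldˣ) : X.functionField) *
          algebraMap (X.presheaf.stalk y) X.functionField (e.repr m k) := by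
        rw [← h1, scaled_repr, ← mul_assoc, ← Units.val_mul, ← zpow_add, add_neg_cancel,
          zpow_zero, Units.val_one, one_mul]
      have h3 : (![1, -1, 1, 1, -1, 1] k : X.functionField) =
          algebraMap (X.presheaf.stalk y) X.functionField (![1, -1, 1, 1, -1, 1] k) := by
        fin_cases k <;> simp
      have h4 : IsUnit (![1, -1, 1, 1, -1, 1] k : X.presheaf.stalk y) := by
        fin_cases k <;> simp
      rw [scaled_apply, map_smul, wedgeForm_pairBasis_rev, h2, h3, smul_eq_mul] at hr'
      rw [two_mul, zpow_add, Units.val_mul] at hu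
      have h5 : r = (u * ![1, -1, 1, 1, -1, 1] k) * e.repr m k := by
        refine algebraMap_functionField_injective X y (hr'.trans ?_)
        rw [map_mul, map_mul, ← hu]
        ring
      rw [h5] at hr
      exact ((maximalIdeal (X.presheaf.stalk y)).unit_mul_mem_iff_mem (u.isUnit.mul h4)).mp hr
    rw [← e.sum_repr m]
    exact Submodule.sum_mem _ fun k _ => Submodule.smul_mem_smul (hr k) trivial

end Model
end

/-! ### The model of (Λ²F)(mx) and its form -/

section
variable {X : Scheme.{u}} [IsIntegral X] {F : X.Modules} {V : Type u} [AddCommGroup V]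
  [Module X.functionField V] {x : X} (p : LocalParameter x)

namespace Model

/-- The model of `𝒪_X(-nx)`. -/
abbrev twistNegModel (n : ℕ) : Model (twistNeg (structureModule X) x n) X.functionField :=
  (structureModel X).subAt p _

variable (μ : Model F V) (hF : IsVectorBundle F 4) {m : ℕ}
  (δ : OrthHecke.extPower F 4 ≅ twistNeg (structureModule X) x (2 * m))

/-- The model of `(Λ²F)(mx)`. -/
abbrev sixModel (m : ℕ) : Model (sixBundle F x m) (⋀[X.functionField]^2 V) :=
  (μ.extPower hF 2).twist p m

/-- The isomorphism `⋀⁴V ≃ K` induced by `det F ≅ 𝒪_X(-2mx)`. -/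
abbrev detIso : ⋀[X.functionField]^4 V ≃ₗ[X.functionField] X.functionField :=
  (μ.extPower hF 4).mapIso (twistNegModel p (2 * m)) δ

theorem sixModel_emb_germ_wedge {U : X.Opens} {y : X} (hy : y ∈ U) (s : Fin 2 → Γ(F, U)) :
    (μ.sixModel p hF m).emb y ((sixBundle F x m).presheaf.germ U y hy
      ((toTwist (OrthHecke.extPower F 2) x m).app U (wedge s))) =
      exteriorPower.ιMulti _ 2 fun i => μ.emb y (F.presheaf.germ U y hy (s i)) := by
  rw [← μ.extPower_emb_germ_wedge hF, ← (μ.extPower hF 2).twist_emb p m]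
  exact congrArg ((μ.sixModel p hF m).emb y) (stalkMap_germ _ hy _).symm

theorem germ_det_wedge {U : X.Opens} (hη : genericPoint X ∈ U) (s : Fin 4 → Γ(F, U)) :
    X.presheaf.germ U (genericPoint X) hη
      (toFunction ((subAtι (structureModule X) x
        (maximalIdeal (X.presheaf.stalk x) ^ (2 * m) • ⊤)).app U (δ.hom.app U (wedge s)))) =
    μ.detIso p hF δ (exteriorPower.ιMulti _ 4 fun i =>
      μ.emb (genericPoint X) (F.presheaf.germ U _ hη (s i))) := by
  rw [← μ.extPower_emb_germ_wedge hF 4 hη, ← mapIso_emb, ← structureModel_emb hη, stalkMap_germ]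
  refine Eq.trans ?_ ((structureModel X).subAt_emb p _ _ _).symm
  exact congrArg ((structureModel X).emb _) (stalkMap_germ _ hη _).symm

theorem wedgeForm_emb_germ {U : X.Opens} (hη : genericPoint X ∈ U) (s : Fin 4 → Γ(F, U)) :
    wedgeForm (μ.detIso p hF δ).toLinearMap
      ((μ.sixModel p hF m).emb (genericPoint X) ((sixBundle F x m).presheaf.germ U _ hη
        ((toTwist (OrthHecke.extPower F 2) x m).app U (wedge ![s 0, s 1]))))
      ((μ.sixModel p hF m).emb (genericPoint X) ((sixBundle F x m).presheaf.germ U _ hη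
        ((toTwist (OrthHecke.extPower F 2) x m).app U (wedge ![s 2, s 3])))) =
    X.presheaf.germ U (genericPoint X) hη (toFunction ((subAtι (structureModule X) x
      (maximalIdeal (X.presheaf.stalk x) ^ (2 * m) • ⊤)).app U (δ.hom.app U (wedge s)))) := by
  rw [germ_det_wedge p μ hF δ, sixModel_emb_germ_wedge, sixModel_emb_germ_wedge]
  have h1 (a b : Γ(F, U)) : (fun i => μ.emb (genericPoint X)
      (F.presheaf.germ U (genericPoint X) hη (![a, b] i))) =
      ![μ.emb (genericPoint X) (F.presheaf.germ U _ hη a),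
        μ.emb (genericPoint X) (F.presheaf.germ U _ hη b)] := by
    ext i
    fin_cases i <;> rfl
  rw [h1, h1, wedgeForm_ιMulti]
  refine congrArg (fun v => μ.detIso p hF δ (exteriorPower.ιMulti _ 4 v)) ?_
  ext i
  fin_cases i <;> rfl

theorem isWedgeForm_of_formIs {b : OrthogonalForm (sixBundle F x m)}
    (hb : (μ.sixModel p hF m).FormIs b (wedgeForm (μ.detIso p hF δ).toLinearMap)) :
    IsWedgeForm δ b := fun U s => function_ext _ _ fun hη =>
  (hb U hη _ _).trans (μ.wedgeForm_emb_germ p hF δ hη s)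

/-- The definition of a wedge form tests only decomposable sections over a common open set. Their
germs span the generic stalk, so bilinearity extends the formula to all pairs of sections. -/
theorem formIs_of_isWedgeForm {b : OrthogonalForm (sixBundle F x m)} (hb : IsWedgeForm δ b) :
    (μ.sixModel p hF m).FormIs b (wedgeForm (μ.detIso p hF δ).toLinearMap) := by
  let E : X.Modules := sixBundle F x m
  let μE : Model E _ := μ.sixModel p hF m
  let β := wedgeForm (μ.detIso p hF δ).toLinearMap
  let η := genericPoint X
  -- The formula for some representatives of two generic germs; `hP` shows that it then holds for
  -- all representatives.
  let P (u v : E.presheaf.stalk η) : Prop := ∃ (U : X.Opens) (hη : η ∈ U) (s t : Γ(E, U)),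
    E.presheaf.germ U η hη s = u ∧ E.presheaf.germ U η hη t = v ∧
      X.presheaf.germ U η hη (b.form U s t) = β (μE.emb η u) (μE.emb η v)
  have hP {u v} (h : P u v) (U : X.Opens) (hη : η ∈ U) (s t : Γ(E, U))
      (hs : E.presheaf.germ U η hη s = u) (ht : E.presheaf.germ U η hη t = v) :
      X.presheaf.germ U η hη (b.form U s t) = β (μE.emb η u) (μE.emb η v) := by
    obtain ⟨W, hW, s', t', hs', ht', h⟩ := h
    have h1 : η ∈ U ⊓ W := ⟨hη, hW⟩
    have e1 : res E (inf_le_left : U ⊓ W ≤ U) s = res E inf_le_right s' :=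
      μE.torsionFree.section_ext _ _ fun _ => by rw [germ_res, germ_res]; exact hs.trans hs'.symm
    have e2 : res E (inf_le_left : U ⊓ W ≤ U) t = res E inf_le_right t' :=
      μE.torsionFree.section_ext _ _ fun _ => by rw [germ_res, germ_res]; exact ht.trans ht'.symm
    rw [← h, ← germ_resO (inf_le_left : U ⊓ W ≤ U) η h1, ← b.form_res, e1, e2, b.form_res,
      germ_resO]
  have hsymm {u v} (h : P u v) : P v u := by
    obtain ⟨W, hW, s, t, hs, ht, h⟩ := h
    obtain ⟨f, -⟩ := (μ.locallyFree hF) η |>.choose_spec.2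
    exact ⟨W, hW, t, s, ht, hs, by rw [b.symm, h, wedgeForm_comm f]⟩
  have hadd {u u' v} (h : P u v) (h' : P u' v) : P (u + u') v := by
    obtain ⟨W, hW, -, s, hs⟩ := exists_germs E (U := ⊤) (y := η) trivial ![u, u', v]
    refine ⟨W, hW, s 0 + s 1, s 2, ?_, hs 2, ?_⟩
    · rw [map_add]; exact congrArg₂ _ (hs 0) (hs 1)
    · rw [map_add, LinearMap.add_apply, map_add, hP h W hW _ _ (hs 0) (hs 2),
        hP h' W hW _ _ (hs 1) (hs 2), map_add, map_add, LinearMap.add_apply]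
  have hsmul {u v} (c : X.presheaf.stalk η) (h : P u v) : P (c • u) v := by
    obtain ⟨W, hW, -, s, hs⟩ := exists_germs E (U := ⊤) (y := η) trivial ![u, v]
    obtain ⟨W', hW', hle, c', hc⟩ := exists_germsO (y := η) hW fun _ : Unit => c
    have h0 : E.presheaf.germ W' η hW' (res E hle (s 0)) = u := (germ_res _ _ _ _ _).trans (hs 0)
    have h1 : E.presheaf.germ W' η hW' (res E hle (s 1)) = v := (germ_res _ _ _ _ _).trans (hs 1)
    refine ⟨W', hW', c' () • res E hle (s 0), res E hle (s 1), ?_, h1, ?_⟩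
    · rw [germ_smul, hc, h0]
    · rw [map_smul, LinearMap.smul_apply, smul_eq_mul, map_mul, hc, hP h W' hW' _ _ h0 h1,
        map_smulₛₗ, map_smul, algebraMap_genericPoint]
      rfl
  have hzero (v) : P 0 v := by
    obtain ⟨W, hW, -, s, hs⟩ := exists_germs E (U := ⊤) (y := η) trivial fun _ : Unit => v
    exact ⟨W, hW, 0, s (), map_zero _, hs _, by simp⟩
  -- The generic point is not x, so the twist leaves the stalk there unchanged.
  have hsurj (u : E.presheaf.stalk η) :
      ∃ u', stalkMap (toTwist (OrthHecke.extPower F 2) x m) η u' = u := by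
    have h1 : μE.emb η u ∈ (μ.extPower hF 2).lat η :=
      (μ.extPower hF 2).twist_lat_of_ne p m p.genericPoint_ne ▸ ⟨u, rfl⟩
    obtain ⟨u', hu'⟩ := (Model.mem_lat _).mp h1
    exact ⟨u', μE.emb_injective η (((μ.extPower hF 2).twist_emb p m η u').trans hu')⟩
  have hww (W : X.Opens) (hW : η ∈ W) (s : Fin 2 → Γ(F, W)) (W' : X.Opens) (hW' : η ∈ W')
      (t : Fin 2 → Γ(F, W')) :
      P (stalkMap (toTwist (OrthHecke.extPower F 2) x m) η
        ((OrthHecke.extPower F 2).presheaf.germ W η hW (wedge s)))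
        (stalkMap (toTwist (OrthHecke.extPower F 2) x m) η
        ((OrthHecke.extPower F 2).presheaf.germ W' η hW' (wedge t))) := by
    let s' : Fin 4 → Γ(F, W ⊓ W') := ![res F inf_le_left (s 0), res F inf_le_left (s 1),
      res F inf_le_right (t 0), res F inf_le_right (t 1)]
    have h0 : η ∈ W ⊓ W' := ⟨hW, hW'⟩
    have hg {W₀ : X.Opens} (hW₀ : η ∈ W₀) (r : Fin 2 → Γ(F, W₀)) (r' : Fin 2 → Γ(F, W ⊓ W'))
        (h : ∀ i, F.presheaf.germ _ η h0 (r' i) = F.presheaf.germ _ η hW₀ (r i)) :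
        E.presheaf.germ _ η h0 ((toTwist (OrthHecke.extPower F 2) x m).app _ (wedge r')) =
          stalkMap (toTwist (OrthHecke.extPower F 2) x m) η
            ((OrthHecke.extPower F 2).presheaf.germ W₀ η hW₀ (wedge r)) := by
      refine μE.emb_injective η ?_
      refine (μ.sixModel_emb_germ_wedge p hF h0 r').trans (Eq.trans ?_
        ((congrArg (μE.emb η) (stalkMap_germ _ hW₀ _)).trans
          (μ.sixModel_emb_germ_wedge p hF hW₀ r)).symm)
      exact congrArg _ (funext fun i => congrArg _ (h i))
    have h1 := hg hW s ![s' 0, s' 1] fun i => by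
      fin_cases i
      · exact germ_res _ _ _ _ _
      · exact germ_res _ _ _ _ _
    have h2 := hg hW' t ![s' 2, s' 3] fun i => by
      fin_cases i
      · exact germ_res _ _ _ _ _
      · exact germ_res _ _ _ _ _
    refine ⟨W ⊓ W', h0, _, _, h1, h2, ?_⟩
    rw [← h1, ← h2]
    exact (congrArg _ (hb _ s')).trans (μ.wedgeForm_emb_germ p hF δ h0 s').symm
  have hall (u v) : P u v := by
    obtain ⟨u, rfl⟩ := hsurj u
    obtain ⟨v, rfl⟩ := hsurj v
    induction u using extStalk_induction hF with
    | hw W hW s =>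
      refine hsymm ?_
      induction v using extStalk_induction hF with
      | hw W' hW' t => exact hsymm (hww W hW s W' hW' t)
      | hz => rw [map_zero]; exact hzero _
      | ha a b iha ihb => rw [map_add]; exact hadd iha ihb
      | hs c a iha => rw [map_smul]; exact hsmul c iha
    | hz => rw [map_zero]; exact hzero _
    | ha a b iha ihb => rw [map_add]; exact hadd iha ihb
    | hs c a iha => rw [map_smul]; exact hsmul c iha
  exact fun U hη s t => hP (hall _ _) U hη s t rfl rfl

end Model
end

/-! ### The isomorphism of orthogonal bundles from adapted bases -/

section
variable {X : Scheme.{u}} [IsIntegral X] {x : X} (p : LocalParameter x)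

namespace Model
variable {M M' : X.Modules} {V V' : Type u} [AddCommGroup V] [Module X.functionField V]
  [AddCommGroup V'] [Module X.functionField V'] {μ : Model M V} {μ' : Model M' V'}

theorem mapIso_eq {φ : M ≅ M'} {θ : V ≃ₗ[X.functionField] V'}
    (h : ∀ y m, μ'.emb y (stalkMap φ.hom y m) = θ (μ.emb y m)) : μ.mapIso μ' φ = θ := by
  ext v
  obtain ⟨m, rfl⟩ := μ.equiv.surjective v
  rw [← μ.emb_genericPoint, ← mapIso_emb, h]

theorem IsBasisAt.map {y : X} {ι : Type} {b : Module.Basis ι X.functionField V}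
    (h : μ.IsBasisAt y b) (θ : V ≃ₗ[X.functionField] V')
    (h' : ∀ v, θ v ∈ μ'.lat y ↔ v ∈ μ.lat y) : μ'.IsBasisAt y (b.map θ) := by
  intro v
  obtain ⟨v, rfl⟩ := θ.surjective v
  rw [h', h]
  simp

end Model

/-- The basis of the function field consisting of `1`. -/
abbrev oneBasis (X : Scheme.{u}) [IsIntegral X] :
    Module.Basis (Fin 1) X.functionField X.functionField := .singleton _ _

theorem repr_eq_div (b : Module.Basis (Fin 1) X.functionField X.functionField)
    (v : X.functionField) (i : Fin 1) : b.repr v i = v / b 0 := by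
  rw [Subsingleton.elim i 0, eq_div_iff (b.ne_zero 0)]
  have := b.sum_repr v
  rwa [Fin.sum_univ_one] at this

namespace LocalParameter

theorem isBasisAt_twistNegModel [IsDiscreteValuationRing (X.presheaf.stalk x)] (n : ℕ) (y : X) :
    (Model.twistNegModel p n).IsBasisAt y (scaled (p.unit y) (oneBasis X) fun _ => n) := by
  have h (y : X) : (structureModel X).IsBasisAt y (oneBasis X) := fun v => by
    rw [mem_structureModel_lat]
    simp
  by_cases hy : y = x
  · subst hy
    obtain ⟨e, he⟩ := (h y).exists_basis
    have h1 : (maximalIdeal (X.presheaf.stalk y) ^ n • ⊤ : Submodule (X.presheaf.stalk y)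
        ((structureModule X).presheaf.stalk y)) = expSub p.ϖ e fun _ => n := by
      rw [← span_smul_top, p.irreducible.maximalIdeal_eq]
      rfl
    have key : ∀ N, N = expSub p.ϖ e (fun _ => n) → ((structureModel X).subAt p N).IsBasisAt y
        (scaled (p.unit y) (oneBasis X) fun _ => n) := by
      rintro _ rfl
      exact p.isBasisAt_subAt e he _
    exact key _ h1
  · exact p.isBasisAt_subAt_of_ne (h y) hy _ _

end LocalParameter

variable [IsDiscreteValuationRing (X.presheaf.stalk x)]
  {F : X.Modules} {V : Type u} [AddCommGroup V] [Module X.functionField V]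
  (μ : Model F V) (hF : IsVectorBundle F 4) {m : ℕ}
  (δ : extPower F 4 ≅ twistNeg (structureModule X) x (2 * m))

/-- The image of f 0 ∧ f 1 ∧ f 2 ∧ f 3 and the 2m-th power of `p.unit y` generate the same lattice
at y, that of 𝒪(-2mx); their quotient is therefore a unit. -/
theorem exists_detIso_eq {y : X} {f : Module.Basis (Fin 4) X.functionField V}
    (hf : μ.IsBasisAt y f) : ∃ u : (X.presheaf.stalk y)ˣ,
      μ.detIso p hF δ (exteriorPower.ιMulti _ 4 f) =
        ((p.unit y ^ (2 * m : ℤ) : X.functionFieldˣ) : X.functionField) *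
          algebraMap (X.presheaf.stalk y) X.functionField u := by
  have h1 := p.isBasisAt_twistNegModel (2 * m) y
  have h2 := (hf.topBasis hF).map (μ.detIso p hF δ)
    (μ' := Model.twistNegModel p (2 * m)) fun v => Model.mapIso_mem_lat _ _ _
  have h0 : (topBasis f).map (μ.detIso p hF δ) 0 =
      μ.detIso p hF δ (exteriorPower.ιMulti _ 4 f) := by
    rw [Module.Basis.map_apply, topBasis_apply]
  have h0' : scaled (p.unit y) (oneBasis X) (fun _ => ((2 * m : ℕ) : ℤ)) 0 =
      ((p.unit y ^ (2 * m : ℤ) : X.functionFieldˣ) : X.functionField) := by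
    rw [scaled_apply]
    simp
  obtain ⟨r, hr⟩ := h1.repr_mem h2 0 0
  obtain ⟨s, hs⟩ := h2.repr_mem h1 0 0
  rw [repr_eq_div, h0, h0'] at hr
  rw [repr_eq_div, h0, h0'] at hs
  have hd : μ.detIso p hF δ (exteriorPower.ιMulti _ 4 f) ≠ 0 := by
    rw [← h0]
    exact Module.Basis.ne_zero _ _
  have hrs : r * s = 1 := algebraMap_functionField_injective X y (by
    rw [map_mul, hr, hs, map_one, div_mul_div_comm, mul_comm, div_self]
    exact mul_ne_zero (Units.ne_zero _) hd)
  exact ⟨Units.mkOfMulEqOne r s hrs, by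
    rw [Units.val_mkOfMulEqOne, hr, mul_div_cancel₀ _ (Units.ne_zero _)]⟩

/-- The exponents `z` and `w` are measured in V and Λ²V, so `w` already includes the twist of E by
mx. The two sides of `hw` are the exponents of ℋ(E, L) = E'(x) and of (Λ²(F'(ax)))(cx), and `hz`
says that D sends the generator of det F'(ax) to a unit times the 2c-th power of the parameter.
Hence the lattices in Λ²V agree, and the same D gives the form on both sides. -/
theorem heckeIs_of_isBasisAt {b : OrthogonalForm (sixBundle F x m)} (hb : IsWedgeForm δ b)
    {L : Submodule (X.presheaf.stalk x) (fiber2 (sixBundle F x m) x)}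
    {P : Submodule (X.presheaf.stalk x) (fiber2 F x)} {a c : ℕ} {z : Fin 4 → ℤ} {w : Fin 6 → ℤ}
    (h : ∀ y, ∃ f : Module.Basis (Fin 4) X.functionField V, μ.IsBasisAt y f ∧
      (μ.subAt p (P.comap (mk2 F x))).IsBasisAt y (scaled (p.unit y) f z) ∧
      ((μ.sixModel p hF m).subAt p (L.comap (mk2 _ x))).IsBasisAt y
        (scaled (p.unit y) (pairBasis f) w))
    (hw : ∀ k, w k - 1 = z (pfst k) + z (psnd k) - 2 * a - c)
    (hz : ∑ i, z i - 4 * a + 2 * m = 2 * c) : HeckeIs b L P a c := by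
  choose f hf hP hL using h
  let μ₁ : Model (hecke F x P) V := μ.subAt p (P.comap (mk2 F x))
  let μ' : Model (twist (hecke F x P) x a) V := μ₁.twist p a
  let g (y : X) : Module.Basis (Fin 4) X.functionField V :=
    scaled (p.unit y) (f y) (z + fun _ => -(a : ℤ))
  have hg (y : X) : μ'.IsBasisAt y (g y) := by
    have := p.isBasisAt_twist (μ := μ₁) (hP y) a
    rwa [scaled_scaled] at this
  have hF' : IsVectorBundle (twist (hecke F x P) x a) 4 :=
    Model.LocallyFree.isVectorBundle μ' ((μ.locallyFree hF).of_lat_eq p (fun y hy =>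
      (μ₁.twist_lat_of_ne p a hy).trans (μ.subAt_lat_of_ne p _ hy)) (hg x))
  let μE := μ.sixModel p hF m
  let μL : Model (hecke (sixBundle F x m) x L) _ := μE.subAt p (L.comap (mk2 _ x))
  let μH : Model (orthogonalHecke (sixBundle F x m) x L) _ := μL.twist p 1
  let μ'E := μ'.sixModel p hF' c
  have hE (y : X) : μ'E.IsBasisAt y (scaled (p.unit y) (pairBasis (g y)) fun _ => -(c : ℤ)) :=
    p.isBasisAt_twist ((hg y).pairBasis hF') c
  have hH (y : X) : μH.IsBasisAt y (scaled (p.unit y) (pairBasis (g y)) fun _ => -(c : ℤ)) := by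
    have := p.isBasisAt_twist (μ := μL) (hL y) 1
    have hexp : scaled (p.unit y) (pairBasis (g y)) (fun _ => -(c : ℤ)) =
        scaled (p.unit y) (scaled (p.unit y) (pairBasis (f y)) w) fun _ => -((1 : ℕ) : ℤ) := by
      rw [pairBasis_scaled, scaled_scaled, scaled_scaled]
      refine congrArg _ (funext fun k => ?_)
      have := hw k
      simp only [Pi.add_apply]
      push_cast
      linarith
    rw [hexp]
    exact this
  -- Both lattices have the same basis at every point, so ψ is the identity on Λ²V.
  obtain ⟨ψ, hψ⟩ := μH.exists_iso μ'E fun y => (hH y).mem_lat_iff (hE y)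
  let D := μ.detIso p hF δ
  have hD (y : X) : ∃ u : (X.presheaf.stalk y)ˣ, D (exteriorPower.ιMulti _ 4 (g y)) =
      ((p.unit y ^ (2 * c : ℤ) : X.functionFieldˣ) : X.functionField) *
        algebraMap (X.presheaf.stalk y) X.functionField u := by
    obtain ⟨u, hu⟩ := exists_detIso_eq p μ hF δ (hf y)
    refine ⟨u, ?_⟩
    rw [ιMulti_scaled, map_smul, hu, smul_eq_mul, ← mul_assoc, ← Units.val_mul, ← zpow_add]
    congr 4
    rw [← hz]
    simp only [Pi.add_apply, Finset.sum_add_distrib]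
    simp
    ring
  let A : Model (extPower (twist (hecke F x P) x a) 4) X.functionField :=
    (μ'.extPower hF' 4).trans D
  -- The determinant of F'(ax) is placed in the function field by the old D, where its lattices are
  -- those of 𝒪(-2cx).
  obtain ⟨δ', hδ'⟩ := A.exists_iso (Model.twistNegModel p (2 * c)) fun y => by
    have hA : A.IsBasisAt y ((topBasis (g y)).map D) :=
      ((hg y).topBasis hF').map D fun v => by
        rw [Model.mem_trans_lat, LinearEquiv.symm_apply_apply]
    obtain ⟨u, hu⟩ := hD y
    have hu' : (topBasis (g y)).map D 0 =
        ((p.unit y ^ (2 * c : ℤ) : X.functionFieldˣ) : X.functionField) *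
          algebraMap (X.presheaf.stalk y) X.functionField u := by
      rw [Module.Basis.map_apply, topBasis_apply]
      exact hu
    have h0 : scaled (p.unit y) (oneBasis X) (fun _ => ((2 * c : ℕ) : ℤ)) 0 =
        ((p.unit y ^ (2 * c : ℤ) : X.functionFieldˣ) : X.functionField) := by
      rw [scaled_apply]
      simp
    have hne := Units.ne_zero (p.unit y ^ (2 * c : ℤ) : X.functionFieldˣ)
    refine hA.mem_lat_iff ((p.isBasisAt_twistNegModel (2 * c) y).of_repr (fun j i => ?_)
      fun j i => ?_)
    · rw [repr_eq_div, Subsingleton.elim i 0, h0, hu', mul_div_cancel_left₀ _ hne]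
      exact ⟨u, rfl⟩
    · rw [repr_eq_div, Subsingleton.elim i 0, h0, hu', div_mul_cancel_left₀ hne]
      refine ⟨((u⁻¹ : (X.presheaf.stalk y)ˣ) : X.presheaf.stalk y), eq_inv_of_mul_eq_one_left ?_⟩
      rw [← map_mul, Units.inv_mul, map_one]
  have hDδ : μ'.detIso p hF' δ' = D := Model.mapIso_eq hδ'
  obtain ⟨b', hb'⟩ := μ'E.exists_wedgeForm D.toLinearMap fun y => by
    obtain ⟨u, hu⟩ := hD y
    refine ⟨g y, p.unit y, -c, u, hE y, ?_⟩
    refine (congrArg _ hu).trans ?_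
    rw [← mul_assoc, ← Units.val_mul, ← zpow_add]
    simp
  -- The form on ℋ(E, L) is defined by transport from the right-hand side. It extends the form of E
  -- because both come from `wedgeForm D` and ψ is the identity on Λ²V.
  refine ⟨b'.transport ψ, δ', b', ψ, ?_, ?_, fun U s t => b'.transport_form ψ U s t⟩
  · intro U s t
    refine function_ext _ _ fun hη => ?_
    have key (s : Γ(hecke (sixBundle F x m) x L, U)) :
        μ'E.emb _ ((sixBundle (twist (hecke F x P) x a) x c).presheaf.germ U _ hη
          (ψ.hom.app U ((toTwist (hecke (sixBundle F x m) x L) x 1).app U s))) =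
        μE.emb _ ((sixBundle F x m).presheaf.germ U (genericPoint X) hη
          ((heckeι (sixBundle F x m) x L).app U s)) := by
      refine (congrArg (μ'E.emb _) (stalkMap_germ ψ.hom hη _).symm).trans ((hψ _ _).trans ?_)
      refine (congrArg (μH.emb _) (stalkMap_germ _ hη _).symm).trans ((μL.twist_emb p 1 _ _).trans
        ((μE.subAt_emb p _ _ _).trans (congrArg (μE.emb _) (stalkMap_germ _ hη _))))
    have hbE := μ.formIs_of_isWedgeForm p hF δ hb
    refine (congrArg _ (b'.transport_form ψ U _ _).symm).trans
      ((hb' U hη _ _).trans (Eq.trans ?_ (hbE U hη _ _).symm))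
    exact congrArg₂ (fun v w => wedgeForm D.toLinearMap v w) (key s) (key t)
  · refine μ'.isWedgeForm_of_formIs p hF' δ' ?_
    rw [hDδ]
    exact hb'

end

/-! ### Linear equivalences and lengths of quotients -/

section
variable {R A B C : Type*} [CommRing R] [AddCommGroup A] [Module R A] [AddCommGroup B] [Module R B]
  [AddCommGroup C] [Module R C]

theorem exists_linearEquiv_of_range_eq (f : A →ₗ[R] C) (g : B →ₗ[R] C)
    (hf : Function.Injective f) (hg : Function.Injective g)
    (h : LinearMap.range f = LinearMap.range g) : ∃ σ : A ≃ₗ[R] B, ∀ a, g (σ a) = f a := by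
  refine ⟨(LinearEquiv.ofInjective f hf).trans ((LinearEquiv.ofEq _ _ h).trans
    (LinearEquiv.ofInjective g hg).symm), fun a => ?_⟩
  have h1 := (LinearEquiv.ofInjective g hg).apply_symm_apply
    (LinearEquiv.ofEq _ _ h (LinearEquiv.ofInjective f hf a))
  exact congrArg Subtype.val h1

theorem smul_top_map_equiv (ρ : A ≃ₗ[R] B) (I : Ideal R) :
    (I • ⊤ : Submodule R A).map ρ.toLinearMap = I • ⊤ := by
  rw [Submodule.map_smul'', Submodule.map_top, LinearEquiv.range]

theorem length_map_mkQ_equiv (ρ : A ≃ₗ[R] B) (I : Ideal R) (S : Submodule R A) :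
    Module.length R ((S.map ρ.toLinearMap).map (I • ⊤ : Submodule R B).mkQ) =
      Module.length R (S.map (I • ⊤ : Submodule R A).mkQ) := by
  let θ := Submodule.Quotient.equiv (I • ⊤ : Submodule R A) (I • ⊤ : Submodule R B) ρ
    (smul_top_map_equiv ρ I)
  have h2 : (S.map ρ.toLinearMap).map (I • ⊤ : Submodule R B).mkQ =
      (S.map (I • ⊤ : Submodule R A).mkQ).map θ.toLinearMap := by
    rw [← Submodule.map_comp, ← Submodule.map_comp]
    rfl
  rw [h2]
  exact (θ.submoduleMap _).length_eq.symm

end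

/-! ### Submodules over the divisor 2x and their preimages in the stalk -/

section
variable {X : Scheme.{u}} {M : X.Modules} {x : X}

theorem smul_top_le_comap_mk2 (P : Submodule (X.presheaf.stalk x) (fiber2 M x)) :
    maximalIdeal (X.presheaf.stalk x) ^ 2 • ⊤ ≤ P.comap (mk2 M x) := fun v hv => by
  rw [Submodule.mem_comap, mk2, Submodule.mkQ_apply, (Submodule.Quotient.mk_eq_zero _).mpr hv]
  exact P.zero_mem

theorem comap_map_mk2 (S : Submodule (X.presheaf.stalk x) (M.presheaf.stalk x)) :
    (S.map (mk2 M x)).comap (mk2 M x) = maximalIdeal (X.presheaf.stalk x) ^ 2 • ⊤ ⊔ S :=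
  Submodule.comap_map_mkQ _ _

theorem map_comap_mk2 (P : Submodule (X.presheaf.stalk x) (fiber2 M x)) :
    (P.comap (mk2 M x)).map (mk2 M x) = P :=
  Submodule.map_comap_eq_of_surjective (Submodule.mkQ_surjective _) _

theorem comap_mk2_injective {P Q : Submodule (X.presheaf.stalk x) (fiber2 M x)}
    (h : P.comap (mk2 M x) = Q.comap (mk2 M x)) : P = Q := by
  rw [← map_comap_mk2 P, h, map_comap_mk2]

/-- The preimage in the stalk of a submodule of the fibre. -/
abbrev stalkLift (W : Submodule (X.presheaf.stalk x) (fiber M x)) :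
    Submodule (X.presheaf.stalk x) (M.presheaf.stalk x) :=
  W.comap (maximalIdeal (X.presheaf.stalk x) • ⊤ :
    Submodule (X.presheaf.stalk x) (M.presheaf.stalk x)).mkQ

theorem red_comp_mk2 : (red M x) ∘ₗ (mk2 M x) = (maximalIdeal (X.presheaf.stalk x) • ⊤ :
    Submodule (X.presheaf.stalk x) (M.presheaf.stalk x)).mkQ := rfl

theorem smul_top_le_stalkLift (W : Submodule (X.presheaf.stalk x) (fiber M x)) :
    maximalIdeal (X.presheaf.stalk x) • ⊤ ≤ stalkLift W := Submodule.le_comap_mkQ _ _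

theorem map_stalkLift (W : Submodule (X.presheaf.stalk x) (fiber M x)) :
    (stalkLift W).map (maximalIdeal (X.presheaf.stalk x) • ⊤ :
      Submodule (X.presheaf.stalk x) (M.presheaf.stalk x)).mkQ = W :=
  Submodule.map_comap_eq_of_surjective (Submodule.mkQ_surjective _) _

theorem comap_red_comap_mk2 (W : Submodule (X.presheaf.stalk x) (fiber M x)) :
    (W.comap (red M x)).comap (mk2 M x) = stalkLift W := by
  rw [stalkLift, ← red_comp_mk2, Submodule.comap_comp]

theorem stalkLift_map (S : Submodule (X.presheaf.stalk x) (M.presheaf.stalk x)) :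
    stalkLift (S.map (maximalIdeal (X.presheaf.stalk x) • ⊤ :
      Submodule (X.presheaf.stalk x) (M.presheaf.stalk x)).mkQ) =
      maximalIdeal (X.presheaf.stalk x) • ⊤ ⊔ S := Submodule.comap_map_mkQ _ _

theorem map_red (P : Submodule (X.presheaf.stalk x) (fiber2 M x)) :
    P.map (red M x) = (P.comap (mk2 M x)).map (maximalIdeal (X.presheaf.stalk x) • ⊤ :
      Submodule (X.presheaf.stalk x) (M.presheaf.stalk x)).mkQ := by
  rw [← red_comp_mk2, Submodule.map_comp, map_comap_mk2]

theorem pow_two_smul_top_le : (maximalIdeal (X.presheaf.stalk x) ^ 2 • ⊤ :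
    Submodule (X.presheaf.stalk x) (M.presheaf.stalk x)) ≤
      maximalIdeal (X.presheaf.stalk x) • ⊤ :=
  Submodule.smul_mono_left (Ideal.pow_le_self two_ne_zero)

theorem map_red_eq_iff {P : Submodule (X.presheaf.stalk x) (fiber2 M x)}
    {W : Submodule (X.presheaf.stalk x) (fiber M x)} :
    P.map (red M x) = W ↔
      P.comap (mk2 M x) ⊔ maximalIdeal (X.presheaf.stalk x) • ⊤ = stalkLift W := by
  rw [map_red, sup_comm, ← stalkLift_map]
  exact ⟨fun h => by rw [h], fun h => by rw [← map_stalkLift W, ← h, map_stalkLift]⟩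

/-- Both conditions are pulled back to the stalk, which loses nothing since the quotient map is
surjective. In this form `exists_basis_of_extension` applies. -/
theorem isExtension_iff {P : Submodule (X.presheaf.stalk x) (fiber2 M x)}
    {G W : Submodule (X.presheaf.stalk x) (fiber M x)} : IsExtension P G W ↔
      P.comap (mk2 M x) ⊔ maximalIdeal (X.presheaf.stalk x) • ⊤ = stalkLift W ∧
      P.comap (mk2 M x) ⊓ maximalIdeal (X.presheaf.stalk x) • ⊤ =
        maximalIdeal (X.presheaf.stalk x) • stalkLift G := by
  refine and_congr map_red_eq_iff ?_
  have h1 : (P ⊓ maximalIdeal (X.presheaf.stalk x) • ⊤).comap (mk2 M x) =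
      P.comap (mk2 M x) ⊓ maximalIdeal (X.presheaf.stalk x) • ⊤ := by
    rw [Submodule.comap_inf]
    congr 1
    have : (maximalIdeal (X.presheaf.stalk x) • ⊤ : Submodule _ (fiber2 M x)) =
        (maximalIdeal (X.presheaf.stalk x) • ⊤ : Submodule _ (M.presheaf.stalk x)).map
          (mk2 M x) := by
      rw [Submodule.map_smul'', Submodule.map_top, mk2, Submodule.range_mkQ]
    rw [this, comap_map_mk2, sup_eq_right.mpr pow_two_smul_top_le]
  have h2 : (maximalIdeal (X.presheaf.stalk x) • G.comap (red M x)).comap (mk2 M x) =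
      maximalIdeal (X.presheaf.stalk x) • stalkLift G := by
    rw [← map_comap_mk2 (G.comap (red M x)), ← Submodule.map_smul'', comap_map_mk2,
      comap_red_comap_mk2, sup_eq_right, pow_two, mul_smul]
    exact Submodule.smul_mono le_rfl (smul_top_le_stalkLift G)
  rw [← h1, ← h2]
  exact ⟨fun h => by rw [h], comap_mk2_injective⟩

end

/-! ### The stalk of a twist -/

section
variable {X : Scheme.{u}} [IsIntegral X] {x : X} (p : LocalParameter x)
  [IsDiscreteValuationRing (X.presheaf.stalk x)]
  {M : X.Modules} {V : Type u} [AddCommGroup V] [Module X.functionField V] (μ : Model M V)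

namespace Model

-- Inside V the lattice of M(nx) at x is τ⁻ⁿ times that of M. Multiplication by ϖⁿ and the natural
-- map from M are thus injections into the stalk of M(nx) with the same image.
include μ in
theorem exists_twistStalkEquiv (n : ℕ) :
    ∃ σ : (OrthHecke.twist M x n).presheaf.stalk x ≃ₗ[X.presheaf.stalk x] M.presheaf.stalk x,
      ∀ u, stalkMap (toTwist M x n) x (σ u) = p.ϖ ^ n • u := by
  let μ' : Model (OrthHecke.twist M x n) V := μ.twist p n
  have hemb (u : (OrthHecke.twist M x n).presheaf.stalk x) :
      μ'.emb x (p.ϖ ^ n • u) = p.τ ^ n • μ'.emb x u := by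
    rw [map_smulₛₗ, map_pow]
    rfl
  have hT (v) : μ'.emb x (stalkMap (toTwist M x n) x v) = μ.emb x v := μ.twist_emb p n x v
  refine exists_linearEquiv_of_range_eq (LinearMap.lsmul _ _ (p.ϖ ^ n))
    (stalkMap (toTwist M x n) x) (fun u u' h => μ'.emb_injective x ?_)
    (fun v v' h => μ.emb_injective x ?_) (le_antisymm ?_ ?_)
  · have h1 := congrArg (μ'.emb x) h
    rw [LinearMap.lsmul_apply, LinearMap.lsmul_apply, hemb, hemb] at h1
    exact smul_right_injective V (pow_ne_zero n p.τ_ne_zero) h1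
  · rw [← hT, ← hT, h]
  · rintro _ ⟨u, rfl⟩
    obtain ⟨v, hv⟩ := (μ.mem_twist_lat_self p n).mp ⟨u, rfl⟩
    exact ⟨v, μ'.emb_injective x ((hT v).trans (hv.trans (hemb u).symm))⟩
  · rintro _ ⟨v, rfl⟩
    obtain ⟨u, hu⟩ : (p.τ ^ n)⁻¹ • μ.emb x v ∈ μ'.lat x := (μ.mem_twist_lat_self p n).mpr <| by
      rw [smul_inv_smul₀ (pow_ne_zero n p.τ_ne_zero)]
      exact ⟨v, rfl⟩
    refine ⟨u, μ'.emb_injective x ?_⟩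
    rw [LinearMap.lsmul_apply, hemb, hT]
    exact (congrArg _ hu).trans (smul_inv_smul₀ (pow_ne_zero n p.τ_ne_zero) _)

/-- Multiplication by the `n`-th power of the parameter identifies the stalks of `M(nx)` and `M`. -/
def twistStalkEquiv (n : ℕ) :
    (OrthHecke.twist M x n).presheaf.stalk x ≃ₗ[X.presheaf.stalk x] M.presheaf.stalk x :=
  (μ.exists_twistStalkEquiv p n).choose

theorem stalkMap_twistStalkEquiv (n : ℕ) (u) :
    stalkMap (toTwist M x n) x (μ.twistStalkEquiv p n u) = p.ϖ ^ n • u :=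
  (μ.exists_twistStalkEquiv p n).choose_spec u

theorem emb_twistStalkEquiv (n : ℕ) (u : (OrthHecke.twist M x n).presheaf.stalk x) :
    μ.emb x (μ.twistStalkEquiv p n u) = p.τ ^ n • (μ.twist p n).emb x u := by
  rw [← μ.twist_emb p n, stalkMap_twistStalkEquiv, map_smulₛₗ, map_pow]
  rfl

theorem twistGerms_eq (n : ℕ) (N : Submodule (X.presheaf.stalk x) (fiber2 M x)) :
    twistGerms n N = (N.comap (mk2 M x)).comap (μ.twistStalkEquiv p n).toLinearMap := by
  have hm : maximalIdeal (X.presheaf.stalk x) ^ n = Ideal.span {p.ϖ ^ n} := by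
    rw [p.irreducible.maximalIdeal_eq, Ideal.span_singleton_pow]
    rfl
  have hinj : Function.Injective (stalkMap (toTwist M x n) x) := fun v v' h =>
    μ.emb_injective x (by rw [← μ.twist_emb p n, h, μ.twist_emb p n])
  ext u
  constructor
  · intro hu
    obtain ⟨v, hv, h⟩ := hu (p.ϖ ^ n) (hm ▸ Ideal.mem_span_singleton_self _)
    rw [← μ.stalkMap_twistStalkEquiv] at h
    rw [hinj h] at hv
    exact hv
  · intro hu f hf
    rw [hm, Ideal.mem_span_singleton'] at hf
    obtain ⟨r, rfl⟩ := hf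
    rw [mul_smul, ← μ.stalkMap_twistStalkEquiv]
    exact Submodule.smul_mem _ _ ⟨_, hu, rfl⟩

theorem comap_twistSubmodule (n : ℕ) (N : Submodule (X.presheaf.stalk x) (fiber2 M x)) :
    (twistSubmodule n N).comap (mk2 _ x) =
      (N.comap (mk2 M x)).comap (μ.twistStalkEquiv p n).toLinearMap := by
  rw [twistSubmodule, comap_map_mk2, μ.twistGerms_eq p, sup_eq_right, ← Submodule.map_le_iff_le_comap,
    smul_top_map_equiv]
  exact smul_top_le_comap_mk2 N

end Model
end

section
variable {R A B C : Type*} [CommRing R] [AddCommGroup A] [Module R A] [AddCommGroup B] [Module R B]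
  [AddCommGroup C] [Module R C]

theorem map_trans_comap (σ : A ≃ₗ[R] B) (ε : B ≃ₗ[R] C) (S : Submodule R B) :
    (S.comap σ.toLinearMap).map (σ.trans ε).toLinearMap = S.map ε.toLinearMap := by
  rw [LinearEquiv.coe_trans, Submodule.map_comp, Submodule.map_comap_eq_of_surjective σ.surjective]

variable [IsDomain R] [IsDiscreteValuationRing R] {ϖ : R}

theorem length_map_mkQ_pow (hϖ : Irreducible ϖ) (k : ℕ) (S : Submodule R A) :
    Module.length R (S.map (maximalIdeal R ^ k • ⊤ : Submodule R A).mkQ) = lengthMod ϖ k S := by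
  rw [hϖ.maximalIdeal_eq]

theorem length_map_mkQ_maximalIdeal (hϖ : Irreducible ϖ) (S : Submodule R A) :
    Module.length R (S.map (maximalIdeal R • ⊤ : Submodule R A).mkQ) = lengthMod ϖ 1 S := by
  rw [lengthMod, pow_one, hϖ.maximalIdeal_eq]

end

/-! ### Products of submodules on the level of stalks -/

section
variable {X : Scheme.{u}} {F : X.Modules} (hF : IsVectorBundle F 4) {x : X}

/-- Sections near x may be replaced by germs, since finitely many germs extend to a common
neighbourhood. The summand 𝔪² accounts for passing to the quotient and back. -/
theorem map_comap_wedgeSub (P Q : Submodule (X.presheaf.stalk x) (fiber2 F x)) :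
    ((wedgeSub P Q).comap (mk2 _ x)).map (extStalkEquiv hF 2 x).toLinearMap =
      Submodule.span _ {ω | ∃ p q, p ∈ P.comap (mk2 F x) ∧ q ∈ Q.comap (mk2 F x) ∧
        ω = exteriorPower.ιMulti _ 2 ![p, q]} ⊔ maximalIdeal (X.presheaf.stalk x) ^ 2 • ⊤ := by
  let S : Set ((extPower F 2).presheaf.stalk x) := {v | ∃ p q, p ∈ P.comap (mk2 F x) ∧
    q ∈ Q.comap (mk2 F x) ∧ v = (extStalkEquiv hF 2 x).symm (exteriorPower.ιMulti _ 2 ![p, q])}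
  have hg {U : X.Opens} (hx : x ∈ U) (s : Fin 2 → Γ(F, U)) :
      (extStalkEquiv hF 2 x).symm (exteriorPower.ιMulti _ 2
        ![F.presheaf.germ U x hx (s 0), F.presheaf.germ U x hx (s 1)]) =
        (extPower F 2).presheaf.germ U x hx (wedge s) := by
    rw [LinearEquiv.symm_apply_eq, extStalkEquiv_germ_wedge]
    congr 1
    ext i
    fin_cases i <;> rfl
  have h1 : wedgeSub P Q = (Submodule.span _ S).map (mk2 _ x) := by
    rw [wedgeSub, Submodule.map_span]
    congr 1
    ext ω
    constructor
    · rintro ⟨U, hx, s, t, hs, ht, rfl⟩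
      exact ⟨_, ⟨_, _, hs, ht, rfl⟩, congrArg (mk2 _ x) (hg hx ![s, t])⟩
    · rintro ⟨_, ⟨v, w, hv, hw, rfl⟩, rfl⟩
      obtain ⟨U, hx, -, s, hs⟩ := exists_germs F (U := ⊤) (y := x) trivial ![v, w]
      have h0 : F.presheaf.germ U x hx (s 0) = v := hs 0
      have h1 : F.presheaf.germ U x hx (s 1) = w := hs 1
      subst h0 h1
      exact ⟨U, hx, s 0, s 1, hv, hw, congrArg (mk2 _ x) (hg hx ![s 0, s 1])⟩
  rw [h1, comap_map_mk2, Submodule.map_sup, smul_top_map_equiv, Submodule.map_span, sup_comm]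
  congr 2
  ext ω
  constructor
  · rintro ⟨_, ⟨v, w, hv, hw, rfl⟩, rfl⟩
    exact ⟨v, w, hv, hw, LinearEquiv.apply_symm_apply _ _⟩
  · rintro ⟨v, w, hv, hw, rfl⟩
    exact ⟨_, ⟨v, w, hv, hw, rfl⟩, LinearEquiv.apply_symm_apply _ _⟩

end

/-! ### The lattice in the exterior square of the stalk given by a submodule over 2x -/

section
variable {X : Scheme.{u}} [IsIntegral X] {x : X} (p : LocalParameter x)
  [IsDiscreteValuationRing (X.presheaf.stalk x)]
  {F : X.Modules} {V : Type u} [AddCommGroup V] [Module X.functionField V] (μ : Model F V)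
  (hF : IsVectorBundle F 4) {m : ℕ}

namespace Model

/-- The stalk at `x` of `(Λ²F)(mx)` is identified with `⋀²F_x` by means of the parameter. -/
def sixStalkEquiv (m : ℕ) : (sixBundle F x m).presheaf.stalk x ≃ₗ[X.presheaf.stalk x]
    ⋀[X.presheaf.stalk x]^2 (F.presheaf.stalk x) :=
  ((μ.extPower hF 2).twistStalkEquiv p m).trans (extStalkEquiv hF 2 x)

theorem emb_sixStalkEquiv (u : (sixBundle F x m).presheaf.stalk x) :
    exteriorMap (algebraMap (X.presheaf.stalk x) X.functionField) 2 (μ.emb x)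
      (μ.sixStalkEquiv p hF m u) = p.τ ^ m • (μ.sixModel p hF m).emb x u := by
  exact (μ.extPower_emb hF 2 x _).symm.trans ((μ.extPower hF 2).emb_twistStalkEquiv p m u)

/-- The lattice in `⋀²F_x` that corresponds to a submodule of the fibre of `(Λ²F)(mx)` over
`2x`. -/
def sixLattice (L : Submodule (X.presheaf.stalk x) (fiber2 (sixBundle F x m) x)) :
    Submodule (X.presheaf.stalk x) (⋀[X.presheaf.stalk x]^2 (F.presheaf.stalk x)) :=
  (L.comap (mk2 _ x)).map (μ.sixStalkEquiv p hF m).toLinearMap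

variable {L L' : Submodule (X.presheaf.stalk x) (fiber2 (sixBundle F x m) x)}

theorem sixStalkEquiv_mem {u : (sixBundle F x m).presheaf.stalk x} :
    μ.sixStalkEquiv p hF m u ∈ μ.sixLattice p hF L ↔ u ∈ L.comap (mk2 _ x) := by
  rw [sixLattice, Submodule.mem_map_equiv, LinearEquiv.symm_apply_apply]

theorem sixLattice_injective (h : μ.sixLattice p hF L = μ.sixLattice p hF L') : L = L' :=
  comap_mk2_injective
    (Submodule.map_injective_of_injective (μ.sixStalkEquiv p hF m).injective h)

theorem smul_top_le_sixLattice :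
    maximalIdeal (X.presheaf.stalk x) ^ 2 • ⊤ ≤ μ.sixLattice p hF L := by
  rw [← smul_top_map_equiv (μ.sixStalkEquiv p hF m)]
  exact Submodule.map_mono (smul_top_le_comap_mk2 L)

theorem sixLattice_wedgeIn (P Q : Submodule (X.presheaf.stalk x) (fiber2 F x)) :
    μ.sixLattice p hF (wedgeIn m P Q) =
      Submodule.span _ {ω | ∃ p q, p ∈ P.comap (mk2 F x) ∧ q ∈ Q.comap (mk2 F x) ∧
        ω = exteriorPower.ιMulti _ 2 ![p, q]} ⊔ maximalIdeal (X.presheaf.stalk x) ^ 2 • ⊤ := by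
  rw [← map_comap_wedgeSub hF, sixLattice]
  have h1 := (μ.extPower hF 2).comap_twistSubmodule p m (wedgeSub P Q)
  have h2 : (wedgeIn m P Q).comap (mk2 (sixBundle F x m) x) =
    ((wedgeSub P Q).comap (mk2 _ x)).comap
      ((μ.extPower hF 2).twistStalkEquiv p m).toLinearMap := h1
  rw [h2]
  exact map_trans_comap _ _ _

theorem sixLattice_wedgeIn_of_eq (e : Module.Basis (Fin 4) _ (F.presheaf.stalk x))
    {P Q : Submodule (X.presheaf.stalk x) (fiber2 F x)} {a b : Fin 4 → ℕ}
    (hP : P.comap (mk2 F x) = expSub p.ϖ e a) (hQ : Q.comap (mk2 F x) = expSub p.ϖ e b) :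
    μ.sixLattice p hF (wedgeIn m P Q) = expSub p.ϖ (pairBasis e) (wedgeExp a b) := by
  rw [sixLattice_wedgeIn, hP, hQ, ← span_wedge_sup, p.irreducible.maximalIdeal_eq]
  rfl

theorem length_eq_lengthMod :
    Module.length (X.presheaf.stalk x) L = lengthMod p.ϖ 2 (μ.sixLattice p hF L) := by
  have h1 := length_map_mkQ_equiv (μ.sixStalkEquiv p hF m)
    (maximalIdeal (X.presheaf.stalk x) ^ 2) (L.comap (mk2 _ x))
  have h2 := congrArg (fun N : Submodule _ (fiber2 (sixBundle F x m) x) =>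
    Module.length (X.presheaf.stalk x) N) (map_comap_mk2 L)
  refine h2.symm.trans (h1.symm.trans ?_)
  exact length_map_mkQ_pow p.irreducible 2 _

theorem length_map_red :
    Module.length (X.presheaf.stalk x) (L.map (red _ x)) =
      lengthMod p.ϖ 1 (μ.sixLattice p hF L) := by
  have h1 := length_map_mkQ_equiv (μ.sixStalkEquiv p hF m)
    (maximalIdeal (X.presheaf.stalk x)) (L.comap (mk2 _ x))
  rw [map_red, ← h1]
  exact length_map_mkQ_maximalIdeal p.irreducible _

theorem map_red_eq_map_red_iff : L.map (red _ x) = L'.map (red _ x) ↔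
    μ.sixLattice p hF L ⊔ maximalIdeal (X.presheaf.stalk x) • ⊤ =
      μ.sixLattice p hF L' ⊔ maximalIdeal (X.presheaf.stalk x) • ⊤ := by
  rw [map_red_eq_iff, map_red (P := L'), stalkLift_map, sup_comm (maximalIdeal _ • ⊤),
    sixLattice, sixLattice, ← smul_top_map_equiv (μ.sixStalkEquiv p hF m), ← Submodule.map_sup,
    ← Submodule.map_sup]
  exact (Submodule.map_injective_of_injective (μ.sixStalkEquiv p hF m).injective).eq_iff.symm

end Model
end

section
variable {R A B : Type*} [CommRing R] [AddCommGroup A] [Module R A] [AddCommGroup B] [Module R B]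
  {ι : Type*}

theorem expSub_map_equiv (ϖ : R) (e : Module.Basis ι R A) (σ : A ≃ₗ[R] B) (c : ι → ℕ) :
    (expSub ϖ e c).map σ.toLinearMap = expSub ϖ (e.map σ) c := by
  ext v
  rw [Submodule.mem_map_equiv, mem_expSub, mem_expSub]
  rfl

end

/-! ### The criterion in terms of exponents at x -/

section
variable {X : Scheme.{u}} [IsIntegral X] {x : X} (p : LocalParameter x)
  [IsDiscreteValuationRing (X.presheaf.stalk x)]
  {F : X.Modules} {V : Type u} [AddCommGroup V] [Module X.functionField V] (μ : Model F V)
  (hF : IsVectorBundle F 4) {m : ℕ}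

namespace Model

include hF in
theorem exists_basis_emb {y : X} (e : Module.Basis (Fin 4) (X.presheaf.stalk y)
    (F.presheaf.stalk y)) :
    ∃ f : Module.Basis (Fin 4) X.functionField V, ∀ i, μ.emb y (e i) = f i := by
  obtain ⟨U, hy, b, hb⟩ := μ.locallyFree hF y
  obtain ⟨e', he'⟩ := (hb y hy).exists_basis
  obtain ⟨f, hf⟩ := exists_basis_of_mem_span b (fun i => μ.emb y (e i)) fun i => by
    rw [← he', ← e.sum_repr (e' i), map_sum]
    refine Submodule.sum_mem _ fun j _ => ?_
    rw [map_smulₛₗ]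
    exact Submodule.smul_mem _ _ (Submodule.subset_span ⟨j, rfl⟩)
  exact ⟨f, fun i => (congrFun hf i).symm⟩

theorem exteriorMap_pairBasis {y : X} {e : Module.Basis (Fin 4) (X.presheaf.stalk y)
    (F.presheaf.stalk y)} {f : Module.Basis (Fin 4) X.functionField V}
    (he : ∀ i, μ.emb y (e i) = f i) (k : Fin 6) :
    exteriorMap (algebraMap (X.presheaf.stalk y) X.functionField) 2 (μ.emb y) (pairBasis e k) =
      pairBasis f k := by
  rw [pairBasis_apply, pairBasis_apply, exteriorMap_ιMulti]
  congr 1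
  ext i
  fin_cases i
  · exact he _
  · exact he _

omit [IsDiscreteValuationRing (X.presheaf.stalk x)] in
theorem isBasisAt_subAt_of_eq {M : X.Modules} {W : Type u} [AddCommGroup W]
    [Module X.functionField W] {ν : Model M W} {ι : Type} [Finite ι]
    {b : Module.Basis ι X.functionField W}
    {e : Module.Basis ι (X.presheaf.stalk x) (M.presheaf.stalk x)} (he : ∀ i, ν.emb x (e i) = b i)
    {c : ι → ℕ} {N : Submodule (X.presheaf.stalk x) (M.presheaf.stalk x)}
    (hN : N = expSub p.ϖ e c) :
    (ν.subAt p N).IsBasisAt x (scaled (p.unit x) b fun i => c i) := by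
  subst hN
  exact p.isBasisAt_subAt e he c

end Model

variable (δ : extPower F 4 ≅ twistNeg (structureModule X) x (2 * m))
  {b : OrthogonalForm (sixBundle F x m)} (hb : IsWedgeForm δ b)
  {L : Submodule (X.presheaf.stalk x) (fiber2 (sixBundle F x m) x)}

include hb

/-- Away from x nothing is modified, so a single basis of the stalk at x decides. The exponents `w`
are measured in Λ² of the stalk of F, and each twist shifts the bookkeeping by its degree. -/
theorem heckeIs_of_eq_expSub {P : Submodule (X.presheaf.stalk x) (fiber2 F x)} {a c : ℕ}
    {e : Module.Basis (Fin 4) (X.presheaf.stalk x) (F.presheaf.stalk x)} {z : Fin 4 → ℕ}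
    {w : Fin 6 → ℕ} (hP : P.comap (mk2 F x) = expSub p.ϖ e z)
    (hL : μ.sixLattice p hF L = expSub p.ϖ (pairBasis e) w)
    (hw : ∀ k, w k + 2 * a + c = z (pfst k) + z (psnd k) + m + 1)
    (hz : ∑ i, z i + 2 * m = 2 * c + 4 * a) : HeckeIs b L P a c := by
  -- The shift by m undoes the factor τ^m in `sixStalkEquiv`.
  refine heckeIs_of_isBasisAt p μ hF δ hb (z := fun i => z i) (w := fun k => (w k : ℤ) - m)
    (fun y => ?_) (fun k => ?_) ?_
  · by_cases hy : y = x
    · subst hy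
      obtain ⟨f, hf⟩ := μ.exists_basis_emb hF e
      refine ⟨f, Model.isBasisAt_of_basis e hf, Model.isBasisAt_subAt_of_eq p hf hP, ?_⟩
      let E : X.Modules := sixBundle F y m
      let e' : Module.Basis (Fin 6) (X.presheaf.stalk y) (E.presheaf.stalk y) :=
        (pairBasis e).map (μ.sixStalkEquiv p hF m).symm
      have he' (k : Fin 6) : (μ.sixModel p hF m).emb y (e' k) =
          scaled (p.unit y) (pairBasis f) (fun _ => -(m : ℤ)) k := by
        have h1 := μ.emb_sixStalkEquiv p hF (e' k)
        have h2 : μ.sixStalkEquiv p hF m (e' k) = pairBasis e k := by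
          rw [Module.Basis.map_apply]
          exact LinearEquiv.apply_symm_apply _ _
        rw [h2, μ.exteriorMap_pairBasis hf] at h1
        rw [scaled_apply, h1, smul_smul, p.unit_self, zpow_neg, zpow_natCast,
          Units.val_inv_eq_inv_val, Units.val_pow_eq_pow_val, Units.val_mk0,
          inv_mul_cancel₀ (pow_ne_zero m p.τ_ne_zero), one_smul]
      have hL' : L.comap (mk2 (sixBundle F y m) y) = expSub p.ϖ e' w := by
        rw [← expSub_map_equiv, ← hL]
        ext v
        rw [Submodule.mem_map_equiv, LinearEquiv.symm_symm, Model.sixStalkEquiv_mem]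
      have h3 := Model.isBasisAt_subAt_of_eq p (ν := μ.sixModel p hF m) he' hL'
      rw [scaled_scaled] at h3
      have h4 : (fun k => (w k : ℤ) - m) = (fun _ => -(m : ℤ)) + fun k => (w k : ℤ) :=
        funext fun k => by rw [Pi.add_apply]; ring
      rw [h4]
      exact h3
    · obtain ⟨U, hU, f, hf⟩ := μ.locallyFree hF y
      have h1 := p.isBasisAt_twist ((hf y hU).pairBasis hF) m
      rw [p.unit_of_ne hy, scaled_one] at h1
      exact ⟨f, hf y hU, p.isBasisAt_subAt_of_ne (hf y hU) hy _ _,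
        p.isBasisAt_subAt_of_ne h1 hy _ _⟩
  · have := hw k
    linarith [(by exact_mod_cast this : (w k : ℤ) + 2 * a + c = z (pfst k) + z (psnd k) + m + 1)]
  · linarith [(by exact_mod_cast hz : ∑ i, (z i : ℤ) + 2 * m = 2 * c + 4 * a)]

/-- The identification of stalks multiplies each argument of the form by τ^m, which absorbs the
factor τ^(2m) in δ. The form becomes the exterior product with values in the local ring, normalized
by a unit. -/
theorem exists_isotropicLattice (h2 : IsUnit (2 : X.presheaf.stalk x)) {r : ℕ}
    (hL : IsLagrangian b x r L) :
    ∃ D, IsotropicLattice p.ϖ D (μ.sixLattice p hF L) := by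
  obtain ⟨U, hx, f, hf⟩ := μ.locallyFree hF x
  obtain ⟨e, he⟩ := (hf x hx).exists_basis
  obtain ⟨u, hu⟩ := exists_detIso_eq p μ hF δ (hf x hx)
  -- The linear form on Λ⁴ of the stalk that takes the unit u on the basis e, where u is what
  -- remains of δ after the power of the parameter is removed.
  let D : ⋀[X.presheaf.stalk x]^4 (F.presheaf.stalk x) ≃ₗ[X.presheaf.stalk x] X.presheaf.stalk x :=
    (topBasis e).equivFun.trans ((LinearEquiv.funUnique (Fin 1) _ _).trans
      (LinearEquiv.smulOfUnit u))
  have hD : D (exteriorPower.ιMulti _ 4 e) = u := by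
    rw [← topBasis_apply e 0]
    simp [D, LinearEquiv.smulOfUnit, Units.smul_def]
  refine ⟨D, p.irreducible, h2, fun e' => ?_, ?_, fun l hl => ?_⟩
  -- D is an isomorphism, so it sends the generator given by any basis to a unit; the inverse is the
  -- coordinate of the preimage of 1.
  · rw [← topBasis_apply e' 0]
    have h1 := (topBasis e').sum_repr (D.symm 1)
    rw [Fin.sum_univ_one] at h1
    have h2 := congrArg D h1
    rw [map_smul, LinearEquiv.apply_symm_apply, smul_eq_mul, mul_comm] at h2
    exact IsUnit.of_mul_eq_one _ h2
  · have := μ.smul_top_le_sixLattice p hF (L := L)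
    rwa [p.irreducible.maximalIdeal_eq] at this
  · obtain ⟨v, rfl⟩ := (μ.sixStalkEquiv p hF m).surjective l
    rw [μ.sixStalkEquiv_mem] at hl
    obtain ⟨U', hx', s, rfl⟩ := TopCat.Presheaf.exists_germ_eq (sixBundle F x m).presheaf v
    have h3 := hL.1 U' hx' s hl
    rw [p.irreducible.maximalIdeal_eq, Ideal.span_singleton_pow, Ideal.mem_span_singleton] at h3
    refine h3.trans (dvd_of_eq (algebraMap_functionField_injective X x ?_))
    have hη := genericPoint_mem hx'
    have hs : (μ.sixModel p hF m).emb (genericPoint X) ((sixBundle F x m).presheaf.germ U' _ hη s) =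
        (μ.sixModel p hF m).emb x ((sixBundle F x m).presheaf.germ U' x hx' s) := by
      rw [Model.emb_germ, Model.emb_germ]
    have hc (k : Fin 6) : algebraMap (X.presheaf.stalk x) X.functionField ((pairBasis e).repr
        (μ.sixStalkEquiv p hF m ((sixBundle F x m).presheaf.germ U' x hx' s)) k) =
        p.τ ^ m * (pairBasis f).repr ((μ.sixModel p hF m).emb x
          ((sixBundle F x m).presheaf.germ U' x hx' s)) k := by
      rw [← repr_semilinear (pairBasis e) (pairBasis f) _ (μ.exteriorMap_pairBasis he),
        μ.emb_sixStalkEquiv p hF, map_smul]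
      rfl
    have hu' : p.τ ^ (2 * m) * algebraMap (X.presheaf.stalk x) X.functionField u =
        μ.detIso p hF δ (exteriorPower.ιMulti _ 4 f) := by
      rw [hu, p.unit_self]
      norm_cast
    rw [algebraMap_germ, μ.formIs_of_isWedgeForm p hF δ hb U' hη, hs, wedgeForm_eq _ f,
      wedgeForm_eq _ e, LinearEquiv.coe_coe, LinearEquiv.coe_coe, hD, ← hu']
    simp only [map_mul, map_add, map_sub, hc]
    ring

end

/-! ### Extensions inside the fibre over 2x -/

section
variable {X : Scheme.{u}} {x : X} [IsDomain (X.presheaf.stalk x)]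
  [IsDiscreteValuationRing (X.presheaf.stalk x)] {F : X.Modules} {ϖ : X.presheaf.stalk x}
  (hϖ : Irreducible ϖ)
include hϖ

theorem pow_smul_top_eq {r : ℕ} (e : Module.Basis (Fin r) (X.presheaf.stalk x)
    (F.presheaf.stalk x)) (k : ℕ) :
    (maximalIdeal (X.presheaf.stalk x) ^ k • ⊤ : Submodule (X.presheaf.stalk x)
      (F.presheaf.stalk x)) = expSub ϖ e fun _ => k := by
  rw [← span_smul_top, hϖ.maximalIdeal_eq]

theorem stalkLift_map_expSub {r : ℕ} (e : Module.Basis (Fin r) (X.presheaf.stalk x)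
    (F.presheaf.stalk x)) {a : Fin r → ℕ} (ha : ∀ i, a i ≤ 1) :
    stalkLift ((expSub ϖ e a).map (maximalIdeal (X.presheaf.stalk x) • ⊤ :
      Submodule (X.presheaf.stalk x) (F.presheaf.stalk x)).mkQ) = expSub ϖ e a := by
  have h1 := pow_smul_top_eq hϖ e 1
  rw [pow_one] at h1
  rw [stalkLift_map, sup_eq_right, h1]
  exact expSub_anti ha

theorem comap_map_mk2_expSub {r : ℕ} (e : Module.Basis (Fin r) (X.presheaf.stalk x)
    (F.presheaf.stalk x)) {a : Fin r → ℕ} (ha : ∀ i, a i ≤ 2) :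
    ((expSub ϖ e a).map (mk2 F x)).comap (mk2 F x) = expSub ϖ e a := by
  rw [comap_map_mk2, sup_eq_right, pow_smul_top_eq hϖ e 2]
  exact expSub_anti ha

theorem length_map_flagExp {r : ℕ} (e : Module.Basis (Fin r) (X.presheaf.stalk x)
    (F.presheaf.stalk x)) {w : ℕ} (hw : w ≤ r) :
    Module.length (X.presheaf.stalk x) ((expSub ϖ e (flagExp r w)).map
      (maximalIdeal (X.presheaf.stalk x) • ⊤ :
        Submodule (X.presheaf.stalk x) (F.presheaf.stalk x)).mkQ) = w := by
  rw [length_map_mkQ_maximalIdeal hϖ, lengthMod, length_map_expSub hϖ e flagExp_le, sum_flagExp hw]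

theorem length_fiber {r : ℕ} (e : Module.Basis (Fin r) (X.presheaf.stalk x)
    (F.presheaf.stalk x)) :
    Module.length (X.presheaf.stalk x) (⊤ : Submodule (X.presheaf.stalk x) (fiber F x)) = r := by
  have h1 := length_map_flagExp hϖ e le_rfl
  have h2 : flagExp r r = 0 := funext fun i => if_pos i.2
  rwa [h2, expSub_zero, Submodule.map_top, Submodule.range_mkQ] at h1

theorem IsExtension.exists_basis {r : ℕ} (e : Module.Basis (Fin r) (X.presheaf.stalk x)
    (F.presheaf.stalk x)) {P : Submodule (X.presheaf.stalk x) (fiber2 F x)}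
    {G W : Submodule (X.presheaf.stalk x) (fiber F x)} (h : IsExtension P G W) (hWG : W ≤ G)
    {g w : ℕ} (hG : Module.length (X.presheaf.stalk x) G = g)
    (hW : Module.length (X.presheaf.stalk x) W = w) :
    ∃ f : Module.Basis (Fin r) (X.presheaf.stalk x) (F.presheaf.stalk x),
      stalkLift W = expSub ϖ f (flagExp r w) ∧ stalkLift G = expSub ϖ f (flagExp r g) ∧
      P.comap (mk2 F x) = expSub ϖ f fun i => flagExp r w i + flagExp r g i := by
  rw [isExtension_iff] at h
  refine exists_basis_of_extension hϖ e (Submodule.comap_mono hWG) ?_ ?_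
    (smul_top_le_stalkLift W) h.1 h.2
  · rw [map_stalkLift]
    exact hG
  · rw [map_stalkLift]
    exact hW

theorem exists_basis_stalkLift {r : ℕ} (e : Module.Basis (Fin r) (X.presheaf.stalk x)
    (F.presheaf.stalk x)) {W : Submodule (X.presheaf.stalk x) (fiber F x)} {w : ℕ}
    (hW : Module.length (X.presheaf.stalk x) W = w) :
    ∃ f : Module.Basis (Fin r) (X.presheaf.stalk x) (F.presheaf.stalk x),
      stalkLift W = expSub ϖ f (flagExp r w) := by
  -- The preimage of W is an extension of W by the whole of εF_x, so the adapted basis for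
  -- extensions applies.
  have h : IsExtension (W.comap (red F x)) ⊤ W := by
    rw [isExtension_iff, comap_red_comap_mk2]
    refine ⟨sup_eq_left.mpr (smul_top_le_stalkLift W), ?_⟩
    rw [inf_eq_right.mpr (smul_top_le_stalkLift W), stalkLift, Submodule.comap_top]
  obtain ⟨f, hf, -⟩ := h.exists_basis hϖ e le_top (length_fiber hϖ e) hW
  exact ⟨f, hf⟩

/-- The converse of `IsExtension.exists_basis`, used to produce attached submodules from a normal
form of L. -/
theorem isExtension_of_eq_expSub {r : ℕ} {e : Module.Basis (Fin r) (X.presheaf.stalk x)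
    (F.presheaf.stalk x)} {P : Submodule (X.presheaf.stalk x) (fiber2 F x)}
    {G W : Submodule (X.presheaf.stalk x) (fiber F x)} {g w : ℕ} (hwg : w ≤ g)
    (hW : stalkLift W = expSub ϖ e (flagExp r w)) (hG : stalkLift G = expSub ϖ e (flagExp r g))
    (hP : P.comap (mk2 F x) = expSub ϖ e fun i => flagExp r w i + flagExp r g i) :
    IsExtension P G W := by
  have h1 := pow_smul_top_eq hϖ e 1
  rw [pow_one] at h1
  rw [isExtension_iff, hP, hW, hG, h1, expSub_sup, expSub_inf, hϖ.maximalIdeal_eq]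
  have h2 := span_smul_expSub (ϖ := ϖ) (e := e) (c := flagExp r g) 1
  rw [pow_one] at h2
  rw [h2]
  -- Adding 𝔪 takes the minimum of each exponent with 1 and leaves the flag of W; intersecting with
  -- 𝔪 takes the maximum with 1 and leaves the flag of G raised by one.
  refine ⟨congrArg _ (funext fun i => ?_), congrArg _ (funext fun i => ?_)⟩ <;>
  · simp only [Pi.inf_apply, Pi.sup_apply, flagExp]
    split_ifs <;> first | rfl | omega

end

/-! ### Attached submodules and their normal forms -/

section
variable {X : Scheme.{u}} [IsIntegral X] {x : X} (p : LocalParameter x)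
  [IsDiscreteValuationRing (X.presheaf.stalk x)]
  {F : X.Modules} {V : Type u} [AddCommGroup V] [Module X.functionField V] (μ : Model F V)
  (hF : IsVectorBundle F 4) {m : ℕ}
  {L : Submodule (X.presheaf.stalk x) (fiber2 (sixBundle F x m) x)}
  {P : Submodule (X.presheaf.stalk x) (fiber2 F x)}

omit [IsDiscreteValuationRing (X.presheaf.stalk x)] in
include μ hF in
theorem Model.exists_basis_stalk : Nonempty (Module.Basis (Fin 4) (X.presheaf.stalk x)
    (F.presheaf.stalk x)) := by
  obtain ⟨U, hx, b, hb⟩ := μ.locallyFree hF x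
  obtain ⟨e, -⟩ := (hb x hx).exists_basis
  exact ⟨e⟩

/-- In a basis adapted to the extension the exponents of P are the sum of two flag exponents, here
those of a plane and of the whole fibre. The exponents of L then follow by computing `wedgeExp`. The
other three types are treated alike. -/
theorem Attached1.exists_basis (h : Attached1 L P) :
    ∃ e : Module.Basis (Fin 4) (X.presheaf.stalk x) (F.presheaf.stalk x),
      P.comap (mk2 F x) = expSub p.ϖ e ![0, 0, 1, 1] ∧
      μ.sixLattice p hF L = expSub p.ϖ (pairBasis e) ![0, 1, 1, 1, 1, 2] := by
  obtain ⟨e⟩ := μ.exists_basis_stalk hF (x := x)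
  obtain ⟨K, hK, hP, rfl⟩ := h
  obtain ⟨f, -, -, hf⟩ := hP.exists_basis p.irreducible e le_top (length_fiber p.irreducible e) hK
  have h1 : (fun i : Fin 4 => flagExp 4 2 i + flagExp 4 4 i) = ![0, 0, 1, 1] := by decide
  rw [h1] at hf
  refine ⟨f, hf, (μ.sixLattice_wedgeIn_of_eq p hF f hf hf).trans (congrArg _ ?_)⟩
  decide

theorem Attached2.exists_basis (h : Attached2 L P) :
    ∃ e : Module.Basis (Fin 4) (X.presheaf.stalk x) (F.presheaf.stalk x),
      P.comap (mk2 F x) = expSub p.ϖ e ![0, 1, 1, 2] ∧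
      μ.sixLattice p hF L = expSub p.ϖ (pairBasis e) ![0, 0, 1, 1, 2, 2] := by
  obtain ⟨e⟩ := μ.exists_basis_stalk hF (x := x)
  obtain ⟨D, W, hD, hW, hDW, hP, rfl⟩ := h
  obtain ⟨f, -, hfW, hf⟩ := hP.exists_basis p.irreducible e hDW hW hD
  have h1 : (fun i : Fin 4 => flagExp 4 1 i + flagExp 4 3 i) = ![0, 1, 1, 2] := by decide
  rw [h1] at hf
  refine ⟨f, hf, (μ.sixLattice_wedgeIn_of_eq p hF f hf
    ((comap_red_comap_mk2 W).trans hfW)).trans (congrArg _ ?_)⟩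
  decide

theorem Attached30.exists_basis (h : Attached30 L P) :
    ∃ e : Module.Basis (Fin 4) (X.presheaf.stalk x) (F.presheaf.stalk x),
      P.comap (mk2 F x) = expSub p.ϖ e ![0, 0, 0, 2] ∧
      μ.sixLattice p hF L = expSub p.ϖ (pairBasis e) ![0, 0, 2, 0, 2, 2] := by
  obtain ⟨e⟩ := μ.exists_basis_stalk hF (x := x)
  obtain ⟨W, hW, hP, rfl⟩ := h
  obtain ⟨f, -, -, hf⟩ := hP.exists_basis p.irreducible e le_rfl hW hW
  have h1 : (fun i : Fin 4 => flagExp 4 3 i + flagExp 4 3 i) = ![0, 0, 0, 2] := by decide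
  rw [h1] at hf
  refine ⟨f, hf, (μ.sixLattice_wedgeIn_of_eq p hF f hf hf).trans (congrArg _ ?_)⟩
  decide

theorem Attached31.exists_basis (h : Attached31 L P) :
    ∃ e : Module.Basis (Fin 4) (X.presheaf.stalk x) (F.presheaf.stalk x),
      P.comap (mk2 F x) = expSub p.ϖ e ![0, 2, 2, 2] ∧
      μ.sixLattice p hF L = expSub p.ϖ (pairBasis e) ![0, 0, 0, 2, 2, 2] := by
  obtain ⟨e⟩ := μ.exists_basis_stalk hF (x := x)
  obtain ⟨D, hD, hP, rfl⟩ := h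
  obtain ⟨f, -, -, hf⟩ := hP.exists_basis p.irreducible e le_rfl hD hD
  have h1 : (fun i : Fin 4 => flagExp 4 1 i + flagExp 4 1 i) = ![0, 2, 2, 2] := by decide
  rw [h1] at hf
  refine ⟨f, hf, (μ.sixLattice_wedgeIn_of_eq p hF f hf (b := 0) ?_).trans (congrArg _ ?_)⟩
  · rw [Submodule.comap_top, expSub_zero]
  · decide

variable {e : Module.Basis (Fin 4) (X.presheaf.stalk x) (F.presheaf.stalk x)}

/-- P is defined by the exponents of the extension in the basis e, and K is the span of the classes
of the first two vectors. As L and P ∧ P have the same lattice, they are equal. The remaining three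
types follow the same pattern with other flags. -/
theorem exists_attached1
    (h : μ.sixLattice p hF L = expSub p.ϖ (pairBasis e) ![0, 1, 1, 1, 1, 2]) :
    ∃ P, Attached1 L P := by
  have hP := comap_map_mk2_expSub p.irreducible e (a := fun i => flagExp 4 2 i + flagExp 4 4 i)
    (by decide)
  refine ⟨_, _, length_map_flagExp p.irreducible e (w := 2) (by decide),
    isExtension_of_eq_expSub p.irreducible (w := 2) (g := 4) (by decide)
      (stalkLift_map_expSub p.irreducible e flagExp_le) ?_ hP,
    μ.sixLattice_injective p hF (h.trans ?_)⟩
  · have h1 : flagExp 4 4 = 0 := by decide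
    rw [h1, expSub_zero, stalkLift, Submodule.comap_top]
  · rw [μ.sixLattice_wedgeIn_of_eq p hF e hP hP]
    refine congrArg _ ?_
    decide

theorem exists_attached2
    (h : μ.sixLattice p hF L = expSub p.ϖ (pairBasis e) ![0, 0, 1, 1, 2, 2]) :
    ∃ P, Attached2 L P := by
  have hP := comap_map_mk2_expSub p.irreducible e (a := fun i => flagExp 4 1 i + flagExp 4 3 i)
    (by decide)
  have hW := stalkLift_map_expSub p.irreducible e (flagExp_le (w := 3))
  refine ⟨_, _, _, length_map_flagExp p.irreducible e (w := 1) (by decide),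
    length_map_flagExp p.irreducible e (w := 3) (by decide),
    Submodule.map_mono (expSub_anti (by decide)),
    isExtension_of_eq_expSub p.irreducible (w := 1) (g := 3) (by decide)
      (stalkLift_map_expSub p.irreducible e flagExp_le) hW hP,
    μ.sixLattice_injective p hF (h.trans ?_)⟩
  rw [μ.sixLattice_wedgeIn_of_eq p hF e hP ((comap_red_comap_mk2 _).trans hW)]
  refine congrArg _ ?_
  decide

theorem exists_attached30
    (h : μ.sixLattice p hF L = expSub p.ϖ (pairBasis e) ![0, 0, 2, 0, 2, 2]) :
    ∃ P, Attached30 L P := by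
  have hP := comap_map_mk2_expSub p.irreducible e (a := fun i => flagExp 4 3 i + flagExp 4 3 i)
    (by decide)
  have hW := stalkLift_map_expSub p.irreducible e (flagExp_le (w := 3))
  refine ⟨_, _, length_map_flagExp p.irreducible e (w := 3) (by decide),
    isExtension_of_eq_expSub p.irreducible (w := 3) (g := 3) (by decide) hW hW hP,
    μ.sixLattice_injective p hF (h.trans ?_)⟩
  rw [μ.sixLattice_wedgeIn_of_eq p hF e hP hP]
  refine congrArg _ ?_
  decide

theorem exists_attached31
    (h : μ.sixLattice p hF L = expSub p.ϖ (pairBasis e) ![0, 0, 0, 2, 2, 2]) :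
    ∃ P, Attached31 L P := by
  have hP := comap_map_mk2_expSub p.irreducible e (a := fun i => flagExp 4 1 i + flagExp 4 1 i)
    (by decide)
  have hD := stalkLift_map_expSub p.irreducible e (flagExp_le (w := 1))
  refine ⟨_, _, length_map_flagExp p.irreducible e (w := 1) (by decide),
    isExtension_of_eq_expSub p.irreducible (w := 1) (g := 1) (by decide) hD hD hP,
    μ.sixLattice_injective p hF (h.trans ?_)⟩
  rw [μ.sixLattice_wedgeIn_of_eq p hF e hP (b := 0) (by rw [Submodule.comap_top, expSub_zero])]
  refine congrArg _ ?_
  decide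

theorem Model.sixLattice_sup {c d : Fin 6 → ℕ} (hcd : c ⊓ (fun _ => 1) = d)
    (h : μ.sixLattice p hF L = expSub p.ϖ (pairBasis e) c) :
    μ.sixLattice p hF L ⊔ maximalIdeal (X.presheaf.stalk x) • ⊤ = expSub p.ϖ (pairBasis e) d := by
  have h1 : (maximalIdeal (X.presheaf.stalk x) • ⊤ : Submodule (X.presheaf.stalk x)
      (⋀[X.presheaf.stalk x]^2 (F.presheaf.stalk x))) =
      expSub p.ϖ (pairBasis e) (fun _ => 1) := by
    rw [← span_smul_top, pow_one, p.irreducible.maximalIdeal_eq]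
    rfl
  rw [h, h1, expSub_sup, hcd]

variable (b : OrthogonalForm (sixBundle F x m))

/-- A hyperplane of the fibre is the span of the classes of the first three vectors of a suitable
basis, so the condition on the image of L becomes one on exponents modulo ϖ. -/
theorem mem_OSigma30_iff : L ∈ OSigma30 b ↔ L ∈ OSigma b x 3 ∧
    ∃ e : Module.Basis (Fin 4) (X.presheaf.stalk x) (F.presheaf.stalk x),
      μ.sixLattice p hF L ⊔ maximalIdeal (X.presheaf.stalk x) • ⊤ =
        expSub p.ϖ (pairBasis e) ![0, 0, 1, 0, 1, 1] := by
  have key {W : Submodule (X.presheaf.stalk x) (fiber F x)}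
      {e : Module.Basis (Fin 4) (X.presheaf.stalk x) (F.presheaf.stalk x)}
      (hW : stalkLift W = expSub p.ϖ e (flagExp 4 3)) :=
    μ.sixLattice_sup p hF (d := ![0, 0, 1, 0, 1, 1]) (by decide)
      (μ.sixLattice_wedgeIn_of_eq p hF (m := m) e ((comap_red_comap_mk2 W).trans hW)
        ((comap_red_comap_mk2 W).trans hW))
  refine and_congr_right fun _ => ⟨fun ⟨W, hW, h⟩ => ?_, fun ⟨e, he⟩ => ?_⟩
  · obtain ⟨e⟩ := μ.exists_basis_stalk hF (x := x)
    obtain ⟨f, hf⟩ := exists_basis_stalkLift p.irreducible e hW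
    exact ⟨f, ((μ.map_red_eq_map_red_iff p hF).mp h).trans (key hf)⟩
  · exact ⟨_, length_map_flagExp p.irreducible e (w := 3) (by decide),
      (μ.map_red_eq_map_red_iff p hF).mpr
        (he.trans (key (stalkLift_map_expSub p.irreducible e flagExp_le)).symm)⟩

theorem mem_OSigma31_iff : L ∈ OSigma31 b ↔ L ∈ OSigma b x 3 ∧
    ∃ e : Module.Basis (Fin 4) (X.presheaf.stalk x) (F.presheaf.stalk x),
      μ.sixLattice p hF L ⊔ maximalIdeal (X.presheaf.stalk x) • ⊤ =
        expSub p.ϖ (pairBasis e) ![0, 0, 0, 1, 1, 1] := by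
  have key {D : Submodule (X.presheaf.stalk x) (fiber F x)}
      {e : Module.Basis (Fin 4) (X.presheaf.stalk x) (F.presheaf.stalk x)}
      (hD : stalkLift D = expSub p.ϖ e (flagExp 4 1)) :=
    μ.sixLattice_sup p hF (d := ![0, 0, 0, 1, 1, 1]) (by decide)
      (μ.sixLattice_wedgeIn_of_eq p hF (m := m) e (Q := ⊤) (b := 0)
        ((comap_red_comap_mk2 D).trans hD) (by rw [Submodule.comap_top, expSub_zero]))
  refine and_congr_right fun _ => ⟨fun ⟨D, hD, h⟩ => ?_, fun ⟨e, he⟩ => ?_⟩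
  · obtain ⟨e⟩ := μ.exists_basis_stalk hF (x := x)
    obtain ⟨f, hf⟩ := exists_basis_stalkLift p.irreducible e hD
    exact ⟨f, ((μ.map_red_eq_map_red_iff p hF).mp h).trans (key hf)⟩
  · exact ⟨_, length_map_flagExp p.irreducible e (w := 1) (by decide),
      (μ.map_red_eq_map_red_iff p hF).mpr
        (he.trans (key (stalkLift_map_expSub p.irreducible e flagExp_le)).symm)⟩

end

theorem isUnit_two_stalk {K : Type u} [Field K] (hK : (2 : K) ≠ 0) {X : Scheme.{u}}
    (f : X ⟶ Spec (CommRingCat.of K)) (x : X) : IsUnit (2 : X.presheaf.stalk x) := by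
  let φ : CommRingCat.of K ⟶ X.presheaf.stalk x :=
    (Scheme.ΓSpecIso (CommRingCat.of K)).inv ≫ f.appTop ≫ X.presheaf.germ ⊤ x trivial
  have h1 : IsUnit (2 : K) := isUnit_iff_ne_zero.mpr hK
  exact (map_ofNat φ.hom 2) ▸ h1.map φ.hom

end
end OrthHecke

/-! ### The theorem -/

theorem mainTheorem12 {K : Type u} [Field K] [IsAlgClosed K] (hK : (2 : K) ≠ 0)
    {X : Scheme.{u}} (f : X ⟶ Spec (CommRingCat.of K)) [SmoothOfRelativeDimension 1 f]
    [IsProper f] [IsIntegral X] (x : X) (hx : IsClosed ({x} : Set X))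
    (F : X.Modules) (hF : IsVectorBundle F 4) (m : ℕ) (hm : m = 0 ∨ m = 1)
    (δ : extPower F 4 ≅ twistNeg (structureModule X) x (2 * m))
    (b : OrthogonalForm (sixBundle F x m)) (hb : IsWedgeForm δ b)
    (L : Submodule (X.presheaf.stalk x) (fiber2 (sixBundle F x m) x)) :
    (L ∈ OSigma b x 1 → (∃ P, Attached1 L P) ∧ ∀ P, Attached1 L P →
      (m = 0 → HeckeIs b L P 0 1) ∧ (m = 1 → HeckeIs b L P 1 0)) ∧
    (L ∈ OSigma b x 2 → (∃ P, Attached2 L P) ∧ ∀ P, Attached2 L P →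
      (m = 0 → HeckeIs b L P 1 0) ∧ (m = 1 → HeckeIs b L P 1 1)) ∧
    (L ∈ OSigma b x 3 → (L ∈ OSigma30 b ∨ L ∈ OSigma31 b) ∧ ¬(L ∈ OSigma30 b ∧ L ∈ OSigma31 b)) ∧
    (L ∈ OSigma30 b → (∃ P, Attached30 L P) ∧ ∀ P, Attached30 L P →
      (m = 0 → HeckeIs b L P 0 1) ∧ (m = 1 → HeckeIs b L P 1 0)) ∧
    (L ∈ OSigma31 b → (∃ P, Attached31 L P) ∧ ∀ P, Attached31 L P →
      (m = 0 → HeckeIs b L P 1 1) ∧ (m = 1 → HeckeIs b L P 2 0)) := by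
  have _ : Smooth f := SmoothOfRelativeDimension.smooth 1 f
  have _ := LocallyOfFiniteType.isLocallyNoetherian f
  have hdvr : IsDiscreteValuationRing (X.presheaf.stalk x) := isDiscreteValuationRing_stalk f x hx
  obtain ⟨U, hxU, t, ht, hU⟩ := exists_uniformizer x hx
  let p : LocalParameter x := ⟨hx, U, hxU, t, ht, hU⟩
  -- The ambient space is the generic stalk of F itself.
  let μ : Model F (genericStalk F) := ⟨hF.torsionFree, .refl _ _⟩
  obtain ⟨e⟩ := μ.exists_basis_stalk hF (x := x)
  have hlat {i : ℕ} (hL : L ∈ OSigma b x i) :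
      (∃ D, IsotropicLattice p.ϖ D (μ.sixLattice p hF L)) ∧
        lengthMod p.ϖ 2 (μ.sixLattice p hF L) = 6 ∧ lengthMod p.ϖ 1 (μ.sixLattice p hF L) = i :=
    ⟨exists_isotropicLattice p μ hF δ hb (isUnit_two_stalk hK f x) hL.1,
      (μ.length_eq_lengthMod p hF).symm.trans hL.1.2, (μ.length_map_red p hF).symm.trans hL.2⟩
  have h3 (hL : L ∈ OSigma b x 3) :
      ∃ g, μ.sixLattice p hF L = expSub p.ϖ (pairBasis g) ![0, 0, 2, 0, 2, 2] ∨
        μ.sixLattice p hF L = expSub p.ϖ (pairBasis g) ![0, 0, 0, 2, 2, 2] := by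
    obtain ⟨⟨D, hD⟩, h6, hi⟩ := hlat hL
    exact hD.exists_eq_of_length_eq_three e h6 hi
  have hne {g g'} (h : μ.sixLattice p hF L ⊔ maximalIdeal (X.presheaf.stalk x) • ⊤ =
        expSub p.ϖ (pairBasis g) ![0, 0, 1, 0, 1, 1])
      (h' : μ.sixLattice p hF L ⊔ maximalIdeal (X.presheaf.stalk x) • ⊤ =
        expSub p.ϖ (pairBasis g') ![0, 0, 0, 1, 1, 1]) : False :=
    expSub_hyperplane_ne_expSub_line p.irreducible g g' (h.symm.trans h')
  refine ⟨fun hL => ⟨?_, fun P hP => ?_⟩, fun hL => ⟨?_, fun P hP => ?_⟩, fun hL => ⟨?_, ?_⟩,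
    fun hL => ⟨?_, fun P hP => ?_⟩, fun hL => ⟨?_, fun P hP => ?_⟩⟩
  · obtain ⟨⟨D, hD⟩, h6, hi⟩ := hlat hL
    obtain ⟨g, hg⟩ := hD.exists_eq_of_length_eq_one e h6 hi
    exact exists_attached1 p μ hF hg
  · obtain ⟨g, hg, hL⟩ := hP.exists_basis p μ hF
    -- With m, a and c fixed, both exponent identities become finite numerical checks.
    constructor <;> rintro rfl <;>
      exact heckeIs_of_eq_expSub p μ hF δ hb hg hL (by decide) (by decide)
  · obtain ⟨⟨D, hD⟩, h6, hi⟩ := hlat hL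
    obtain ⟨g, hg⟩ := hD.exists_eq_of_length_eq_two e h6 hi
    exact exists_attached2 p μ hF hg
  · obtain ⟨g, hg, hL⟩ := hP.exists_basis p μ hF
    constructor <;> rintro rfl <;>
      exact heckeIs_of_eq_expSub p μ hF δ hb hg hL (by decide) (by decide)
  · rw [mem_OSigma30_iff p μ hF, mem_OSigma31_iff p μ hF]
    obtain ⟨g, hg | hg⟩ := h3 hL
    · exact .inl ⟨hL, g, μ.sixLattice_sup p hF (by decide) hg⟩
    · exact .inr ⟨hL, g, μ.sixLattice_sup p hF (by decide) hg⟩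
  · rw [mem_OSigma30_iff p μ hF, mem_OSigma31_iff p μ hF]
    rintro ⟨⟨-, g, hg⟩, -, g', hg'⟩
    exact hne hg hg'
  · obtain ⟨hL, g', hg'⟩ := (mem_OSigma30_iff p μ hF b).mp hL
    obtain ⟨g, hg | hg⟩ := h3 hL
    · exact exists_attached30 p μ hF hg
    -- The other normal form would make the image of L in the fibre of the form D ∧ F_x, which is
    -- never Λ²W.
    · exact (hne hg' (μ.sixLattice_sup p hF (by decide) hg)).elim
  · obtain ⟨g, hg, hL⟩ := hP.exists_basis p μ hF
    constructor <;> rintro rfl <;>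
      exact heckeIs_of_eq_expSub p μ hF δ hb hg hL (by decide) (by decide)
  · obtain ⟨hL, g', hg'⟩ := (mem_OSigma31_iff p μ hF b).mp hL
    obtain ⟨g, hg | hg⟩ := h3 hL
    · exact (hne (μ.sixLattice_sup p hF (by decide) hg) hg').elim
    · exact exists_attached31 p μ hF hg
  · obtain ⟨g, hg, hL⟩ := hP.exists_basis p μ hF
    constructor <;> rintro rfl <;>
      exact heckeIs_of_eq_expSub p μ hF δ hb hg hL (by decide) (by decide)
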